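/- Let $E/F$ be an unramified quadratic extension of non-archimedean local fields of odd residue characteristic, with non-trivial automorphism $z\mapsto\bar z$. Let $\mathcal O_E$ be the ring of integers of $E$, let $|\cdot|_F$ be the normalized absolute value of $F$, and let $\omega_{E/F}$ be the quadratic character of $F^\times$ with kernel $\mathrm{Nm}(E^\times)$. For $d=1,2$ let $V_d$ be a Hermitian space of dimension $d$ over $E$ with a self-dual $\mathcal O_E$-lattice $\Lambda_d$. **Orbits.** For Hermitian spaces $W_1,W_2$ of the same dimension, $U(W_1)\times U(W_2)$ acts on $\mathrm{Hom}_E(W_2,W_1)$ by $(g,h)\cdot X=gXh^{-1}$. Put $r(X)=-XX^*\in \mathcal{H}erm(W_1)$ (the self-adjoint operators). $X$ is regular semisimple if $\begin{pmatrix}0&X\\-X^*&0\end{pmatrix}$ has a separable characteristic polynomial; $X$ and $X'$ are stably conjugate if $X'=gXh^{-1}$ and $X'^*=hX^*g^{-1}$ for some $g\in GL(W_1)$, $h\in GL(W_2)$. For one-dimensional Hermitian spaces $V_\alpha,V_\beta$ over $E$, consider the componentwise action of $(U(V_1)\times U(V_\alpha))\times(U(V_1)\times U(V_\beta))$ on $\mathrm{Hom}(V_\alpha,V_1)\oplus\mathrm{Hom}(V_\beta,V_1)$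 (stable conjugacy is componentwise), and call $(x_a,x_b)$ regular semisimple if $x_a,x_b$ are and the eigenvalues $c_a,c_b\in F$ of $r(x_a),r(x_b)$ are distinct. A regular semisimple $x\in\mathrm{End}(V_2)$ matches $(x_a,x_b)$ if $r(x)$ is conjugate to $r(x_a)\oplus r(x_b)$ by an $E$-linear isomorphism $V_2\cong V_1\oplus V_1$. **The character $\kappa$.** Suppose $x$ matches $(x_a,x_b)$ and put $\delta=r(x)$. Let $\delta'$ be a self-adjoint operator on a Hermitian space $V'$ with $\delta'=P\delta P^{-1}$ for an $E$-linear isomorphism $P:V_2\to V'$. Then $P^{-1}(P^{*})^{-1}$, which is the value at the non-trivial element of $\mathrm{Gal}(E/F)$ of the cocycle $\sigma\mapsto P^{-1}\sigma(P)$ representing $\mathrm{inv}(\delta,\delta')$, acts on the $c_b$-eigenline of $\delta$ by a scalar $s\in F^\times$, and $\kappa(\mathrm{inv}(\delta,\delta')):=\omega_{E/F}(s)$, which does not depend on $P$. (Thus $\kappa$ is trivial on the $a$-factor and non-trivial on the $b$-factor of $H^1(F,T_\delta)=(\mathbb Z/2\mathbb Z)^2$, where $T_\delta$ is the centralizer of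 $\delta$ in $U(V_2)$.) **Transfer factor.** For matching $x$ and $(x_a,x_b)$, with $\delta'=r(x_a)\oplus r(x_b)$ on $V_1\oplus V_1$, $$\Delta_{rel}((x_a,x_b),x)=\kappa(\mathrm{inv}(r(x),\delta'))\,\omega_{E/F}(c_a-c_b)\,|c_a-c_b|_F .$$ **Orbital integrals.** Give $U(V_2)$ the Haar measure for which the stabilizer of $\Lambda_2$ has volume $1$, give each unitary group in one variable total volume $1$, and give products the product measures. For a group $G$ as above and a regular semisimple $x$ whose stabilizer $G_x$ is compact (as it is for all elements occurring in a matching pair), let $\mathrm{RO}(x,f)=\int_{G_x\backslash G}f(g^{-1}\cdot x)\,d\dot g$ with the quotient measure by the Haar measure of total volume $1$ on $G_x$. For $x$ matching $(x_a,x_b)$ put $$\mathrm{RO}^\kappa(x,f)=\sum_{x'}\kappa(\mathrm{inv}(r(x),r(x')))\,\mathrm{RO}(x',f),\qquad \mathrm{SRO}((x_a,x_b),f')=\sum_{y'}\mathrm{RO}(y',f'),$$ where $x'$, respectively $y'$, runs over representatives of the orbits in the stable conjugacy class of $x$, respectively of $(x_a,x_b)$. Functions $f\in C_c^\infty(\mathrm{End}(V_2))$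 and $f'\in C_c^\infty(\mathrm{Hom}(V_\alpha,V_1)\oplus\mathrm{Hom}(V_\beta,V_1))$ *match* if, for every regular semisimple $(x_a,x_b)$, 1. $\mathrm{SRO}((x_a,x_b),f')=\Delta_{rel}((x_a,x_b),x)\,\mathrm{RO}^\kappa(x,f)$ for every regular semisimple $x$ matching $(x_a,x_b)$; 2. $\mathrm{SRO}((x_a,x_b),f')=0$ if no regular semisimple $x$ matches $(x_a,x_b)$. **Theorem** (relative fundamental lemma for $(U(4),U(2)\times U(2))$ and the endoscopic space $\mathrm{End}(V_1)\oplus\mathrm{End}(V_1)$). * For the split pair $V_\alpha=V_\beta=V_1$, the functions $\mathbf 1_{\mathrm{End}(\Lambda_2)}$ and $\mathbf 1_{\mathrm{End}(\Lambda_1)}\otimes\mathbf 1_{\mathrm{End}(\Lambda_1)}$ match. * If $V_\alpha$ and $V_\beta$ are not both isometric to $V_1$, then $\mathbf 1_{\mathrm{End}(\Lambda_2)}$ matches $0$. -/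

import Mathlib

open MeasureTheory ValuativeRel
open scoped Matrix ENNReal

noncomputable section

/-! ## Relative orbital integrals for a group action -/

section OrbitalIntegrals

variable {G X : Type*} [Group G] [TopologicalSpace G] [MeasurableSpace G] [MulAction G X]

/-- A Haar measure on `H` is normalized when the maximal compact subgroups have volume one
(if `H` is compact: when its total volume is one). -/
def IsNormalizedHaar {H : Type*} [Group H] [TopologicalSpace H] [MeasurableSpace H]
    (τ : Measure H) : Prop :=
  τ.IsHaarMeasure ∧
    ∀ K : Subgroup H, Maximal (fun L : Subgroup H => IsCompact (L : Set H)) K →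
      τ (K : Set H) = 1

/-- The space `G_x \ G` of right cosets of the stabilizer of `x`. -/
abbrev StabQuot (G : Type*) {X : Type*} [Group G] [MulAction G X] (x : X) : Type _ :=
  Quotient (QuotientGroup.rightRel (MulAction.stabilizer G x))

/-- `ν` is the quotient measure on `G_x \ G` of `dg = μ` by the normalized Haar measure `dt` of
the stabilizer: `∫_G φ(g) dg = ∫_{G_x \ G} ∫_{G_x} φ(t g) dt dν`. -/
def IsQuotientMeasure (μ : Measure G) (x : X) (ν : Measure (StabQuot G x)) : Prop :=
  ∃ τ : Measure (MulAction.stabilizer G x), IsNormalizedHaar τ ∧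
    ∀ φ : G → ℝ≥0∞, Measurable φ →
      ∫⁻ g, φ g ∂μ = ∫⁻ q, (∫⁻ t, φ ((t : G) * Quotient.out q) ∂τ) ∂ν

/-- The quotient measure on `G_x \ G`. -/
def quotientMeasure (μ : Measure G) (x : X) : Measure (StabQuot G x) :=
  Classical.epsilon (IsQuotientMeasure μ x)

/-- The orbital integral `RO(x, f) = ∫_{G_x \ G} f(g⁻¹ • x) dg`. -/
def orbitalIntegral (μ : Measure G) (x : X) (f : X → ℂ) : ℂ :=
  ∫ q : StabQuot G x, f ((Quotient.out q)⁻¹ • x) ∂(quotientMeasure μ x)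

/-- `∑ κ(x, x') RO(x', f)`, where `x'` runs over representatives of the `G`-orbits in the stable
class `st x` of `x`. -/
def kappaOrbitalIntegral (μ : Measure G) (st : X → X → Prop) (κ : X → X → ℂ)
    (x : X) (f : X → ℂ) : ℂ :=
  ∑ᶠ o : {o : MulAction.orbitRel.Quotient G X // st x (Quotient.out o)},
    κ x (Quotient.out o.1) * orbitalIntegral μ (Quotient.out o.1) f

/-- The stable orbital integral: `κ = 1`. -/
def stableOrbitalIntegral (μ : Measure G) (st : X → X → Prop) (x : X) (f : X → ℂ) : ℂ :=
  kappaOrbitalIntegral μ st (fun _ _ => 1) x f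

end OrbitalIntegrals

/-- If the stabilizer of `x` is compact, the quotient measure exists and is unique. -/
theorem isQuotientMeasure_iff {G X : Type*} [Group G] [TopologicalSpace G] [IsTopologicalGroup G]
    [SecondCountableTopology G] [T2Space G]
    [MeasurableSpace G] [BorelSpace G] [MulAction G X] (μ : Measure G) [μ.IsHaarMeasure]
    [SFinite μ] (x : X) [CompactSpace (MulAction.stabilizer G x)] (ν : Measure (StabQuot G x)) :
    IsQuotientMeasure μ x ν ↔ ν = μ.map (fun g => (Quotient.mk _ g : StabQuot G x)) := by
  have hπ : Measurable (fun g => (Quotient.mk _ g : StabQuot G x)) := measurable_quotient_mk''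
  have hout : ∀ g : G, ∃ h : MulAction.stabilizer G x,
      Quotient.out (Quotient.mk _ g : StabQuot G x) = (h : G) * g := by
    intro g
    have h1 : (QuotientGroup.rightRel (MulAction.stabilizer G x))
        (Quotient.out (Quotient.mk _ g : StabQuot G x)) g := Quotient.exact (Quotient.out_eq _)
    rw [QuotientGroup.rightRel_apply] at h1
    refine ⟨⟨_, inv_mem h1⟩, by simp⟩
  constructor
  · rintro ⟨τ, ⟨hτ, hτ1⟩, hW⟩
    have hmax : τ Set.univ = 1 := by
      have := hτ1 ⊤ ⟨by simpa using isCompact_univ, fun L _ _ => le_top⟩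
      simpa using this
    ext A hA
    rw [Measure.map_apply hπ hA]
    have h2 := hW ((fun g => (Quotient.mk _ g : StabQuot G x)) ⁻¹' A |>.indicator 1)
      (measurable_one.indicator (hπ hA))
    rw [lintegral_indicator_one (hπ hA)] at h2
    rw [h2, ← lintegral_indicator_one hA]
    congr 1
    funext q
    have h3 : ∀ t : MulAction.stabilizer G x,
        (Quotient.mk _ ((t : G) * Quotient.out q) : StabQuot G x) = q := by
      intro t
      conv_rhs => rw [← Quotient.out_eq q]
      apply Quotient.sound
      change (QuotientGroup.rightRel (MulAction.stabilizer G x)) _ _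
      rw [QuotientGroup.rightRel_apply]
      simp
    have h4 : ∀ t : MulAction.stabilizer G x,
        ((fun g => (Quotient.mk _ g : StabQuot G x)) ⁻¹' A).indicator (1 : G → ℝ≥0∞)
          ((t : G) * Quotient.out q) = A.indicator 1 q := by
      intro t
      by_cases hq : q ∈ A
      · rw [Set.indicator_of_mem hq, Set.indicator_of_mem]
        · rfl
        · simpa [h3] using hq
      · rw [Set.indicator_of_notMem hq, Set.indicator_of_notMem]
        simpa [h3] using hq
    simp only [h4, lintegral_const, hmax, mul_one]
  · rintro rfl
    have : SecondCountableTopology (MulAction.stabilizer G x) :=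
      TopologicalSpace.Subtype.secondCountableTopology (MulAction.stabilizer G x : Set G)
    let K₀ : TopologicalSpace.PositiveCompacts (MulAction.stabilizer G x) := ⊤
    let τ : Measure (MulAction.stabilizer G x) := Measure.haarMeasure K₀
    have hτu : τ Set.univ = 1 := Measure.haarMeasure_self (K₀ := K₀)
    have hτr : τ.IsMulRightInvariant := by
      refine ⟨fun h => ?_⟩
      have hp : IsProbabilityMeasure (τ.map (fun t => t * h)) :=
        have : IsProbabilityMeasure τ := ⟨hτu⟩
        Measure.isProbabilityMeasure_map (by fun_prop)
      have h1 := Measure.haarMeasure_unique (τ.map (fun t => t * h)) K₀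
      have h2 : τ.map (fun t => t * h) (K₀ : Set (MulAction.stabilizer G x)) = 1 :=
        hp.measure_univ
      rw [h1, h2, one_smul]
    refine ⟨τ, ⟨inferInstance, ?_⟩, ?_⟩
    · intro K hK
      have : K = ⊤ := top_le_iff.mp (hK.2 (by simpa using isCompact_univ) le_top)
      subst this
      simpa using hτu
    · intro φ hφ
      have hF : ∀ g : G, ∫⁻ t : MulAction.stabilizer G x,
          φ ((t : G) * Quotient.out (Quotient.mk _ g : StabQuot G x)) ∂τ =
          ∫⁻ t : MulAction.stabilizer G x, φ ((t : G) * g) ∂τ := by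
        intro g
        obtain ⟨h, hh⟩ := hout g
        rw [hh]
        have := lintegral_mul_right_eq_self (μ := τ) (fun t => φ ((t : G) * g)) h
        simpa [mul_assoc] using this
      have hm : Measurable (fun p : G × MulAction.stabilizer G x => φ ((p.2 : G) * p.1)) :=
        hφ.comp ((measurable_subtype_coe.comp measurable_snd).mul measurable_fst)
      have hFm : Measurable (fun q : StabQuot G x => ∫⁻ t : MulAction.stabilizer G x,
          φ ((t : G) * Quotient.out q) ∂τ) := by
        apply measurable_from_quotient.2
        simp only [Function.comp_def]
        change Measurable (fun g => ∫⁻ t : MulAction.stabilizer G x,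
          φ ((t : G) * Quotient.out (Quotient.mk _ g : StabQuot G x)) ∂τ)
        simp only [hF]
        exact hm.lintegral_prod_right'
      rw [lintegral_map hFm hπ]
      simp only [hF]
      rw [lintegral_lintegral_swap hm.aemeasurable]
      simp only [lintegral_mul_left_eq_self, lintegral_const, hτu, mul_one]

/-- The product of two groups acts componentwise on a product. -/
instance prodProdMulAction {G H X Y : Type*} [Group G] [Group H] [MulAction G X]
    [MulAction H Y] : MulAction (G × H) (X × Y) where
  smul g x := (g.1 • x.1, g.2 • x.2)
  one_smul x := Prod.ext (one_smul G x.1) (one_smul H x.2)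
  mul_smul g h x := Prod.ext (mul_smul g.1 h.1 x.1) (mul_smul g.2 h.2 x.2)

/-! ## Hermitian spaces and the infinitesimal symmetric space -/

section Hermitian

variable {F E : Type*} [Field F] [Field E] [Algebra F E] {σ : E ≃ₐ[F] E}
variable {m n : Type*} [Fintype m] [DecidableEq m] [Fintype n] [DecidableEq n]

/-- A non-degenerate Hermitian form on `E^n` (with respect to the conjugation `σ`), given by its
Gram matrix. -/
structure HermSpace (σ : E ≃ₐ[F] E) (n : Type*) [Fintype n] [DecidableEq n] where
  gram : Matrix n n E
  isHerm : (gram.map σ)ᵀ = gram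
  nondeg : IsUnit gram.det

namespace HermSpace

/-- The Hermitian form, conjugate linear in the first variable. -/
def form (V : HermSpace σ n) (v w : n → E) : E := (fun i => σ (v i)) ⬝ᵥ (V.gram *ᵥ w)

/-- `X^* : V₁ → V₂` for a linear map `X : V₂ → V₁`. -/
def adj (V₁ : HermSpace σ m) (V₂ : HermSpace σ n) (X : Matrix m n E) : Matrix n m E :=
  V₂.gram⁻¹ * (X.map σ)ᵀ * V₁.gram

theorem form_adj (V₁ : HermSpace σ m) (V₂ : HermSpace σ n) (X : Matrix m n E)
    (v : n → E) (w : m → E) :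
    V₁.form (X *ᵥ v) w = V₂.form v (adj V₁ V₂ X *ᵥ w) := by
  have h : (fun i => σ ((X *ᵥ v) i)) = (fun i => σ (v i)) ᵥ* (X.map σ)ᵀ := by
    funext i
    simp [Matrix.mulVec, Matrix.vecMul, dotProduct, map_sum, mul_comm]
  have h2 : V₂.gram * (V₂.gram⁻¹ * (X.map σ)ᵀ * V₁.gram) = (X.map σ)ᵀ * V₁.gram := by
    rw [Matrix.mul_assoc V₂.gram⁻¹, Matrix.mul_nonsing_inv_cancel_left _ _ V₂.nondeg]
  rw [form, form, adj, h, Matrix.mulVec_mulVec, h2, ← Matrix.dotProduct_mulVec,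
    Matrix.mulVec_mulVec]

/-- The orthogonal direct sum. -/
def sum (V₁ : HermSpace σ m) (V₂ : HermSpace σ n) : HermSpace σ (m ⊕ n) where
  gram := Matrix.fromBlocks V₁.gram 0 0 V₂.gram
  isHerm := by
    rw [Matrix.fromBlocks_map, Matrix.fromBlocks_transpose, V₁.isHerm, V₂.isHerm]
    congr 1 <;> ext <;> simp
  nondeg := by
    rw [Matrix.det_fromBlocks_zero₂₁]
    exact V₁.nondeg.mul V₂.nondeg

/-- Isometry of Hermitian spaces. -/
def Isometric (V₁ : HermSpace σ m) (V₂ : HermSpace σ n) : Prop :=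
  ∃ (P : Matrix n m E) (Q : Matrix m n E), P * Q = 1 ∧ Q * P = 1 ∧
    (P.map σ)ᵀ * V₂.gram * P = V₁.gram

/-- The unitary group `U(V)`. -/
def U (V : HermSpace σ n) : Subgroup (GL n E) where
  carrier := {g | ((g : Matrix n n E).map σ)ᵀ * V.gram * (g : Matrix n n E) = V.gram}
  one_mem' := by
    simp [Matrix.map_one]
  mul_mem' := by
    intro a b ha hb
    simp only [Set.mem_ofPred_eq] at ha hb ⊢
    rw [Units.val_mul, Matrix.map_mul, Matrix.transpose_mul]
    calc _ = ((b : Matrix n n E).map σ)ᵀ * (((a : Matrix n n E).map σ)ᵀ * V.gram *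
          (a : Matrix n n E)) * (b : Matrix n n E) := by simp only [Matrix.mul_assoc]
      _ = V.gram := by rw [ha, hb]
  inv_mem' := by
    intro a ha
    simp only [Set.mem_ofPred_eq] at ha ⊢
    have h1 : (a : Matrix n n E) * ((a⁻¹ : GL n E) : Matrix n n E) = 1 := by
      rw [← Units.val_mul]; simp
    have h2 : (((a⁻¹ : GL n E) : Matrix n n E).map σ)ᵀ * ((a : Matrix n n E).map σ)ᵀ = 1 := by
      rw [← Matrix.transpose_mul, ← Matrix.map_mul, h1]
      simp [Matrix.map_one]
    calc _ = (((a⁻¹ : GL n E) : Matrix n n E).map σ)ᵀ * (((a : Matrix n n E).map σ)ᵀ * V.gram *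
          (a : Matrix n n E)) * ((a⁻¹ : GL n E) : Matrix n n E) := by rw [ha]
      _ = ((((a⁻¹ : GL n E) : Matrix n n E).map σ)ᵀ * ((a : Matrix n n E).map σ)ᵀ) * V.gram *
          ((a : Matrix n n E) * ((a⁻¹ : GL n E) : Matrix n n E)) := by
            simp only [Matrix.mul_assoc]
      _ = V.gram := by rw [h1, h2]; simp

end HermSpace

/-- `U(V₁) × U(V₂)` acts on `𝔲(V₁ ⊕ V₂)₁ = Hom(V₂, V₁)` by `(g, h) • X = g X h⁻¹`. -/
instance homAction (V₁ : HermSpace σ m) (V₂ : HermSpace σ n) :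
    MulAction (V₁.U × V₂.U) (Matrix m n E) where
  smul g X := ((g.1 : GL m E) : Matrix m m E) * X * (((g.2 : GL n E)⁻¹ : GL n E) : Matrix n n E)
  one_smul X := by
    change ((((1 : V₁.U × V₂.U).1 : GL m E)) : Matrix m m E) * X *
      ((((1 : V₁.U × V₂.U).2 : GL n E)⁻¹ : GL n E) : Matrix n n E) = X
    simp
  mul_smul g h X := by
    change ((((g * h).1 : GL m E)) : Matrix m m E) * X *
      ((((g * h).2 : GL n E)⁻¹ : GL n E) : Matrix n n E) =
      ((g.1 : GL m E) : Matrix m m E) * (((h.1 : GL m E) : Matrix m m E) * X *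
        (((h.2 : GL n E)⁻¹ : GL n E) : Matrix n n E)) *
        (((g.2 : GL n E)⁻¹ : GL n E) : Matrix n n E)
    simp only [Prod.fst_mul, Prod.snd_mul, Subgroup.coe_mul, mul_inv_rev, Units.val_mul,
      Matrix.mul_assoc]

/-- The contraction `r(X) = -X X^*`, a Hermitian operator on `V₁`. -/
def contraction (V₁ : HermSpace σ m) (V₂ : HermSpace σ n) (X : Matrix m n E) : Matrix m m E :=
  -(X * HermSpace.adj V₁ V₂ X)

/-- `X` is regular semisimple: the element `(0, X; -X^*, 0)` of `𝔲(V₁ ⊕ V₂)` is, that is, its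
characteristic polynomial has distinct roots in an algebraic closure. -/
def IsRegSS (V₁ : HermSpace σ m) (V₂ : HermSpace σ n) (X : Matrix m n E) : Prop :=
  (Matrix.fromBlocks 0 X (-(HermSpace.adj V₁ V₂ X)) 0).charpoly.Separable

/-- Stable conjugacy: `(0, X; -X^*, 0)` and `(0, X'; -X'^*, 0)` are conjugate under the points of
`U(V₁) × U(V₂)` over `E`, which form the group `GL(V₁) × GL(V₂)`. -/
def StablyConj (V₁ : HermSpace σ m) (V₂ : HermSpace σ n) (X X' : Matrix m n E) : Prop :=
  ∃ (g : GL m E) (h : GL n E),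
    X' = (g : Matrix m m E) * X * ((h⁻¹ : GL n E) : Matrix n n E) ∧
    HermSpace.adj V₁ V₂ X' =
      (h : Matrix n n E) * HermSpace.adj V₁ V₂ X * ((g⁻¹ : GL m E) : Matrix m m E)

/-! ## Matching, the character `κ` and transfer factors -/

/-- `δ ∈ End(E^m)` and `δ' ∈ End(E^n)` are conjugate under the isomorphism `P : E^m → E^n`
with inverse `Q`. -/
def ConjBy (P : Matrix n m E) (Q : Matrix m n E) (δ : Matrix m m E) (δ' : Matrix n n E) : Prop :=
  P * Q = 1 ∧ Q * P = 1 ∧ δ' = P * δ * Q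

/-- Jacquet--Langlands transfer. -/
def IsJLTransfer (δ : Matrix m m E) (δ' : Matrix n n E) : Prop :=
  ∃ (P : Matrix n m E) (Q : Matrix m n E), ConjBy P Q δ δ'

/-- The quadratic character `ω_{E/F}` of `F^×`, whose kernel is the group of norms. -/
def omega (F E : Type*) [Field F] [Field E] [Algebra F E] (a : F) : ℂ :=
  open Classical in if ∃ z : E, Algebra.norm F z = a then 1 else -1

/-- `s ∈ F^×` represents the component at the eigenvalue `c ∈ F` of `δ` of the class
`inv(δ, δ') ∈ H¹(F, T_δ)` of the cocycle `g⁻¹ σ(g)`, where `δ' = g δ g⁻¹`, `g = P : V → V'`.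
Here `σ(g) = (g^*)⁻¹ = (g⁻¹)^*`, the centralizer of `δ` acts on the `c`-eigenline through a
factor `U(1)` of `T_δ`, and `H¹(F, U(1)) = F^× / Nm E^×`. -/
def RepresentsInv (V : HermSpace σ m) (V' : HermSpace σ n) (δ : Matrix m m E) (δ' : Matrix n n E)
    (c s : F) : Prop :=
  ∃ (P : Matrix n m E) (Q : Matrix m n E), ConjBy P Q δ δ' ∧
    ∀ v : m → E, δ *ᵥ v = algebraMap F E c • v →
      (Q * HermSpace.adj V V' Q) *ᵥ v = algebraMap F E s • v

/-- `κ(inv(δ, δ'))` for the endoscopic datum of type `(a, 1)`: `κ` is trivial on the factors of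
`H¹(F, T_δ)` that come from `V_a`, and non-trivial on the factor that comes from `V_b`, which is
the one at the eigenvalue `c` of `δ_b`. -/
def kappaInv (V : HermSpace σ m) (V' : HermSpace σ n) (δ : Matrix m m E) (δ' : Matrix n n E)
    (c : F) : ℂ :=
  open Classical in
    if ∃ s : F, s ≠ 0 ∧ RepresentsInv V V' δ δ' c s ∧ omega F E s = 1 then 1 else -1

/-- The eigenvalue in `F` of a Hermitian operator on a space of dimension one. -/
def eigF (F : Type*) {E : Type*} [Field F] [Field E] [Algebra F E]
    (δ : Matrix (Fin 1) (Fin 1) E) : F :=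
  Function.invFun (algebraMap F E) (δ 0 0)

/-- `φ_{a,b}(δ_a, δ_b)`, the operator `δ_a ⊕ δ_b` on `V_a ⊕ V_b`. -/
def dsum (δa : Matrix m m E) (δb : Matrix n n E) : Matrix (m ⊕ n) (m ⊕ n) E :=
  Matrix.fromBlocks δa 0 0 δb

end Hermitian

section LocalField

variable {F E : Type*} [Field F] [ValuativeRel F] [TopologicalSpace F]
  [IsNonarchimedeanLocalField F]
  [Field E] [ValuativeRel E] [TopologicalSpace E] [IsNonarchimedeanLocalField E]
  [Algebra F E] {σ : E ≃ₐ[F] E}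
variable {m n : Type*} [Fintype m] [DecidableEq m] [Fintype n] [DecidableEq n]

/-- The normalized absolute value of `F`: a uniformizer goes to `q⁻¹`, where `q` is the order of
the residue field. -/
def absF (F : Type*) [Field F] [ValuativeRel F] [TopologicalSpace F]
    [IsNonarchimedeanLocalField F] (a : F) : ℝ :=
  WithZeroMulInt.toNNReal (e := (Nat.card (IsLocalRing.ResidueField (valuation F).integer)))
    (Nat.cast_ne_zero.mpr Nat.card_pos.ne')
    (IsNonarchimedeanLocalField.valueGroupWithZeroIsoInt F (valuation F a))

/-- `E/F` is unramified: ramification index one (the residue extension is separable since the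
residue fields are finite). -/
def IsUnramifiedExt (F E : Type*) [Field F] [Field E] [ValuativeRel E] [Algebra F E] : Prop :=
  ∀ x : E, ∃ y : F, valuation E (algebraMap F E y) = valuation E x

/-- The transfer factor `Δ((δ_a, δ_b), δ)`, for `V_a` and `V_b` of dimension one:
`κ(inv(δ, δ')) ω_{E/F}(D) |D|_F` with `δ' = φ_{a,b}(δ_a, δ_b)` and `D` the difference of the
eigenvalues of `δ_a` and `δ_b`, if `δ` and `(δ_a, δ_b)` match; zero otherwise. -/
def transferFactor (V : HermSpace σ m) (Va Vb : HermSpace σ (Fin 1))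
    (δa δb : Matrix (Fin 1) (Fin 1) E) (δ : Matrix m m E) : ℂ :=
  open Classical in
    if IsJLTransfer δ (dsum δa δb) then
      kappaInv V (Va.sum Vb) δ (dsum δa δb) (eigF F δb) *
        omega F E (eigF F δa - eigF F δb) * (absF F (eigF F δa - eigF F δb) : ℂ)
    else 0

instance unitaryMeasurableSpace (V : HermSpace σ n) : MeasurableSpace V.U := borel _

instance unitaryBorelSpace (V : HermSpace σ n) : BorelSpace V.U := ⟨rfl⟩

/-- The lattice `Λ = 𝒪_E^n`. -/
def stdLattice (E n : Type*) [Field E] [ValuativeRel E] : Set (n → E) :=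
  {v | ∀ i, v i ∈ (valuation E).integer}

/-- `Λ = 𝒪_E^n` is self-dual in `V`. -/
def HermSpace.IsSelfDual (V : HermSpace σ n) : Prop :=
  ∀ v : n → E, v ∈ stdLattice E n ↔
    ∀ w ∈ stdLattice E n, V.form v w ∈ (valuation E).integer

/-- The stabilizer `U(Λ)` of `Λ = 𝒪_E^n` in `U(V)`. -/
def HermSpace.latticeStab (V : HermSpace σ n) : Set V.U :=
  {g | (∀ v ∈ stdLattice E n, ((g : GL n E) : Matrix n n E) *ᵥ v ∈ stdLattice E n) ∧
    ∀ v ∈ stdLattice E n, (((g : GL n E)⁻¹ : GL n E) : Matrix n n E) *ᵥ v ∈ stdLattice E n}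

/-- A Haar measure on `U(V)` which gives `U(Λ)` volume one. -/
def HermSpace.IsUnitHaar (V : HermSpace σ n) (μ : Measure V.U) : Prop :=
  μ.IsHaarMeasure ∧ μ V.latticeStab = 1

/-- The subring `End(Λ)` of `End(V)`, `Λ = 𝒪_E^n`. -/
def endLattice (E n : Type*) [Field E] [ValuativeRel E] [Fintype n] : Set (Matrix n n E) :=
  {X | ∀ v ∈ stdLattice E n, X *ᵥ v ∈ stdLattice E n}

/-- The indicator function of `End(Λ)`. -/
def endIndicator (E n : Type*) [Field E] [ValuativeRel E] [Fintype n] : Matrix n n E → ℂ :=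
  (endLattice E n).indicator 1

/-- Locally constant functions with compact support. -/
def IsSchwartz {X : Type*} [TopologicalSpace X] (f : X → ℂ) : Prop :=
  IsLocallyConstant f ∧ HasCompactSupport f

/-- `x ∈ 𝔲(V ⊕ V)₁ = End(V)` matches `(x_a, x_b) ∈ Hom(V_α, V_a) ⊕ Hom(V_β, V_b)`. -/
def IsMatching (V : HermSpace σ n) (Va Vb Vα Vβ : HermSpace σ (Fin 1))
    (x : Matrix n n E) (y : Matrix (Fin 1) (Fin 1) E × Matrix (Fin 1) (Fin 1) E) : Prop :=
  IsJLTransfer (contraction V V x) (dsum (contraction Va Vα y.1) (contraction Vb Vβ y.2))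

/-- `(x_a, x_b)` is regular semisimple for the endoscopic datum: `x_a` and `x_b` are regular
semisimple, and `r(x_a) ⊕ r(x_b)` is regular semisimple on `V_a ⊕ V_b`. -/
def IsRegSSPair (Va Vb Vα Vβ : HermSpace σ (Fin 1))
    (y : Matrix (Fin 1) (Fin 1) E × Matrix (Fin 1) (Fin 1) E) : Prop :=
  IsRegSS Va Vα y.1 ∧ IsRegSS Vb Vβ y.2 ∧
    (dsum (contraction Va Vα y.1) (contraction Vb Vβ y.2)).charpoly.Separable

/-- The relative transfer factor `Δ_rel((x_a, x_b), x)`. -/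
def relTransferFactor (V : HermSpace σ n) (Va Vb Vα Vβ : HermSpace σ (Fin 1))
    (y : Matrix (Fin 1) (Fin 1) E × Matrix (Fin 1) (Fin 1) E) (x : Matrix n n E) : ℂ :=
  transferFactor V Va Vb (contraction Va Vα y.1) (contraction Vb Vβ y.2) (contraction V V x)

/-- The relative `κ`-orbital integral `RO^κ(x, f)` of `x ∈ End(V)`, where `c` is the eigenvalue of
`r(x)` that comes from `V_b`; `κ(inv(x, x')) = κ(inv(r(x), r(x')))`. -/
def relKappaOrbitalIntegral (V : HermSpace σ n) (μ : Measure V.U) (c : F)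
    (x : Matrix n n E) (f : Matrix n n E → ℂ) : ℂ :=
  kappaOrbitalIntegral (μ.prod μ) (StablyConj V V)
    (fun x x' => kappaInv V V (contraction V V x) (contraction V V x') c) x f

/-- The relative stable orbital integral of `(x_a, x_b)`, for the action of
`(U(V_a) × U(V_α)) × (U(V_b) × U(V_β))` on `Hom(V_α, V_a) ⊕ Hom(V_β, V_b)`. -/
def relStableOrbitalIntegral (Va Vb Vα Vβ : HermSpace σ (Fin 1))
    (μa : Measure Va.U) (μb : Measure Vb.U) (μα : Measure Vα.U) (μβ : Measure Vβ.U)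
    (y : Matrix (Fin 1) (Fin 1) E × Matrix (Fin 1) (Fin 1) E)
    (f : Matrix (Fin 1) (Fin 1) E × Matrix (Fin 1) (Fin 1) E → ℂ) : ℂ :=
  stableOrbitalIntegral ((μa.prod μα).prod (μb.prod μβ))
    (fun y y' => StablyConj Va Vα y.1 y'.1 ∧ StablyConj Vb Vβ y.2 y'.2) y f

/-- `f ∈ C_c^∞(End(V))` and `f' ∈ C_c^∞(Hom(V_α, V_a) ⊕ Hom(V_β, V_b))` match
(are smooth transfers of each other). -/
def AreSmoothTransfers (V : HermSpace σ n) (Va Vb Vα Vβ : HermSpace σ (Fin 1))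
    (μ : Measure V.U)
    (μa : Measure Va.U) (μb : Measure Vb.U) (μα : Measure Vα.U) (μβ : Measure Vβ.U)
    (f : Matrix n n E → ℂ)
    (f' : Matrix (Fin 1) (Fin 1) E × Matrix (Fin 1) (Fin 1) E → ℂ) : Prop :=
  IsSchwartz f ∧ IsSchwartz f' ∧
  (∀ x y, IsRegSS V V x → IsRegSSPair Va Vb Vα Vβ y → IsMatching V Va Vb Vα Vβ x y →
    relStableOrbitalIntegral Va Vb Vα Vβ μa μb μα μβ y f' =
      relTransferFactor V Va Vb Vα Vβ y x *
        relKappaOrbitalIntegral V μ (eigF F (contraction Vb Vβ y.2)) x f) ∧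
  (∀ y, IsRegSSPair Va Vb Vα Vβ y →
    (¬ ∃ x, IsRegSS V V x ∧ IsMatching V Va Vb Vα Vβ x y) →
    relStableOrbitalIntegral Va Vb Vα Vβ μa μb μα μβ y f' = 0)

end LocalField

end

/-! ### Norm-one elements of an unramified quadratic extension and their congruence filtration. -/

noncomputable section
section UnramifiedArithmetic

open WithZero

variable {F E : Type*} [Field F] [Field E] [Algebra F E] {σ : E ≃ₐ[F] E}

/-! The orbital integral of the indicator function of `End(Λ₂)` counts pairs of self-dual lattices:
the integrand at `(g₁, g₂)` is nonzero exactly when `x` maps `g₂Λ` into `g₁Λ`, and each lattice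
contributes a left coset of the stabilizer of `Λ`, of volume one.

Let `r(x)` have distinct nonzero eigenvalues `ca`, `cb` in `F`. Its eigenlines are orthogonal. As
the plane is unimodular and a fixed element of even valuation is a norm, the eigenvectors can be
rescaled so that both have norm `ϖ ^ ε` with the same `ε ∈ {0, 1}`: this is a frame of type `ε`. The
type classifies the orbits in the stable class. Both types occur, because there is a similitude with
factor `ϖ`, and `κ` is the sign that compares types (`kappaInv_eq`). Hence `RO^κ` is a difference of
two orbital integrals, one for each type (`HasType.kappaOrbitalIntegral_eq`).

If `-ca = ta * σ ta` and `-cb = tb * σ tb`, then in suitable frames of the same type at source and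
target `x` is `diag(ta, tb)`. In a frame of type `e`, the unimodular lattices are spanned by `ϖ ^
(-s) (1, ζ z)` and `ϖ ^ m (0, 1)`, where `s - m = e`, `ζ` has norm `-1`, `z` has norm one and
matters only modulo `ϖ ^ k`, `k = m + s`. So they are indexed by the `k ≥ 0` of the parity of `e`
and the classes of norm-one elements modulo level `k`; there are `(q + 1) q ^ (k - 1)` classes for
`k ≥ 1` and one for `k = 0`. The sign `(-1) ^ k` is therefore the sign of the type, and the two
counts merge into one alternating sum. For radii `k` and `2n - k` the inclusion of lattices becomes
three inequalities (`isIntegralMatrix_glue_iff`). The alternating count telescopes to `(-q) ^ val(ca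
- cb)` if `ta`, `tb` are integral, and to zero otherwise (`exists_sum_pairCount`).

The transfer factor is `(-q) ^ (-val(ca - cb))` times the sign of the type of `x`, so the product is
the indicator of integrality of `ta` and `tb`. That is also the stable orbital integral on the
endoscopic side, where the groups are compact of volume one and a stable class is a single orbit
(`relStableOrbitalIntegral_eq`). For the split pair every regular semisimple element has a match, so
the vanishing condition is empty.

If `V_α`, `V_β` are not both isometric to `V₁` and a match exists, then `ca * cb` is a norm, which
forces both eigenvalues to have odd valuation. Then `x ↦ x^*` exchanges the types and preserves
integral points, so the two orbital integrals cancel (`HasType.kappaOrbitalIntegral_eq_zero`). -/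

theorem exp_neg_le_exp_neg {a b : ℤ} : (exp (-a) : ℤᵐ⁰) ≤ exp (-b) ↔ b ≤ a := by
  rw [exp_le_exp, neg_le_neg_iff]

/-- The elements of the base field of valuation at least `n`. -/
def baseBall (F : Type*) {E : Type*} [Field F] [Field E] [Algebra F E]
    (v : Valuation E ℤᵐ⁰) (n : ℤ) : AddSubgroup F where
  carrier := {a | v (algebraMap F E a) ≤ exp (-n)}
  zero_mem' := by simp
  add_mem' := by
    intro a b ha hb
    simp only [Set.mem_ofPred_eq, map_add] at *
    exact v.map_add_le ha hb
  neg_mem' := by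
    intro a ha
    simpa only [Set.mem_ofPred_eq, map_neg, Valuation.map_neg] using ha

theorem mem_baseBall {v : Valuation E ℤᵐ⁰} {n : ℤ} {a : F} :
    a ∈ baseBall F v n ↔ v (algebraMap F E a) ≤ exp (-n) := Iff.rfl

/-- The arithmetic of an unramified quadratic extension of local fields of odd residue
characteristic, with residue field of order `q`. -/
structure UnramifiedQuadratic (σ : E ≃ₐ[F] E) (v : Valuation E ℤᵐ⁰) (q : ℕ) where
  θ : E
  ϖ : F
  conj_conj : ∀ z, σ (σ z) = z
  exists_of_fixed : ∀ z, σ z = z → ∃ a : F, algebraMap F E a = z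
  v_conj : ∀ z, v (σ z) = v z
  conj_θ : σ θ = -θ
  v_θ : v θ = 1
  v_two : v 2 = 1
  v_ϖ : v (algebraMap F E ϖ) = exp (-1)
  v_add_mul : ∀ a b : F, v (algebraMap F E a + algebraMap F E b * θ) =
    max (v (algebraMap F E a)) (v (algebraMap F E b))
  exists_norm : ∀ a : F, v (algebraMap F E a) = 1 → ∃ z, z * σ z = algebraMap F E a
  one_lt_q : 1 < q
  relIndex_succ : ∀ n : ℕ, (baseBall F v (n + 1)).relIndex (baseBall F v n) = q

/-- The group of elements of norm one. -/
def normOne (σ : E ≃ₐ[F] E) : Subgroup Eˣ where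
  carrier := {z | (z : E) * σ z = 1}
  one_mem' := by simp
  mul_mem' := by
    intro a b ha hb
    simp only [Set.mem_ofPred_eq, Units.val_mul, map_mul] at *
    linear_combination (b : E) * σ b * ha + hb
  inv_mem' := by
    intro a ha
    simp only [Set.mem_ofPred_eq, Units.val_inv_eq_inv_val, map_inv₀] at *
    rw [← mul_inv, ha, inv_one]

/-- Allows cosets to be counted through a map that is not a homomorphism, such as the Cayley
transform. -/
theorem Nat.card_quotient_congr {α β : Type*} {s : Setoid α} {t : Setoid β} (f : α → β)
    (h : ∀ a b, s a b ↔ t (f a) (f b)) (hsurj : ∀ b, ∃ a, t (f a) b) :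
    Nat.card (Quotient s) = Nat.card (Quotient t) := by
  refine Nat.card_congr (Equiv.ofBijective (Quotient.map f fun a b hab => (h a b).1 hab) ⟨?_, ?_⟩)
  · rintro ⟨a⟩ ⟨b⟩ hab
    exact Quotient.sound ((h a b).2 (Quotient.exact hab))
  · rintro ⟨b⟩
    obtain ⟨a, ha⟩ := hsurj b
    exact ⟨Quotient.mk _ a, Quotient.sound ha⟩

namespace UnramifiedQuadratic

variable {v : Valuation E ℤᵐ⁰} {q : ℕ} (D : UnramifiedQuadratic σ v q)
include D

local notation "ι" => algebraMap F E

theorem θ_ne_zero : D.θ ≠ 0 := fun h => by simpa [h] using D.v_θ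

theorem two_ne_zero' : (2 : E) ≠ 0 := fun h => by simpa [h] using D.v_two

theorem ϖ_ne_zero : D.ϖ ≠ 0 := fun h => by
  have h1 := D.v_ϖ
  rw [h, map_zero, map_zero] at h1
  exact exp_ne_zero h1.symm

theorem v_ϖ_zpow (n : ℤ) : v (ι D.ϖ ^ n) = exp (-n) := by
  rw [map_zpow₀, D.v_ϖ, ← exp_zsmul]; simp

theorem v_of_mem (z : normOne σ) : v ((z : Eˣ) : E) = 1 := by
  have h : ((z : Eˣ) : E) * σ ((z : Eˣ) : E) = 1 := z.2
  have h2 := congrArg v h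
  rw [map_mul, D.v_conj, map_one, ← sq] at h2
  exact (pow_eq_one_iff_of_nonneg zero_le (by norm_num)).1 h2

/-- The elements of norm one that are congruent to one modulo the `k`-th power of the maximal
ideal. -/
def level (k : ℕ) : Subgroup (normOne σ) where
  carrier := {z | v (((z : Eˣ) : E) - 1) ≤ exp (-(k : ℤ))}
  one_mem' := by simp
  mul_mem' := by
    intro a b ha hb
    have h : (((a * b : normOne σ) : Eˣ) : E) - 1 =
        ((a : Eˣ) : E) * (((b : Eˣ) : E) - 1) + (((a : Eˣ) : E) - 1) := by
      push_cast; ring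
    simp only [Set.mem_ofPred_eq] at *
    rw [h]
    refine v.map_add_le ?_ ha
    rwa [map_mul, D.v_of_mem, one_mul]
  inv_mem' := by
    intro a ha
    have h : (((a⁻¹ : normOne σ) : Eˣ) : E) - 1 =
        - (((a⁻¹ : normOne σ) : Eˣ) : E) * (((a : Eˣ) : E) - 1) := by
      have : (((a⁻¹ : normOne σ) : Eˣ) : E) * ((a : Eˣ) : E) = 1 := by
        rw [← Units.val_mul, ← Subgroup.coe_mul]; simp
      linear_combination this
    simp only [Set.mem_ofPred_eq] at *
    rw [h]
    rwa [map_mul, Valuation.map_neg, D.v_of_mem, one_mul]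

theorem mem_level {k : ℕ} {z : normOne σ} :
    z ∈ D.level k ↔ v (((z : Eˣ) : E) - 1) ≤ exp (-(k : ℤ)) := Iff.rfl

theorem inv_mul_mem_level {k : ℕ} {z w : normOne σ} :
    z⁻¹ * w ∈ D.level k ↔ v (((w : Eˣ) : E) - ((z : Eˣ) : E)) ≤ exp (-(k : ℤ)) := by
  rw [D.mem_level]
  have h : ((w : Eˣ) : E) - ((z : Eˣ) : E) =
      ((z : Eˣ) : E) * ((((z⁻¹ * w : normOne σ) : Eˣ) : E) - 1) := by
    push_cast; field_simp
  rw [h, map_mul, D.v_of_mem, one_mul]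

theorem level_anti {r k : ℕ} (h : r ≤ k) : D.level k ≤ D.level r := by
  intro z hz
  exact le_trans (D.mem_level.1 hz) (exp_neg_le_exp_neg.2 (by exact_mod_cast h))

theorem level_zero : D.level 0 = ⊤ := by
  refine eq_top_iff.2 fun z _ => ?_
  rw [mem_level]
  refine (v.map_sub_le (D.v_of_mem z).le (by simp)).trans (by simp)

theorem v_one_sub {s : F} (hs : v (ι s) ≤ 1) : v (1 - ι s * D.θ) = 1 := by
  have := D.v_add_mul 1 (-s)
  simp only [map_one, map_neg, neg_mul, Valuation.map_neg, ← sub_eq_add_neg] at this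
  rw [this, max_eq_left hs]

theorem v_one_add {s : F} (hs : v (ι s) ≤ 1) : v (1 + ι s * D.θ) = 1 := by
  have := D.v_add_mul 1 s
  simp only [map_one] at this
  rw [this, max_eq_left hs]

theorem one_sub_ne_zero {s : F} (hs : v (ι s) ≤ 1) : 1 - ι s * D.θ ≠ 0 :=
  fun h => by simpa [h] using D.v_one_sub hs

theorem one_add_ne_zero {s : F} (hs : v (ι s) ≤ 1) : 1 + ι s * D.θ ≠ 0 :=
  fun h => by simpa [h] using D.v_one_add hs

/-- The Cayley transform, from integral elements of the base field to elements of norm one. -/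
def cayley (s : F) (hs : v (ι s) ≤ 1) : normOne σ :=
  ⟨Units.mk0 ((1 + ι s * D.θ) / (1 - ι s * D.θ))
    (div_ne_zero (D.one_add_ne_zero hs) (D.one_sub_ne_zero hs)), by
    have h1 := D.one_sub_ne_zero hs
    have h2 := D.one_add_ne_zero hs
    change ((1 + ι s * D.θ) / (1 - ι s * D.θ)) * σ ((1 + ι s * D.θ) / (1 - ι s * D.θ)) = 1
    rw [map_div₀, map_add, map_sub, map_mul, D.conj_θ, map_one, AlgEquiv.commutes, mul_neg,
      sub_neg_eq_add, ← sub_eq_add_neg]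
    field_simp⟩

theorem coe_cayley (s : F) (hs : v (ι s) ≤ 1) :
    ((D.cayley s hs : Eˣ) : E) = (1 + ι s * D.θ) / (1 - ι s * D.θ) := rfl

/-- The difference is `t - s` times `2θ` over two unit denominators, so the Cayley transform is an
isometry. Hence congruence of parameters is congruence of norm-one elements. -/
theorem v_cayley_sub (s t : F) (hs : v (ι s) ≤ 1) (ht : v (ι t) ≤ 1) :
    v (((D.cayley t ht : Eˣ) : E) - ((D.cayley s hs : Eˣ) : E)) = v (ι (t - s)) := by
  have h1 := D.one_sub_ne_zero hs
  have h2 := D.one_sub_ne_zero ht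
  have : ((D.cayley t ht : Eˣ) : E) - ((D.cayley s hs : Eˣ) : E) =
      2 * D.θ * ι (t - s) / ((1 - ι s * D.θ) * (1 - ι t * D.θ)) := by
    rw [coe_cayley, coe_cayley, map_sub, div_sub_div _ _ h2 h1, div_eq_div_iff (mul_ne_zero h2 h1)
      (mul_ne_zero h1 h2)]
    ring
  rw [this, map_div₀, map_mul, map_mul, map_mul, D.v_one_sub hs, D.v_one_sub ht, D.v_two, D.v_θ]
  simp

theorem v_cayley_sub_one (s : F) (hs : v (ι s) ≤ 1) :
    v (((D.cayley s hs : Eˣ) : E) - 1) = v (ι s) := by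
  have := D.v_cayley_sub 0 s (by simp) hs
  rw [coe_cayley D 0] at this
  simpa using this

/-- The residue class of `-1` is the one class that the Cayley transform misses. -/
theorem v_cayley_add_one (s : F) (hs : v (ι s) ≤ 1) :
    v (((D.cayley s hs : Eˣ) : E) + 1) = 1 := by
  have h1 := D.one_sub_ne_zero hs
  have : ((D.cayley s hs : Eˣ) : E) + 1 = 2 / (1 - ι s * D.θ) := by
    rw [coe_cayley]; field_simp; ring
  rw [this, map_div₀, D.v_one_sub hs, D.v_two, div_one]

/-- The inverse transform `(z - 1) / ((z + 1) θ)` is fixed by `σ`, since `σ z = z⁻¹`, and integral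
once `z + 1` is a unit. -/
theorem exists_cayley (z : normOne σ) (hz : v (((z : Eˣ) : E) + 1) = 1) :
    ∃ s hs, D.cayley s hs = z := by
  set w : E := ((z : Eˣ) : E) with hw
  have hw0 : w ≠ 0 := z.1.ne_zero
  have hz1 : w + 1 ≠ 0 := fun h => by simp [h] at hz
  have hσ : σ w = w⁻¹ := by
    have : w * σ w = 1 := z.2
    field_simp; linear_combination this
  have hθ := D.θ_ne_zero
  obtain ⟨s, hs⟩ := D.exists_of_fixed ((w - 1) / ((w + 1) * D.θ)) (by
    have : w⁻¹ + 1 ≠ 0 := by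
      intro h; apply hz1; field_simp at h; linear_combination h
    rw [map_div₀, map_mul, map_sub, map_add, map_one, hσ, D.conj_θ, div_eq_div_iff
      (mul_ne_zero this (neg_ne_zero.2 hθ)) (mul_ne_zero hz1 hθ)]
    field_simp
    ring)
  have hv : v (ι s) ≤ 1 := by
    rw [hs, map_div₀, map_mul, hz, D.v_θ, mul_one, div_one]
    exact v.map_sub_le (D.v_of_mem z).le (by simp)
  refine ⟨s, hv, ?_⟩
  apply Subtype.ext
  apply Units.ext
  have h3 := D.one_sub_ne_zero hv
  have h2 := D.two_ne_zero'
  rw [coe_cayley, ← hw, div_eq_iff h3, hs]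
  field_simp
  ring

theorem v_add_one_of_level {z : E} {r : ℕ} (hr : 1 ≤ r) (hz : v (z - 1) ≤ exp (-(r : ℤ))) :
    v (z + 1) = 1 := by
  have h1 : v (z - 1) < 1 := hz.trans_lt (by rw [← exp_zero, exp_lt_exp]; omega)
  have : z + 1 = 2 + (z - 1) := by ring
  rw [this, v.map_add_eq_of_lt_left (by rwa [D.v_two]), D.v_two]

theorem baseBall_relIndex {r k : ℕ} (h : r ≤ k) :
    (baseBall F v k).relIndex (baseBall F v r) = q ^ (k - r) := by
  induction k, h using Nat.le_induction with
  | base => simp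
  | succ k hk ih =>
    have h1 : baseBall F v ((k + 1 : ℕ) : ℤ) ≤ baseBall F v k := by
      intro a ha
      exact le_trans (mem_baseBall.1 ha) (exp_neg_le_exp_neg.2 (by omega))
    have h2 : baseBall F v (k : ℤ) ≤ baseBall F v r := by
      intro a ha
      exact le_trans (mem_baseBall.1 ha) (exp_neg_le_exp_neg.2 (by omega))
    rw [← AddSubgroup.relIndex_mul_relIndex _ _ _ h1 h2, ih]
    have := D.relIndex_succ k
    push_cast
    rw [this, Nat.succ_sub hk, pow_succ, mul_comm]

/-- The Cayley transform carries the filtration of the base field to the levels. The bound `1 ≤ r`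
keeps `z` away from the class of `-1`. -/
theorem level_relIndex {r k : ℕ} (hr : 1 ≤ r) (h : r ≤ k) :
    (D.level k).relIndex (D.level r) = q ^ (k - r) := by
  rw [← D.baseBall_relIndex h, Subgroup.relIndex, AddSubgroup.relIndex, Subgroup.index,
    AddSubgroup.index]
  symm
  have hr1 : exp (-(r : ℤ)) ≤ (1 : ℤᵐ⁰) := by rw [← exp_zero, exp_le_exp]; omega
  refine Nat.card_quotient_congr
    (fun s : baseBall F v (r : ℤ) => (⟨D.cayley s.1 (s.2.trans hr1), by
      rw [mem_level, v_cayley_sub_one]; exact s.2⟩ : D.level r)) ?_ ?_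
  · intro a b
    rw [QuotientAddGroup.leftRel_apply, QuotientGroup.leftRel_apply, AddSubgroup.mem_addSubgroupOf,
      Subgroup.mem_subgroupOf]
    change _ ↔ (D.cayley a.1 (a.2.trans hr1))⁻¹ * (D.cayley b.1 (b.2.trans hr1)) ∈ D.level k
    rw [inv_mul_mem_level, v_cayley_sub, mem_baseBall]
    simp [add_comm, sub_eq_add_neg]
  · rintro ⟨z, hz⟩
    obtain ⟨s, hs, rfl⟩ := D.exists_cayley z (D.v_add_one_of_level hr hz)
    refine ⟨⟨s, ?_⟩, ?_⟩
    · rw [mem_level, v_cayley_sub_one] at hz; exact hz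
    · rw [QuotientGroup.leftRel_apply, inv_mul_cancel]
      exact one_mem _

/-- The Cayley transform supplies one class for each residue class of the base field, and `-1`
supplies the last one. -/
theorem level_one_index : (D.level 1).index = q + 1 := by
  have hq : Nat.card (baseBall F v (0 : ℤ) ⧸ (baseBall F v (1 : ℤ)).addSubgroupOf
      (baseBall F v (0 : ℤ))) = q := by
    have := D.relIndex_succ 0
    simpa [AddSubgroup.relIndex, AddSubgroup.index] using this
  have : Finite (baseBall F v (0 : ℤ) ⧸ (baseBall F v (1 : ℤ)).addSubgroupOf
      (baseBall F v (0 : ℤ))) :=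
    Nat.finite_of_card_ne_zero (by rw [hq]; have := D.one_lt_q; omega)
  refine Eq.trans ?_ (congrArg (· + 1) hq)
  rw [← Finite.card_option, Subgroup.index]
  symm
  have hle : ∀ s : baseBall F v (0 : ℤ), v (ι s) ≤ 1 := fun s => by
    have := mem_baseBall.1 s.2; simpa using this
  have key : ∀ a b : baseBall F v (0 : ℤ),
      QuotientAddGroup.leftRel ((baseBall F v (1 : ℤ)).addSubgroupOf (baseBall F v (0 : ℤ))) a b ↔
      QuotientGroup.leftRel (D.level 1) (D.cayley a (hle a)) (D.cayley b (hle b)) := by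
    intro a b
    rw [QuotientAddGroup.leftRel_apply, QuotientGroup.leftRel_apply, AddSubgroup.mem_addSubgroupOf,
      inv_mul_mem_level, v_cayley_sub, mem_baseBall]
    simp [add_comm, sub_eq_add_neg]
  let m1 : normOne σ := ⟨-1, by simp [normOne]⟩
  -- The value group is discrete, so a value below one is at most `exp (-1)`.
  have hm1 : ∀ z : normOne σ, m1⁻¹ * z ∈ D.level 1 ↔ v (((z : Eˣ) : E) + 1) < 1 := by
    intro z
    rw [inv_mul_mem_level]
    have : ((m1 : Eˣ) : E) = -1 := by simp [m1]
    rw [this, sub_neg_eq_add]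
    by_cases h0 : v (((z : Eˣ) : E) + 1) = 0
    · simp [h0]
    · rw [← exp_log h0, exp_le_exp, ← exp_zero, exp_lt_exp]
      constructor <;> intro h <;> push_cast at * <;> omega
  refine Nat.card_congr (Equiv.ofBijective
    (fun o => o.elim (Quotient.mk _ m1 : normOne σ ⧸ D.level 1)
      (Quotient.map (fun s => D.cayley s.1 (hle s)) fun a b hab => (key a b).1 hab)) ⟨?_, ?_⟩)
  · have hne : ∀ s : baseBall F v (0 : ℤ), (Quotient.mk _ m1 : normOne σ ⧸ D.level 1) ≠
        Quotient.mk _ (D.cayley s.1 (hle s)) := by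
      intro s hs
      have := Quotient.exact hs
      change QuotientGroup.leftRel (D.level 1) _ _ at this
      rw [QuotientGroup.leftRel_apply, hm1, v_cayley_add_one] at this
      exact lt_irrefl _ this
    rintro (_ | ⟨⟨a⟩⟩) (_ | ⟨⟨b⟩⟩) hab
    · rfl
    · exact absurd hab (hne b)
    · exact absurd hab.symm (hne a)
    · exact congrArg some (Quotient.sound ((key a b).2 (Quotient.exact hab)))
  · rintro ⟨z⟩
    by_cases hz : v (((z : Eˣ) : E) + 1) < 1
    · refine ⟨none, Quotient.sound ?_⟩
      change QuotientGroup.leftRel (D.level 1) _ _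
      rwa [QuotientGroup.leftRel_apply, hm1]
    · obtain ⟨s, hs, rfl⟩ := D.exists_cayley z
        (le_antisymm (v.map_add_le (D.v_of_mem z).le (by simp)) (not_lt.1 hz))
      exact ⟨some (Quotient.mk _ ⟨s, by simpa [mem_baseBall] using hs⟩), rfl⟩

theorem level_index {k : ℕ} (hk : 1 ≤ k) : (D.level k).index = (q + 1) * q ^ (k - 1) := by
  rw [← Subgroup.relIndex_mul_index (D.level_anti hk), D.level_one_index,
    D.level_relIndex le_rfl hk, mul_comm]

theorem level_zero_index : (D.level 0).index = 1 := by rw [level_zero, Subgroup.index_top]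

theorem level_index_ne_zero (k : ℕ) : (D.level k).index ≠ 0 := by
  rcases Nat.eq_zero_or_pos k with rfl | hk
  · simp [level_zero_index]
  · rw [D.level_index hk]
    have := D.one_lt_q
    positivity

instance finite_quotient_level (k : ℕ) : Finite (normOne σ ⧸ D.level k) :=
  Nat.finite_of_card_ne_zero (D.level_index_ne_zero k)

/-- An integral element whose norm is close to one is close to an element of norm one. -/
theorem exists_normOne_near {t : E} (ht : v t ≤ 1) {r : ℤ} 
    (h : v (t * σ t - 1) ≤ exp (-r)) : ∃ z : normOne σ, v (t - ((z : Eˣ) : E)) ≤ exp (-r) := by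
  have key : ∀ t : E, v t ≤ 1 → v (t * σ t - 1) ≤ exp (-r) → v (1 + t) = 1 →
      ∃ z : normOne σ, v (t - ((z : Eˣ) : E)) ≤ exp (-r) := by
    intro t ht h h1
    have h0 : 1 + t ≠ 0 := fun h => by simp [h] at h1
    have h1' : v (1 + σ t) = 1 := by rw [← map_one σ, ← map_add, D.v_conj, h1]
    have h0' : 1 + σ t ≠ 0 := fun h => by simp [h] at h1'
    -- A quotient of conjugates has norm one, and its distance from `t` is `(t σ(t) - 1) / (1 + σ
    -- t)`.
    refine ⟨⟨Units.mk0 ((1 + t) / (1 + σ t)) (div_ne_zero h0 h0'), ?_⟩, ?_⟩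
    · change ((1 + t) / (1 + σ t)) * σ ((1 + t) / (1 + σ t)) = 1
      rw [map_div₀, map_add, map_add, map_one, D.conj_conj]
      field_simp
    · change v (t - (1 + t) / (1 + σ t)) ≤ _
      have : t - (1 + t) / (1 + σ t) = (t * σ t - 1) / (1 + σ t) := by field_simp; ring
      rwa [this, map_div₀, h1', div_one]
  by_cases h1 : v (1 + t) = 1
  · exact key t ht h h1
  -- `1 + t` and `1 - t` add up to the unit `2`, so at least one of them is a unit; here `-t` is
  -- approximated instead.
  · have h2 : v (1 + -t) = 1 := by
      have h3 : v (1 + t) < 1 := lt_of_le_of_ne (v.map_add_le (by simp) ht) h1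
      have : 1 + -t = 2 - (1 + t) := by ring
      rw [this, v.map_sub_eq_of_lt_left (by rwa [D.v_two]), D.v_two]
    obtain ⟨z, hz⟩ := key (-t) (by rwa [Valuation.map_neg]) (by simpa using h) h2
    refine ⟨⟨-(z : Eˣ), ?_⟩, ?_⟩
    · have : ((z : Eˣ) : E) * σ ((z : Eˣ) : E) = 1 := z.2
      change ((-(z : Eˣ) : Eˣ) : E) * σ ((-(z : Eˣ) : Eˣ) : E) = 1
      simpa using this
    · rw [← Valuation.map_neg] at hz
      convert hz using 2
      push_cast
      ring

end UnramifiedQuadratic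
end UnramifiedArithmetic
end

/-! ### The alternating count of pairs of lattices. -/

noncomputable section
section PairCount

open WithZero

variable {F E : Type*} [Field F] [Field E] [Algebra F E] {σ : E ≃ₐ[F] E}

theorem Finset.sum_range_neg_one_pow_odd (n : ℕ) :
    ∑ k ∈ Finset.range (2 * n + 1), (-1 : ℤ) ^ k = 1 := by
  induction n with
  | zero => simp
  | succ n ih =>
    rw [show 2 * (n + 1) + 1 = 2 * n + 1 + 1 + 1 by ring, Finset.sum_range_succ,
      Finset.sum_range_succ, ih]
    ring

theorem Nat.card_subtype_prod_of_fiber {α β : Type*} [Finite α] [Finite β] (P : α → β → Prop)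
    (m : ℕ) (h : ∀ a, Nat.card {b // P a b} = m) :
    Nat.card {c : α × β // P c.1 c.2} = Nat.card α * m := by
  have := Fintype.ofFinite α
  rw [Nat.card_congr (Equiv.subtypeProdEquivSigmaSubtype P), Nat.card_sigma]
  simp [h]

/-- Since `K ≤ L`, the condition does not depend on the chosen representative: it selects the cosets
of `K` inside `w L`. -/
theorem QuotientGroup.card_out_mem_coset {G : Type*} [CommGroup G] {K L : Subgroup G} (h : K ≤ L)
    (w : G) : Nat.card {c : G ⧸ K // w⁻¹ * Quotient.out c ∈ L} = K.relIndex L := by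
  rw [Subgroup.relIndex, Subgroup.index]
  symm
  have hmk : ∀ g : G, (QuotientGroup.mk (s := K) g).out⁻¹ * g ∈ K := fun g => by
    rw [← QuotientGroup.eq]; exact Quotient.out_eq _
  refine Nat.card_congr (Equiv.ofBijective (Quotient.lift
    (fun l : L => (⟨QuotientGroup.mk (s := K) (w * l), ?_⟩ :
      {c : G ⧸ K // w⁻¹ * Quotient.out c ∈ L})) ?_) ⟨?_, ?_⟩)
  · have h1 := h (hmk (w * l))
    convert L.mul_mem l.2 (L.inv_mem h1) using 1
    simp only [mul_inv_rev, inv_inv]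
    rw [mul_assoc, mul_inv_cancel_left]
  · intro a b hab
    apply Subtype.ext
    have := QuotientGroup.leftRel_apply.1 hab
    rw [Subgroup.mem_subgroupOf] at this
    refine QuotientGroup.eq.2 ?_
    simpa [mul_assoc] using this
  · rintro ⟨a⟩ ⟨b⟩ hab
    have := QuotientGroup.eq.1 (Subtype.ext_iff.1 hab)
    refine Quotient.sound (QuotientGroup.leftRel_apply.2 ?_)
    rw [Subgroup.mem_subgroupOf]
    simpa [mul_assoc] using this
  · rintro ⟨c, hc⟩
    refine ⟨Quotient.mk _ ⟨_, hc⟩, Subtype.ext ?_⟩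
    change QuotientGroup.mk (s := K) (w * (w⁻¹ * Quotient.out c)) = c
    rw [mul_inv_cancel_left]
    exact Quotient.out_eq _

namespace UnramifiedQuadratic

variable {v : Valuation E ℤᵐ⁰} {q : ℕ} (D : UnramifiedQuadratic σ v q)

/-- The class of the element of norm one that represents a residue class. -/
abbrev rep {k : ℕ} (c : normOne σ ⧸ D.level k) : E := ((Quotient.out c : normOne σ) : Eˣ)

/-- The relative position condition for a pair of unimodular lattices. -/
def PairCond (ta tb : E) (n k : ℕ) (c₁ : normOne σ ⧸ D.level k)
    (c₂ : normOne σ ⧸ D.level (2 * n - k)) : Prop :=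
  v ta ≤ exp ((k : ℤ) - n) ∧ v tb ≤ exp ((n : ℤ) - k) ∧
    v (D.rep c₂ * tb - D.rep c₁ * ta) ≤ exp (-(n : ℤ))

/-- The number of pairs of lattices of given radii in the given relative position. -/
def pairCount (ta tb : E) (n k : ℕ) : ℕ :=
  Nat.card {c : (normOne σ ⧸ D.level k) × (normOne σ ⧸ D.level (2 * n - k)) //
    D.PairCond ta tb n k c.1 c.2}

variable {D} {ta tb : E} {i j e : ℤ}

theorem pairCount_eq_zero {n k : ℕ} (h : ∀ c₁ c₂, ¬ D.PairCond ta tb n k c₁ c₂) :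
    D.pairCount ta tb n k = 0 := by
  have : IsEmpty {c : (normOne σ ⧸ D.level k) × (normOne σ ⧸ D.level (2 * n - k)) //
    D.PairCond ta tb n k c.1 c.2} := ⟨fun c => h _ _ c.2⟩
  exact Nat.card_of_isEmpty

/-- When `n` is at most both valuations, all three inequalities are automatic and every pair of
classes counts. -/
theorem pairCount_of_le {n k : ℕ} (hi : v ta = exp (-i)) (hj : v tb = exp (-j))
    (hni : (n : ℤ) ≤ i) (hnj : (n : ℤ) ≤ j) (hk : k ≤ 2 * n) :
    D.pairCount ta tb n k = (D.level k).index * (D.level (2 * n - k)).index := by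
  rw [pairCount, Subgroup.index, Subgroup.index, ← Nat.card_prod]
  refine Nat.card_congr (Equiv.subtypeUnivEquiv fun c => ⟨?_, ?_, ?_⟩)
  · rw [hi, exp_le_exp]; omega
  · rw [hj, exp_le_exp]; omega
  · refine v.map_sub_le ?_ ?_
    · rw [map_mul, D.v_of_mem, one_mul, hj, exp_le_exp]; omega
    · rw [map_mul, D.v_of_mem, one_mul, hi, exp_le_exp]; omega

/-- If one valuation is below `n`, the two terms `z₂ tb` and `z₁ ta` must cancel, which the
ultrametric inequality permits only for equal valuations. -/
theorem PairCond.eq_of_lt {n k : ℕ} {c₁ : normOne σ ⧸ D.level k}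
    {c₂ : normOne σ ⧸ D.level (2 * n - k)} (h : D.PairCond ta tb n k c₁ c₂)
    (hi : v ta = exp (-i)) (hj : v tb = exp (-j)) (hn : i < n ∨ j < n) : i = j := by
  obtain ⟨-, -, h3⟩ := h
  have e1 : v (D.rep c₂ * tb) = exp (-j) := by rw [map_mul, D.v_of_mem, one_mul, hj]
  have e2 : v (D.rep c₁ * ta) = exp (-i) := by rw [map_mul, D.v_of_mem, one_mul, hi]
  rcases lt_trichotomy i j with hij | hij | hij
  · rw [v.map_sub_eq_of_lt_right (by rw [e1, e2, exp_lt_exp]; omega), e2, exp_le_exp] at h3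
    omega
  · exact hij
  · rw [v.map_sub_eq_of_lt_left (by rw [e1, e2, exp_lt_exp]; omega), e1, exp_le_exp] at h3
    omega

/-- The norms of `tb` and `ta` are those of `z₂ tb` and `z₁ ta`. If these elements agree to order
`n` and have valuation `i`, their norms agree to order `n + i`. -/
theorem PairCond.bounds {n k : ℕ} {c₁ : normOne σ ⧸ D.level k}
    {c₂ : normOne σ ⧸ D.level (2 * n - k)} (h : D.PairCond ta tb n k c₁ c₂)
    (hi : v ta = exp (-i)) (hj : v tb = exp (-i))
    (he : v (tb * σ tb - ta * σ ta) = exp (-e)) : (n : ℤ) - k ≤ i ∧ (k : ℤ) - n ≤ i ∧ n + i ≤ e := by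
  obtain ⟨h1, h2, h3⟩ := h
  rw [hi, exp_le_exp] at h1
  rw [hj, exp_le_exp] at h2
  refine ⟨by omega, by omega, ?_⟩
  have n1 : D.rep c₁ * σ (D.rep c₁) = 1 := (Quotient.out c₁ : normOne σ).2
  have n2 : D.rep c₂ * σ (D.rep c₂) = 1 := (Quotient.out c₂ : normOne σ).2
  have key : tb * σ tb - ta * σ ta = (D.rep c₂ * tb - D.rep c₁ * ta) * σ (D.rep c₂ * tb) +
      D.rep c₁ * ta * σ (D.rep c₂ * tb - D.rep c₁ * ta) := by
    simp only [map_mul, map_sub]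
    linear_combination (-tb * σ tb) * n2 + ta * σ ta * n1
  have : v (tb * σ tb - ta * σ ta) ≤ exp (-(n : ℤ)) * exp (-i) := by
    rw [key]
    refine v.map_add_le ?_ ?_
    · rw [map_mul, D.v_conj, map_mul, D.v_of_mem, one_mul, hj]
      gcongr
    · rw [map_mul, D.v_conj, map_mul, D.v_of_mem, one_mul, hi, mul_comm]
      gcongr
  rw [he, ← exp_add, exp_le_exp] at this
  omega

/-- The quotient `ta / tb` is within order `n - i` of some norm-one `z₀`, because its norm is close
to one. The condition then says that `z₂` lies in the coset of `z₁ z₀` modulo level `n - i`: `z₁` is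
free, and `z₂` has `q ^ (n + i - k)` choices. The product does not depend on `k`. -/
theorem pairCount_of_lt {n k : ℕ} {i : ℕ} {e : ℤ} (hi : v ta = exp (-(i : ℤ)))
    (hj : v tb = exp (-(i : ℤ))) (he : v (tb * σ tb - ta * σ ta) = exp (-e))
    (hn : i < n) (hne : n + i ≤ e) (h1 : n ≤ k + i) (h2 : k ≤ n + i) :
    D.pairCount ta tb n k = (q + 1) * q ^ (n + i - 1) := by
  have htb : tb ≠ 0 := fun h => by rw [h, map_zero] at hj; exact exp_ne_zero hj.symm
  have hσtb : σ tb ≠ 0 := by simpa using htb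
  have hr : ((n - i : ℕ) : ℤ) = n - i := by omega
  obtain ⟨z₀, hz₀⟩ := D.exists_normOne_near (t := ta / tb) (r := ((n - i : ℕ) : ℤ))
    (by rw [map_div₀, hi, hj, div_self exp_ne_zero]) (by
      have : ta / tb * σ (ta / tb) - 1 = -(tb * σ tb - ta * σ ta) / (tb * σ tb) := by
        rw [map_div₀]; field_simp; ring
      rw [this, map_div₀, Valuation.map_neg, he, map_mul, D.v_conj, hj, ← exp_add, ← exp_sub,
        exp_le_exp]
      omega)
  have hcond : ∀ c₁ c₂, D.PairCond ta tb n k c₁ c₂ ↔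
      (Quotient.out c₁ * z₀)⁻¹ * Quotient.out c₂ ∈ D.level (n - i) := by
    intro c₁ c₂
    rw [D.inv_mul_mem_level]
    have a1 : v ta ≤ exp ((k : ℤ) - n) := by rw [hi, exp_le_exp]; omega
    have a2 : v tb ≤ exp ((n : ℤ) - k) := by rw [hj, exp_le_exp]; omega
    simp only [PairCond, a1, a2, true_and]
    set z₁ : E := D.rep c₁
    set z₂ : E := D.rep c₂
    have e1 : z₂ * tb - z₁ * ta = tb * (z₂ - z₁ * (ta / tb)) := by field_simp
    have e2 : exp (-(n : ℤ)) = (exp (-(i : ℤ)) * exp (-((n - i : ℕ) : ℤ)) : ℤᵐ⁰) := by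
      rw [← exp_add]; congr 1; omega
    rw [e1, map_mul, hj, e2, mul_le_mul_iff_right₀ exp_pos]
    have e3 : ((Quotient.out c₂ : normOne σ) : Eˣ) - (((Quotient.out c₁ * z₀ : normOne σ) : Eˣ) : E)
      = (z₂ - z₁ * (ta / tb)) + z₁ * (ta / tb - ((z₀ : Eˣ) : E)) := by
        push_cast
        ring
    have e4 : v (z₁ * (ta / tb - ((z₀ : Eˣ) : E))) ≤ exp (-((n - i : ℕ) : ℤ)) := by
      rwa [map_mul, D.v_of_mem, one_mul]
    rw [e3]
    constructor
    · intro h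
      exact v.map_add_le h e4
    · intro h
      have := v.map_sub_le h e4
      rwa [add_sub_cancel_right] at this
  rw [pairCount]
  simp only [hcond]
  rw [Nat.card_subtype_prod_of_fiber
    (fun (c₁ : normOne σ ⧸ D.level k) (c₂ : normOne σ ⧸ D.level (2 * n - k)) =>
      (Quotient.out c₁ * z₀)⁻¹ * Quotient.out c₂ ∈ D.level (n - i))
    ((D.level (2 * n - k)).relIndex (D.level (n - i)))
    (fun c₁ => QuotientGroup.card_out_mem_coset (D.level_anti (by omega)) _),
    D.level_relIndex (by omega) (by omega)]
  change (D.level k).index * _ = _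
  rw [D.level_index (by omega), mul_assoc, ← pow_add]
  congr 2
  omega

/-- Each of the two ends `k = 0` and `k = 2(n + 1)` gives `(q + 1) q ^ (2n + 1)`. The interior terms
have constant size `(q + 1) ^ 2 q ^ (2n)`, and their odd number of alternating signs leaves one copy
with a minus sign. -/
theorem sum_pairCount_of_le {n : ℕ} (hi : v ta = exp (-i)) (hj : v tb = exp (-j))
    (hni : ((n + 1 : ℕ) : ℤ) ≤ i) (hnj : ((n + 1 : ℕ) : ℤ) ≤ j) :
    ∑ k ∈ Finset.range (2 * (n + 1) + 1), (-1 : ℤ) ^ k * D.pairCount ta tb (n + 1) k =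
      (q : ℤ) ^ (2 * (n + 1)) - (q : ℤ) ^ (2 * n) := by
  have h0 : ∀ k ∈ Finset.range (2 * (n + 1) + 1), (-1 : ℤ) ^ k * D.pairCount ta tb (n + 1) k =
      (-1 : ℤ) ^ k * ((D.level k).index * (D.level (2 * (n + 1) - k)).index : ℕ) := by
    intro k hk
    rw [pairCount_of_le hi hj hni hnj (by have := Finset.mem_range.1 hk; omega)]
  rw [Finset.sum_congr rfl h0, Finset.sum_range_succ, show 2 * (n + 1) = 2 * n + 1 + 1 by ring,
    Finset.sum_range_succ']
  have h1 : ∀ k ∈ Finset.range (2 * n + 1), (-1 : ℤ) ^ (k + 1) *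
      ((D.level (k + 1)).index * (D.level (2 * n + 1 + 1 - (k + 1))).index : ℕ) =
      (-1 : ℤ) ^ k * (-((q + 1) ^ 2 * q ^ (2 * n))) := by
    intro k hk
    have hk := Finset.mem_range.1 hk
    rw [D.level_index (by omega), D.level_index (by omega)]
    have : (q : ℤ) ^ (2 * n) = (q : ℤ) ^ k * (q : ℤ) ^ (2 * n - k) := by
      rw [← pow_add]; congr 1; omega
    rw [this, show 2 * n + 1 + 1 - (k + 1) - 1 = 2 * n - k by omega]
    push_cast
    ring
  rw [Finset.sum_congr rfl h1, ← Finset.sum_mul, Finset.sum_range_neg_one_pow_odd]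
  rw [Nat.sub_self, Nat.sub_zero, D.level_zero_index, D.level_index (by omega),
    show 2 * n + 1 + 1 - 1 = 2 * n + 1 by omega]
  have : (-1 : ℤ) ^ (2 * n + 1 + 1) = 1 := by
    rw [show 2 * n + 1 + 1 = 2 * (n + 1) by ring, pow_mul]; simp
  rw [this]
  push_cast
  ring

/-- Only `n - i ≤ k ≤ n + i` contributes. These are `2i + 1` equal terms with alternating signs, so
one term survives with the sign of `k = n - i`. -/
theorem sum_pairCount_of_lt {n i : ℕ} {e : ℤ} (hi : v ta = exp (-(i : ℤ)))
    (hj : v tb = exp (-(i : ℤ))) (he : v (tb * σ tb - ta * σ ta) = exp (-e))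
    (hn : i < n) (hne : n + i ≤ e) :
    ∑ k ∈ Finset.range (2 * n + 1), (-1 : ℤ) ^ k * D.pairCount ta tb n k =
      (-1 : ℤ) ^ (n - i) * ((q + 1) * q ^ (n + i - 1)) := by
  have h0 : ∀ k ∈ Finset.range (2 * n + 1), k ∉ Finset.Ico (n - i) (n + i + 1) →
      (-1 : ℤ) ^ k * D.pairCount ta tb n k = 0 := by
    intro k _ hk
    rw [pairCount_eq_zero, Nat.cast_zero, mul_zero]
    intro c₁ c₂ h
    have := h.bounds hi hj he
    apply hk
    rw [Finset.mem_Ico]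
    omega
  rw [← Finset.sum_subset (s₁ := Finset.Ico (n - i) (n + i + 1)) (fun k hk => by
    rw [Finset.mem_Ico] at hk; rw [Finset.mem_range]; omega) h0, Finset.sum_Ico_eq_sum_range,
    show n + i + 1 - (n - i) = 2 * i + 1 by omega]
  have h1 : ∀ k ∈ Finset.range (2 * i + 1), (-1 : ℤ) ^ (n - i + k) *
      D.pairCount ta tb n (n - i + k) =
      (-1 : ℤ) ^ k * ((-1 : ℤ) ^ (n - i) * ((q + 1) * q ^ (n + i - 1))) := by
    intro k hk
    have hk := Finset.mem_range.1 hk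
    rw [pairCount_of_lt hi hj he hn hne (by omega) (by omega)]
    push_cast
    ring
  rw [Finset.sum_congr rfl h1, ← Finset.sum_mul, Finset.sum_range_neg_one_pow_odd, one_mul]

/-- The alternating count of pairs of lattices. -/
theorem exists_sum_pairCount (hi : v ta = exp (-i)) (hj : v tb = exp (-j))
    (he : v (tb * σ tb - ta * σ ta) = exp (-e)) :
    ∃ N : ℕ, (∀ n k c₁ c₂, D.PairCond ta tb n k c₁ c₂ → k ≤ 2 * n → n < N) ∧
      ∑ n ∈ Finset.range N, ∑ k ∈ Finset.range (2 * n + 1),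
        (-1 : ℤ) ^ k * D.pairCount ta tb n k =
        if 0 ≤ i ∧ 0 ≤ j then (-(q : ℤ)) ^ e.toNat else 0 := by
  split_ifs with hij
  · obtain ⟨m, hm⟩ := Int.eq_ofNat_of_zero_le (le_min hij.1 hij.2)
    have hvi : v (tb * σ tb) = exp (-(2 * j)) := by
      rw [map_mul, D.v_conj, hj, ← exp_add]; congr 1; ring
    have hvj : v (ta * σ ta) = exp (-(2 * i)) := by
      rw [map_mul, D.v_conj, hi, ← exp_add]; congr 1; ring
    -- `w` is the extra valuation that the difference of norms gains by cancellation; without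
    -- equality of `i` and `j` there is none.
    have hew : ∃ w : ℕ, e = 2 * m + w ∧ (i ≠ j → w = 0) := by
      rcases lt_trichotomy i j with h | h | h
      · rw [v.map_sub_eq_of_lt_right (by rw [hvi, hvj, exp_lt_exp]; omega), hvj, exp_inj] at he
        exact ⟨0, by omega, by simp⟩
      · have := v.map_sub (tb * σ tb) (ta * σ ta)
        rw [he, hvi, hvj, h, max_self, exp_le_exp] at this
        exact ⟨(e - 2 * m).toNat, by omega, fun h' => absurd h h'⟩
      · rw [v.map_sub_eq_of_lt_left (by rw [hvi, hvj, exp_lt_exp]; omega), hvi, exp_inj] at he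
        exact ⟨0, by omega, by simp⟩
    obtain ⟨w, hw, hw0⟩ := hew
    -- Beyond `m`, `PairCond.bounds` gives `n + m ≤ e = 2m + w`, so `n ≤ m + w`.
    refine ⟨m + 1 + w, ?_, ?_⟩
    · intro n k c₁ c₂ h _
      by_contra hn
      have hij' := h.eq_of_lt hi hj (by omega)
      subst hij'
      have := h.bounds hi hj he
      omega
    -- The layers up to `m` telescope.
    · have hA : ∀ m' : ℕ, m' ≤ m → ∑ n ∈ Finset.range (m' + 1), ∑ k ∈ Finset.range (2 * n + 1),
          (-1 : ℤ) ^ k * D.pairCount ta tb n k = (q : ℤ) ^ (2 * m') := by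
        intro m' hm'
        induction m' with
        | zero =>
          simp [pairCount_of_le hi hj (n := 0) (k := 0) (by simpa using hij.1)
            (by simpa using hij.2) (by simp), level_zero_index]
        | succ m' ih =>
          rw [Finset.sum_range_succ, ih (by omega), sum_pairCount_of_le hi hj (by omega) (by omega)]
          ring
      -- Each further layer changes the total by the factor `-q`, since `1 - (q + 1) = -q`.
      have hB : ∀ w' : ℕ, w' ≤ w → ∑ n ∈ Finset.range (m + 1 + w'),
          ∑ k ∈ Finset.range (2 * n + 1), (-1 : ℤ) ^ k * D.pairCount ta tb n k =
            (q : ℤ) ^ (2 * m) * (-(q : ℤ)) ^ w' := by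
        intro w' hw'
        induction w' with
        | zero => rw [add_zero, hA m le_rfl]; simp
        | succ w' ih =>
          have hij' : i = j := by
            by_contra h
            have := hw0 h
            omega
          subst hij'
          rw [min_self] at hm
          subst hm
          rw [← add_assoc, Finset.sum_range_succ, ih (by omega),
            sum_pairCount_of_lt hi hj he (by omega) (by omega),
            show m + 1 + w' - m = w' + 1 by omega, show m + 1 + w' + m - 1 = 2 * m + w' by omega,
            neg_pow (q : ℤ) w', neg_pow (q : ℤ) (w' + 1)]
          ring
      rw [hB w le_rfl, hw, show (2 * (m : ℤ) + w).toNat = 2 * m + w by omega, pow_add,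
        pow_mul (-(q : ℤ)), neg_sq, ← pow_mul]
  -- If some valuation is negative, it is below every `n`. Both valuations then equal `i < 0`, while
  -- `n - k ≤ i` and `k - n ≤ i` add up to `0 ≤ 2i`.
  · refine ⟨0, ?_, by simp⟩
    intro n k c₁ c₂ h _
    exfalso
    have hij' := h.eq_of_lt hi hj (by omega)
    subst hij'
    have := h.bounds hi hj he
    omega

end UnramifiedQuadratic
end PairCount
end

/-! ### Unimodular Hermitian lattices in a plane, glued from the coordinate axes. -/

noncomputable section
section Lattices

open WithZero

variable {F E : Type*} [Field F] [Field E] [Algebra F E] {σ : E ≃ₐ[F] E}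

/-- A matrix with integral entries. -/
def IsIntegralMatrix {n : Type*} (v : Valuation E ℤᵐ⁰) (X : Matrix n n E) : Prop :=
  ∀ i j, v (X i j) ≤ 1

/-- The conjugate transpose with respect to `σ`. -/
def conjT {m n : Type*} (σ : E ≃ₐ[F] E) (X : Matrix m n E) : Matrix n m E := (X.map σ)ᵀ

theorem conjT_mul {l m n : Type*} [Fintype m] (X : Matrix l m E) (Y : Matrix m n E) :
    conjT σ (X * Y) = conjT σ Y * conjT σ X := by
  rw [conjT, Matrix.map_mul, Matrix.transpose_mul]; rfl

theorem conjT_one {n : Type*} [DecidableEq n] : conjT σ (1 : Matrix n n E) = 1 := by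
  rw [conjT, Matrix.map_one _ (map_zero σ) (map_one σ), Matrix.transpose_one]

theorem det_conjT {n : Type*} [Fintype n] [DecidableEq n] (X : Matrix n n E) :
    (conjT σ X).det = σ X.det := by
  rw [conjT, Matrix.det_transpose]
  exact (RingHom.map_det (σ : E →+* E) X).symm

namespace IsIntegralMatrix

variable {n : Type*} [Fintype n] {v : Valuation E ℤᵐ⁰} {X Y : Matrix n n E}

theorem mul (hX : IsIntegralMatrix v X) (hY : IsIntegralMatrix v Y) :
    IsIntegralMatrix v (X * Y) := fun i j => by
  rw [Matrix.mul_apply]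
  refine v.map_sum_le fun k _ => ?_
  rw [map_mul]
  exact mul_le_one' (hX i k) (hY k j)

theorem inv {X : Matrix (Fin 2) (Fin 2) E} (hX : IsIntegralMatrix v X) (hd : v X.det = 1) :
    IsIntegralMatrix v X⁻¹ := fun i j => by
  rw [Matrix.inv_def, Matrix.smul_apply, smul_eq_mul, map_mul, Ring.inverse_eq_inv', map_inv₀, hd,
    inv_one, one_mul, Matrix.adjugate_fin_two]
  fin_cases i <;> fin_cases j <;> simp [hX _ _]

end IsIntegralMatrix

namespace UnramifiedQuadratic

variable {v : Valuation E ℤᵐ⁰} {q : ℕ} (D : UnramifiedQuadratic σ v q)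
include D

local notation "ι" => algebraMap F E

theorem isIntegralMatrix_conjT {n : Type*} {X : Matrix n n E} (hX : IsIntegralMatrix v X) :
    IsIntegralMatrix v (conjT σ X) := fun i j => by
  change v (σ (X j i)) ≤ 1
  rw [D.v_conj]
  exact hX j i

/-- The uniformizer, as an element of the extension. -/
def ϖE : E := ι D.ϖ

theorem ϖE_ne_zero : D.ϖE ≠ 0 := by
  simpa [ϖE] using D.ϖ_ne_zero

theorem conj_ϖE : σ D.ϖE = D.ϖE := AlgEquiv.commutes _ _

theorem v_ϖE_zpow (n : ℤ) : v (D.ϖE ^ n) = exp (-n) := D.v_ϖ_zpow n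

theorem v_ϖE_zpow_mul_le_one_iff (n : ℤ) (x : E) : v (D.ϖE ^ n * x) ≤ 1 ↔ v x ≤ exp n := by
  rw [map_mul, D.v_ϖE_zpow, exp_neg, inv_mul_le_one₀ exp_pos]

theorem exists_norm_unit {a : E} (ha : σ a = a) (h : v a = 1) :
    ∃ z, z * σ z = a ∧ v z = 1 := by
  obtain ⟨b, rfl⟩ := D.exists_of_fixed a ha
  obtain ⟨z, hz⟩ := D.exists_norm b h
  refine ⟨z, hz, ?_⟩
  rw [← hz, map_mul, D.v_conj, ← sq] at h
  exact (pow_eq_one_iff_of_nonneg zero_le (by norm_num)).1 h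

theorem exists_ζ : ∃ z : E, z * σ z = -1 ∧ v z = 1 :=
  D.exists_norm_unit (by simp) (by simp)

/-- An element of norm `-1`. -/
def ζ : E := D.exists_ζ.choose

theorem norm_ζ : D.ζ * σ D.ζ = -1 := D.exists_ζ.choose_spec.1

theorem v_ζ : v D.ζ = 1 := D.exists_ζ.choose_spec.2

theorem ζ_ne_zero : D.ζ ≠ 0 := fun h => by simpa [h] using D.norm_ζ

/-- The basis matrix of a lattice with prescribed elementary divisors `m`, `s` and gluing `z`. -/
def glue (m s : ℤ) (z : E) : Matrix (Fin 2) (Fin 2) E :=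
  !![D.ϖE ^ (-s), 0; D.ζ * z * D.ϖE ^ (-s), D.ϖE ^ m]

/-- The inverse of `glue`. -/
def glueInv (m s : ℤ) (z : E) : Matrix (Fin 2) (Fin 2) E :=
  !![D.ϖE ^ s, 0; -(D.ζ * z * D.ϖE ^ (-m)), D.ϖE ^ (-m)]

theorem glue_mul_glueInv (m s : ℤ) (z : E) : D.glue m s z * D.glueInv m s z = 1 := by
  have h := D.ϖE_ne_zero
  have h1 : ∀ n : ℤ, D.ϖE ^ n * D.ϖE ^ (-n) = 1 := fun n => by
    rw [← zpow_add₀ h, add_neg_cancel, zpow_zero]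
  ext i j
  fin_cases i <;> fin_cases j <;> simp [glue, glueInv, -zpow_neg]
  · linear_combination h1 s
  · linear_combination D.ζ * z * h1 s - D.ζ * z * h1 m
  · exact h1 m

theorem glueInv_mul_glue (m s : ℤ) (z : E) : D.glueInv m s z * D.glue m s z = 1 :=
  mul_eq_one_comm.1 (D.glue_mul_glueInv m s z)

theorem det_glueInv (m s : ℤ) (z : E) : (D.glueInv m s z).det = D.ϖE ^ (s - m) := by
  rw [glueInv, Matrix.det_fin_two_of, zero_mul, sub_zero, ← zpow_add₀ D.ϖE_ne_zero, sub_eq_add_neg]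

/-- Taking determinants shows that `ϖ ^ e` times `det A` has a square of valuation one. -/
theorem v_det_of_conjT_mul {A M : Matrix (Fin 2) (Fin 2) E} {e : ℤ} (hM : v M.det = 1)
    (hA : D.ϖE ^ e • (conjT σ A * A) = M) : v A.det = exp e := by
  have h := hM
  rw [← hA, Matrix.det_smul, Matrix.det_mul, det_conjT, map_mul, map_mul, D.v_conj, map_pow,
    D.v_ϖE_zpow, Fintype.card_fin, ← sq, ← mul_pow] at h
  have h2 := (pow_eq_one_iff_of_nonneg zero_le (by norm_num)).1 h
  rw [exp_neg, inv_mul_eq_one₀ exp_ne_zero] at h2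
  exact h2.symm

/-- Every lattice that is unimodular for `ϖ ^ e` times the standard form is glued from the
coordinate axes. -/
theorem exists_glueInv_mul_of_le {A M : Matrix (Fin 2) (Fin 2) E} {e : ℤ}
    (hMi : IsIntegralMatrix v M) (hM : v M.det = 1) (hA : D.ϖE ^ e • (conjT σ A * A) = M)
    (hle : v (A 0 1) ≤ v (A 0 0)) :
    ∃ (s : ℤ) (k : ℕ) (z : normOne σ), (k : ℤ) = 2 * s - e ∧
      ∀ w : E, v (((z : Eˣ) : E) - w) ≤ exp (-(k : ℤ)) →
      IsIntegralMatrix v (D.glueInv (s - e) s w * A) := by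
  have hdet := D.v_det_of_conjT_mul hM hA
  have hϖ := D.ϖE_ne_zero
  have hα : A 0 0 ≠ 0 := by
    intro h
    rw [h, map_zero, le_zero_iff, map_eq_zero] at hle
    rw [Matrix.det_fin_two, h, hle] at hdet
    simp only [zero_mul, sub_zero, map_zero] at hdet
    exact exp_ne_zero hdet.symm
  -- `α` is a largest entry of the top row, so the lattice projects onto `ϖ ^ (-s)` times the
  -- integers of the first axis.
  obtain ⟨s, hs⟩ : ∃ s : ℤ, v (A 0 0) = exp s := ⟨_, (exp_log ((v.ne_zero_iff).2 hα)).symm⟩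
  set α := A 0 0
  set β := A 0 1
  set γ := A 1 0
  set δ := A 1 1
  -- Column reduction: `u` is the slope of the first basis vector, and `d` is what remains of the
  -- second one on the second axis. The three Gram entries then bound `1 + u σ(u)`, `u` and `d`.
  set u := γ / α with hu
  set d := δ - u * β with hd
  have hγ : γ = u * α := by rw [hu]; field_simp
  have hδ : δ = u * β + d := by rw [hd]; ring
  have hvd : v d = exp (e - s) := by
    have : A.det = α * d := by
      rw [Matrix.det_fin_two, hd, hu]
      field_simp
      exact congrArg _ (mul_comm _ _)
    rw [this, map_mul, hs] at hdet
    rw [exp_sub, eq_div_iff exp_ne_zero, mul_comm]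
    exact hdet
  have hM' : ∀ i j, v ((conjT σ A * A) i j) ≤ exp e := by
    intro i j
    have := hMi i j
    rw [← hA, Matrix.smul_apply, smul_eq_mul, map_mul, D.v_ϖE_zpow, exp_neg,
      inv_mul_le_one₀ exp_pos] at this
    exact this
  have hMat : ∀ i j, (conjT σ A * A) i j = σ (A 0 i) * A 0 j + σ (A 1 i) * A 1 j := by
    intro i j
    rw [Matrix.mul_apply, Fin.sum_univ_two]
    rfl
  have h1 : v (1 + u * σ u) ≤ exp (e - 2 * s) := by
    have := hM' 0 0
    rw [hMat] at this
    change v (σ α * α + σ γ * γ) ≤ _ at this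
    have e1 : σ α * α + σ γ * γ = (1 + u * σ u) * (α * σ α) := by
      rw [hγ, map_mul]; ring
    rw [e1, map_mul, map_mul, D.v_conj, hs, ← exp_add] at this
    rw [show e - 2 * s = e - (s + s) by ring, exp_sub, le_div_iff₀ exp_pos]
    exact this
  have hβ : v β ≤ exp s := hs ▸ hle
  have h2 : v u ≤ 1 := by
    have := hM' 0 1
    rw [hMat] at this
    change v (σ α * β + σ γ * δ) ≤ _ at this
    have e1 : σ γ * d = (σ α * β + σ γ * δ) - σ α * β * (1 + u * σ u) := by
      rw [hδ, hγ, map_mul]; ring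
    have h3 : v (σ γ * d) ≤ exp e := by
      rw [e1]
      refine v.map_sub_le this ?_
      rw [map_mul, map_mul, D.v_conj, hs]
      calc exp s * v β * v (1 + u * σ u) ≤ exp s * exp s * exp (e - 2 * s) := by gcongr
        _ = exp e := by rw [← exp_add, ← exp_add]; congr 1; ring
    rw [map_mul, D.v_conj, hvd, hγ, map_mul, hs, mul_assoc, ← exp_add, add_sub_cancel] at h3
    have := le_div_iff₀ (exp_pos (a := e)) |>.2 h3
    rwa [div_self exp_ne_zero] at this
  -- The Gram entry of the second vector bounds `d σ(d)`, whose valuation is known from the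
  -- determinant.
  have h4 : e ≤ 2 * s := by
    have := hM' 1 1
    rw [hMat] at this
    change v (σ β * β + σ δ * δ) ≤ _ at this
    have e1 : d * σ d = (σ β * β + σ δ * δ) - (σ β * β * (1 + u * σ u) +
        (σ u * σ β * d + u * β * σ d)) := by
      rw [hδ, map_add, map_mul]; ring
    have h3 : v (d * σ d) ≤ exp e := by
      rw [e1]
      refine v.map_sub_le this (v.map_add_le ?_ (v.map_add_le ?_ ?_))
      · rw [map_mul, map_mul, D.v_conj]
        calc v β * v β * v (1 + u * σ u) ≤ exp s * exp s * exp (e - 2 * s) := by gcongr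
          _ = exp e := by rw [← exp_add, ← exp_add]; congr 1; ring
      · rw [map_mul, map_mul, D.v_conj, D.v_conj, hvd]
        calc v u * v β * exp (e - s) ≤ 1 * exp s * exp (e - s) := by gcongr
          _ = exp e := by rw [one_mul, ← exp_add]; congr 1; ring
      · rw [map_mul, map_mul, D.v_conj, hvd]
        calc v u * v β * exp (e - s) ≤ 1 * exp s * exp (e - s) := by gcongr
          _ = exp e := by rw [one_mul, ← exp_add]; congr 1; ring
    rw [map_mul, D.v_conj, hvd, ← exp_add, exp_le_exp] at h3
    omega
  have hk : (((2 * s - e).toNat : ℕ) : ℤ) = 2 * s - e := by omega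
  have hζ := D.ζ_ne_zero
  have hζ' : σ D.ζ ≠ 0 := by simpa using hζ
  -- The first basis vector is nearly isotropic: `u σ(u)` is close to `-1`. Division by `ζ` turns
  -- this into a norm close to one.
  obtain ⟨z, hz⟩ := D.exists_normOne_near (t := u / D.ζ) (r := 2 * s - e)
    (by rw [map_div₀, D.v_ζ, div_one]; exact h2) (by
      have : u / D.ζ * σ (u / D.ζ) - 1 = -(1 + u * σ u) := by
        rw [map_div₀, div_mul_div_comm, D.norm_ζ]; ring
      rw [this, Valuation.map_neg, show -(2 * s - e) = e - 2 * s by ring]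
      exact h1)
  refine ⟨s, (2 * s - e).toNat, z, hk, ?_⟩
  intro w hw
  rw [hk] at hw
  have h5 : v (u - D.ζ * w) ≤ exp (e - 2 * s) := by
    have e1 : u - D.ζ * w = D.ζ * ((u / D.ζ - ((z : Eˣ) : E)) + (((z : Eˣ) : E) - w)) := by
      field_simp; ring
    rw [e1, map_mul, D.v_ζ, one_mul, show e - 2 * s = -(2 * s - e) by ring]
    exact v.map_add_le hz hw
  have r1 : exp s * exp (-s) = (1 : ℤᵐ⁰) := by rw [← exp_add]; simp
  have g1 : v (D.ϖE ^ s * α) ≤ 1 := by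
    rw [map_mul, D.v_ϖE_zpow, hs, mul_comm, r1]
  have g2 : v (D.ϖE ^ s * β) ≤ 1 := by
    rw [map_mul, D.v_ϖE_zpow, mul_comm]
    exact (mul_le_mul_left hβ _).trans r1.le
  have g3 : v (D.ϖE ^ (-(s - e)) * (γ - D.ζ * w * α)) ≤ 1 := by
    have : γ - D.ζ * w * α = (u - D.ζ * w) * α := by rw [hγ]; ring
    rw [this, map_mul, map_mul, D.v_ϖE_zpow, hs]
    calc exp (- -(s - e)) * (v (u - D.ζ * w) * exp s)
        ≤ exp (- -(s - e)) * (exp (e - 2 * s) * exp s) := by gcongr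
      _ = 1 := by rw [← exp_add, ← exp_add, ← exp_zero]; congr 1; ring
  have g4 : v (D.ϖE ^ (-(s - e)) * (δ - D.ζ * w * β)) ≤ 1 := by
    have : δ - D.ζ * w * β = (u - D.ζ * w) * β + d := by rw [hδ]; ring
    rw [this, map_mul, D.v_ϖE_zpow]
    have h6 : v ((u - D.ζ * w) * β + d) ≤ exp (e - s) := by
      refine v.map_add_le ?_ hvd.le
      rw [map_mul]
      calc v (u - D.ζ * w) * v β ≤ exp (e - 2 * s) * exp s := by gcongr
        _ = exp (e - s) := by rw [← exp_add]; congr 1; ring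
    calc exp (- -(s - e)) * v ((u - D.ζ * w) * β + d) ≤ exp (- -(s - e)) * exp (e - s) := by gcongr
      _ = 1 := by rw [← exp_add, ← exp_zero]; congr 1; ring
  intro i j
  rw [Matrix.mul_apply, Fin.sum_univ_two, glueInv]
  fin_cases i <;> fin_cases j
  · simpa using g1
  · simpa using g2
  · refine le_of_eq_of_le (congrArg v ?_) g3
    simp; ring
  · refine le_of_eq_of_le (congrArg v ?_) g4
    simp; ring

/-- Exchanging the two basis vectors changes neither the lattice nor the hypotheses, and makes the
first one dominate in the top row. -/
theorem exists_glueInv_mul {A M : Matrix (Fin 2) (Fin 2) E} {e : ℤ}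
    (hMi : IsIntegralMatrix v M) (hM : v M.det = 1) (hA : D.ϖE ^ e • (conjT σ A * A) = M) :
    ∃ (s : ℤ) (k : ℕ) (z : normOne σ), (k : ℤ) = 2 * s - e ∧
      ∀ w : E, v (((z : Eˣ) : E) - w) ≤ exp (-(k : ℤ)) →
      IsIntegralMatrix v (D.glueInv (s - e) s w * A) := by
  rcases le_total (v (A 0 1)) (v (A 0 0)) with h | h
  · exact D.exists_glueInv_mul_of_le hMi hM hA h
  · set S : Matrix (Fin 2) (Fin 2) E := !![0, 1; 1, 0] with hS
    have hSS : S * S = 1 := by rw [hS, Matrix.mul_fin_two, Matrix.one_fin_two]; simp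
    have hSc : conjT σ S = S := by
      ext i j; fin_cases i <;> fin_cases j <;> simp [hS, conjT]
    have hSi : IsIntegralMatrix v S := by
      intro i j; fin_cases i <;> fin_cases j <;> simp [hS]
    have hSd : S.det * S.det = 1 := by rw [← Matrix.det_mul, hSS, Matrix.det_one]
    obtain ⟨s, k, z, hk, H⟩ := D.exists_glueInv_mul_of_le (A := A * S) (M := S * M * S) (e := e)
      ((hSi.mul hMi).mul hSi) (by
        rw [Matrix.det_mul, Matrix.det_mul, mul_right_comm, hSd, one_mul, hM])
      (by rw [conjT_mul, hSc, ← hA]; simp only [Matrix.mul_assoc, Matrix.smul_mul, Matrix.mul_smul])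
      (by simpa [hS, Matrix.mul_apply, Fin.sum_univ_two] using h)
    refine ⟨s, k, z, hk, fun w hw => ?_⟩
    have := (H w hw).mul hSi
    rwa [← Matrix.mul_assoc, Matrix.mul_assoc _ S, hSS, Matrix.mul_one] at this

-- Unimodular changes of basis at source and target do not affect whether a map sends one lattice
-- into the other.
omit D in
omit [Field F] [Algebra F E] in
theorem isIntegralMatrix_mul_mul_iff {K L X : Matrix (Fin 2) (Fin 2) E}
    (hK : IsIntegralMatrix v K) (hKd : v K.det = 1) (hL : IsIntegralMatrix v L)
    (hLd : v L.det = 1) : IsIntegralMatrix v (K⁻¹ * X * L) ↔ IsIntegralMatrix v X := by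
  constructor
  · intro h
    have h1 := (hK.mul h).mul (hL.inv hLd)
    have hKu : IsUnit K.det := isUnit_iff_ne_zero.2 fun h => by simp [h] at hKd
    have hLu : IsUnit L.det := isUnit_iff_ne_zero.2 fun h => by simp [h] at hLd
    rwa [Matrix.mul_assoc K⁻¹, Matrix.mul_nonsing_inv_cancel_left _ _ hKu,
      Matrix.mul_nonsing_inv_cancel_right _ _ hLu] at h1
  · intro h
    exact ((hK.inv hKd).mul h).mul hL

/-- The relative position of two glued lattices under a diagonal matrix. -/
theorem isIntegralMatrix_glue_iff {m₁ s₁ m₂ s₂ : ℤ} {z₁ z₂ ta tb : E} :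
    IsIntegralMatrix v (D.glueInv m₁ s₁ z₁ * Matrix.diagonal ![ta, tb] * D.glue m₂ s₂ z₂) ↔
      v ta ≤ exp (s₁ - s₂) ∧ v tb ≤ exp (m₂ - m₁) ∧ v (z₂ * tb - z₁ * ta) ≤ exp (-(m₁ + s₂)) := by
  have hϖ := D.ϖE_ne_zero
  have hmat : D.glueInv m₁ s₁ z₁ * Matrix.diagonal ![ta, tb] * D.glue m₂ s₂ z₂ =
      !![D.ϖE ^ (s₁ - s₂) * ta, 0; D.ζ * D.ϖE ^ (-(m₁ + s₂)) * (z₂ * tb - z₁ * ta),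
        D.ϖE ^ (m₂ - m₁) * tb] := by
    have hdiag : Matrix.diagonal ![ta, tb] = !![ta, 0; 0, tb] := by
      ext i j; fin_cases i <;> fin_cases j <;> rfl
    rw [hdiag, glueInv, glue, Matrix.mul_fin_two, Matrix.mul_fin_two, sub_eq_add_neg s₁,
      sub_eq_add_neg m₂, neg_add, zpow_add₀ hϖ, zpow_add₀ hϖ, zpow_add₀ hϖ]
    ext i j
    fin_cases i <;> fin_cases j <;> simp [-zpow_neg] <;> ring
  have h0 : IsIntegralMatrix v !![D.ϖE ^ (s₁ - s₂) * ta, 0;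
      D.ζ * D.ϖE ^ (-(m₁ + s₂)) * (z₂ * tb - z₁ * ta), D.ϖE ^ (m₂ - m₁) * tb] ↔
      v (D.ϖE ^ (s₁ - s₂) * ta) ≤ 1 ∧ v (D.ϖE ^ (m₂ - m₁) * tb) ≤ 1 ∧
        v (D.ζ * D.ϖE ^ (-(m₁ + s₂)) * (z₂ * tb - z₁ * ta)) ≤ 1 := by
    constructor
    · intro h
      exact ⟨h 0 0, h 1 1, h 1 0⟩
    · rintro ⟨h1, h2, h3⟩ i j
      fin_cases i <;> fin_cases j
      · exact h1
      · simp
      · exact h3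
      · exact h2
  rw [hmat, h0, D.v_ϖE_zpow_mul_le_one_iff, D.v_ϖE_zpow_mul_le_one_iff, mul_assoc, map_mul, D.v_ζ,
    one_mul, D.v_ϖE_zpow_mul_le_one_iff]

/-- A unimodular Hermitian form in two variables represents a unit. -/
theorem exists_primitive_vector {M : Matrix (Fin 2) (Fin 2) E} (hMi : IsIntegralMatrix v M)
    (hM : v M.det = 1) (hH : conjT σ M = M) :
    ∃ x y : E, v x ≤ 1 ∧ v y ≤ 1 ∧
      v (σ x * (M 0 0 * x + M 0 1 * y) + σ y * (M 1 0 * x + M 1 1 * y)) = 1 := by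
  by_cases h0 : v (M 0 0) = 1
  · exact ⟨1, 0, by simp, by simp, by simpa using h0⟩
  by_cases h1 : v (M 1 1) = 1
  · exact ⟨0, 1, by simp, by simp, by simpa using h1⟩
  have h0' := lt_of_le_of_ne (hMi 0 0) h0
  have h1' := lt_of_le_of_ne (hMi 1 1) h1
  have hσ : σ (M 0 1) = M 1 0 := congrFun (congrFun hH 1) 0
  -- With both diagonal entries non-units, the unit determinant must come from the off-diagonal
  -- product.
  have hv : v (M 0 1) = 1 := by
    have e1 : v (M 0 0 * M 1 1) < 1 := by
      rw [map_mul]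
      exact mul_lt_one_of_lt_of_le h0' h1'.le
    have e2 : M 0 1 * M 1 0 = M 0 0 * M 1 1 - M.det := by rw [Matrix.det_fin_two]; ring
    have e3 : v (M 0 1 * M 1 0) = 1 := by
      rw [e2, v.map_sub_eq_of_lt_right (by rwa [hM]), hM]
    rw [map_mul, ← hσ, D.v_conj, ← sq] at e3
    exact (pow_eq_one_iff_of_nonneg zero_le (by norm_num)).1 e3
  have hne : M 0 1 ≠ 0 := fun h => by simp [h] at hv
  have hne' : M 1 0 ≠ 0 := by rw [← hσ]; simpa using hne
  -- The cross terms of this vector add up to `2`, a unit by odd residue characteristic; the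
  -- diagonal terms are non-units.
  refine ⟨1, (M 0 1)⁻¹, by simp, by simp [hv], ?_⟩
  have e1 : σ 1 * (M 0 0 * 1 + M 0 1 * (M 0 1)⁻¹) + σ (M 0 1)⁻¹ * (M 1 0 * 1 + M 1 1 * (M 0 1)⁻¹) =
      2 + (M 0 0 + (M 1 0)⁻¹ * M 1 1 * (M 0 1)⁻¹) := by
    rw [map_inv₀, hσ, map_one]; field_simp; ring
  rw [e1, v.map_add_eq_of_lt_left, D.v_two]
  rw [D.v_two]
  refine v.map_add_lt h0' ?_
  rw [map_mul, map_mul, map_inv₀, map_inv₀, hv, ← hσ, D.v_conj, hv]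
  simpa using h1'

/-- A unimodular Hermitian form in two variables is equivalent to the standard one. -/
theorem exists_conjT_mul_self {M : Matrix (Fin 2) (Fin 2) E} (hMi : IsIntegralMatrix v M)
    (hM : v M.det = 1) (hH : conjT σ M = M) :
    ∃ C : Matrix (Fin 2) (Fin 2) E, IsIntegralMatrix v C ∧ v C.det = 1 ∧ conjT σ C * C = M := by
  obtain ⟨x, y, hx, hy, hxy⟩ := D.exists_primitive_vector hMi hM hH
  have h00 : σ (M 0 0) = M 0 0 := congrFun (congrFun hH 0) 0
  have h11 : σ (M 1 1) = M 1 1 := congrFun (congrFun hH 1) 1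
  have h01 : σ (M 0 1) = M 1 0 := congrFun (congrFun hH 1) 0
  have h10 : σ (M 1 0) = M 0 1 := congrFun (congrFun hH 0) 1
  set r₁ := σ x * M 0 0 + σ y * M 1 0 with hr₁
  set r₂ := σ x * M 0 1 + σ y * M 1 1 with hr₂
  set a := σ x * (M 0 0 * x + M 0 1 * y) + σ y * (M 1 0 * x + M 1 1 * y) with ha
  have har : a = r₁ * x + r₂ * y := by rw [ha, hr₁, hr₂]; ring
  have hσa : σ a = a := by
    rw [ha]; simp only [map_add, map_mul, D.conj_conj, h00, h01, h10, h11]; ring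
  have hσr₁ : σ r₁ = M 0 0 * x + M 0 1 * y := by
    rw [hr₁]; simp only [map_add, map_mul, D.conj_conj, h00, h10]; ring
  have hσr₂ : σ r₂ = M 1 0 * x + M 1 1 * y := by
    rw [hr₂]; simp only [map_add, map_mul, D.conj_conj, h01, h11]; ring
  have hvσx : v (σ x) ≤ 1 := by rwa [D.v_conj]
  have hvσy : v (σ y) ≤ 1 := by rwa [D.v_conj]
  have hvr₁ : v r₁ ≤ 1 := v.map_add_le (by rw [map_mul]; exact mul_le_one' hvσx (hMi _ _))
    (by rw [map_mul]; exact mul_le_one' hvσy (hMi _ _))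
  have hvr₂ : v r₂ ≤ 1 := v.map_add_le (by rw [map_mul]; exact mul_le_one' hvσx (hMi _ _))
    (by rw [map_mul]; exact mul_le_one' hvσy (hMi _ _))
  -- The second column is orthogonal to the primitive vector `(x, y)`. The determinant is the norm
  -- `a` of that vector, hence a unit.
  set R : Matrix (Fin 2) (Fin 2) E := !![x, -r₂; y, r₁] with hR
  have hRi : IsIntegralMatrix v R := by
    intro i j
    fin_cases i <;> fin_cases j
    · exact hx
    · simpa [hR] using hvr₂
    · exact hy
    · exact hvr₁
  have hRd : R.det = a := by rw [hR, Matrix.det_fin_two_of, har]; ring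
  have hRdu : IsUnit R.det := isUnit_iff_ne_zero.2 fun h => by
    rw [hRd] at h; rw [h, map_zero] at hxy; exact zero_ne_one hxy
  set b := a * M.det with hb
  have hMd : σ M.det = M.det := by rw [← det_conjT, hH]
  obtain ⟨c, hc, hcv⟩ := D.exists_norm_unit hσa hxy
  obtain ⟨c', hc', hcv'⟩ := D.exists_norm_unit (a := b) (by rw [hb, map_mul, hσa, hMd])
    (by rw [hb, map_mul, hxy, hM, one_mul])
  -- In this orthogonal basis the form is `diag(a, a det M)`; both entries are fixed units, hence
  -- norms.
  have hRM : conjT σ R * M * R = conjT σ (Matrix.diagonal ![c, c']) * Matrix.diagonal ![c, c'] := by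
    have e1 : conjT σ (Matrix.diagonal ![c, c']) * Matrix.diagonal ![c, c'] = !![a, 0; 0, b] := by
      rw [← hc, ← hc']
      ext i j
      fin_cases i <;> fin_cases j <;> simp [conjT, Matrix.mul_apply, Fin.sum_univ_two, mul_comm]
    have e2 : conjT σ R = !![σ x, σ y; -σ r₂, σ r₁] := by
      ext i j
      fin_cases i <;> fin_cases j <;> simp [conjT, hR]
    rw [e1, e2, hR, Matrix.eta_fin_two M, Matrix.mul_fin_two, Matrix.mul_fin_two, hσr₁, hσr₂]
    congr! 3
    · rw [ha]; ring
    · simp only [hr₁, hr₂, Matrix.vecCons_inj]; exact ⟨by ring, trivial⟩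
    · congr! 1
      · ring
      · congr! 1
        rw [hb, Matrix.det_fin_two, har]
        ring
  have hdi : IsIntegralMatrix v (Matrix.diagonal ![c, c']) := by
    intro i j
    fin_cases i <;> fin_cases j <;> simp [hcv, hcv']
  refine ⟨Matrix.diagonal ![c, c'] * R⁻¹, hdi.mul (hRi.inv (by rw [hRd, hxy])), ?_, ?_⟩
  · rw [Matrix.det_mul, Matrix.det_diagonal, Matrix.det_nonsing_inv, map_mul, Fin.prod_univ_two,
      Ring.inverse_eq_inv', map_inv₀, hRd, hxy]
    simp [hcv, hcv']
  · have e3 : conjT σ R⁻¹ * conjT σ R = 1 := by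
      rw [← conjT_mul, Matrix.mul_nonsing_inv _ hRdu, conjT_one]
    rw [conjT_mul]
    calc conjT σ R⁻¹ * conjT σ (Matrix.diagonal ![c, c']) * (Matrix.diagonal ![c, c'] * R⁻¹)
        = conjT σ R⁻¹ * (conjT σ (Matrix.diagonal ![c, c']) * Matrix.diagonal ![c, c']) * R⁻¹ := by
          simp only [Matrix.mul_assoc]
      _ = (conjT σ R⁻¹ * conjT σ R) * M * (R * R⁻¹) := by rw [← hRM]; simp only [Matrix.mul_assoc]
      _ = M := by rw [e3, Matrix.mul_nonsing_inv _ hRdu, Matrix.one_mul, Matrix.mul_one]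

/-- Every glued lattice occurs. -/
theorem exists_isIntegralMatrix_glueInv_mul {M : Matrix (Fin 2) (Fin 2) E} {m s : ℤ}
    (hms : 0 ≤ m + s) (hMi : IsIntegralMatrix v M) (hM : v M.det = 1) (hH : conjT σ M = M)
    (z : normOne σ) :
    ∃ A : Matrix (Fin 2) (Fin 2) E, D.ϖE ^ (s - m) • (conjT σ A * A) = M ∧
      IsIntegralMatrix v (D.glueInv m s ((z : Eˣ) : E) * A) := by
  set w : E := ((z : Eˣ) : E)
  have hw : w * σ w = 1 := z.2
  have hvw : v w = 1 := D.v_of_mem z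
  have hϖ := D.ϖE_ne_zero
  -- The rescaled Gram matrix of the glued basis. Its first vector is isotropic, because `ζ w` has
  -- norm `-1`. The matrix is integral by `0 ≤ m + s`, and its determinant is a unit.
  set N : Matrix (Fin 2) (Fin 2) E := !![0, σ (D.ζ * w); D.ζ * w, D.ϖE ^ (m + s)] with hN
  have hNeq : D.ϖE ^ (s - m) • (conjT σ (D.glue m s w) * D.glue m s w) = N := by
    have e1 : conjT σ (D.glue m s w) =
        !![D.ϖE ^ (-s), σ (D.ζ * w) * D.ϖE ^ (-s); 0, D.ϖE ^ m] := by
      ext i j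
      fin_cases i <;> fin_cases j <;> simp [conjT, glue, D.conj_ϖE]
    have h1 : ∀ a b c : ℤ, D.ϖE ^ a * (D.ϖE ^ b * D.ϖE ^ c) = D.ϖE ^ (a + b + c) := fun a b c => by
      rw [zpow_add₀ hϖ, zpow_add₀ hϖ, mul_assoc]
    have h2 := h1 (s - m) (-s) m
    have h3 := h1 (s - m) m m
    rw [show s - m + -s + m = 0 by ring, zpow_zero] at h2
    rw [show s - m + m + m = m + s by ring] at h3
    rw [e1, glue, hN, Matrix.mul_fin_two]
    ext i j
    fin_cases i <;> fin_cases j <;> simp [-zpow_neg]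
    · have h4 := D.norm_ζ
      right
      linear_combination D.ϖE ^ (-s) * D.ϖE ^ (-s) * (w * σ w * h4 - hw)
    · linear_combination σ D.ζ * σ w * h2
    · linear_combination D.ζ * w * h2
    · exact h3
  have hNi : IsIntegralMatrix v N := by
    intro i j
    fin_cases i <;> fin_cases j
    · simp [hN]
    · simp [hN, D.v_conj, D.v_ζ, hvw]
    · simp [hN, D.v_ζ, hvw]
    · simp only [hN, Fin.mk_one, Matrix.of_apply, Matrix.cons_val', Matrix.cons_val_one,
        Matrix.cons_val_fin_one, D.v_ϖE_zpow]
      rw [← exp_zero, exp_le_exp]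
      omega
  have hNd : v N.det = 1 := by
    rw [hN, Matrix.det_fin_two_of]
    simp [D.v_conj, D.v_ζ, hvw]
  have hNH : conjT σ N = N := by
    ext i j
    fin_cases i <;> fin_cases j <;> simp [conjT, hN, D.conj_conj, D.conj_ϖE]
  obtain ⟨C, hCi, hCd, hC⟩ := D.exists_conjT_mul_self hMi hM hH
  obtain ⟨B, hBi, hBd, hB⟩ := D.exists_conjT_mul_self hNi hNd hNH
  have hBu : IsUnit B.det := isUnit_iff_ne_zero.2 fun h => by simp [h] at hBd
  have e3 : conjT σ B⁻¹ * conjT σ B = 1 := by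
    rw [← conjT_mul, Matrix.mul_nonsing_inv _ hBu, conjT_one]
  -- Both `N` and `M` are equivalent to the standard form, so a unimodular change of basis turns the
  -- Gram matrix `N` into `M` without moving the lattice.
  refine ⟨D.glue m s w * (B⁻¹ * C), ?_, ?_⟩
  · rw [conjT_mul, conjT_mul]
    calc D.ϖE ^ (s - m) • (conjT σ C * conjT σ B⁻¹ * conjT σ (D.glue m s w) *
          (D.glue m s w * (B⁻¹ * C)))
        = conjT σ C * conjT σ B⁻¹ * (D.ϖE ^ (s - m) • (conjT σ (D.glue m s w) * D.glue m s w)) *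
          (B⁻¹ * C) := by
          simp only [Matrix.mul_assoc, Matrix.smul_mul, Matrix.mul_smul]
      _ = conjT σ C * (conjT σ B⁻¹ * conjT σ B) * (B * B⁻¹) * C := by
          rw [hNeq, ← hB]; simp only [Matrix.mul_assoc]
      _ = M := by rw [e3, Matrix.mul_nonsing_inv _ hBu, Matrix.mul_one, Matrix.mul_one, hC]
  · rw [← Matrix.mul_assoc, D.glueInv_mul_glue, Matrix.one_mul]
    exact (hBi.inv hBd).mul hCi

end UnramifiedQuadratic
end Lattices
end

/-! ### The arithmetic of an unramified quadratic extension, from the axioms of local fields. -/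

noncomputable section
section LocalFields

open WithZero

/-- The valuation of a local field with values in the integers. -/
def intValuation (K : Type*) [Field K] [ValuativeRel K] [TopologicalSpace K]
    [IsNonarchimedeanLocalField K] : Valuation K ℤᵐ⁰ :=
  (valuation K).map
    (MonoidWithZeroHom.ofClass
      (IsNonarchimedeanLocalField.valueGroupWithZeroIsoInt K))
    (IsNonarchimedeanLocalField.valueGroupWithZeroIsoInt K).strictMono.monotone

section OneField

variable {K : Type*} [Field K] [ValuativeRel K] [TopologicalSpace K]
  [IsNonarchimedeanLocalField K]

theorem intValuation_apply (x : K) : intValuation K x =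
    IsNonarchimedeanLocalField.valueGroupWithZeroIsoInt K (valuation K x) := rfl

theorem intValuation_le_iff {x y : K} :
    intValuation K x ≤ intValuation K y ↔ valuation K x ≤ valuation K y := by
  rw [intValuation_apply, intValuation_apply, map_le_map_iff]

theorem mem_integer_iff {x : K} : x ∈ (valuation K).integer ↔ intValuation K x ≤ 1 := by
  rw [Valuation.mem_integer_iff, ← map_one (intValuation K), intValuation_le_iff, map_one]

theorem exists_intValuation_eq_exp (n : ℤ) : ∃ x : K, intValuation K x = exp n := by
  obtain ⟨x, hx⟩ := ValuativeRel.valuation_surjective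
    ((IsNonarchimedeanLocalField.valueGroupWithZeroIsoInt K).symm (exp n))
  exact ⟨x, by rw [intValuation_apply, hx]; simp⟩

theorem isUnit_integer_iff {x : (valuation K).integer} :
    IsUnit x ↔ intValuation K (x : K) = 1 := by
  constructor
  · rintro ⟨u, rfl⟩
    have h1 := mem_integer_iff.1 (u : (valuation K).integer).2
    have h2 := mem_integer_iff.1 ((u⁻¹ : (valuation K).integerˣ) : (valuation K).integer).2
    have h3 : ((u : (valuation K).integer) : K) * ((u⁻¹ : (valuation K).integerˣ) :
        (valuation K).integer) = 1 := by
      rw [← Subring.coe_mul, Units.mul_inv]; rfl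
    have h4 := congrArg (intValuation K) h3
    rw [map_mul, map_one] at h4
    refine le_antisymm h1 ?_
    rw [← h4]
    exact mul_le_of_le_one_right' h2
  · intro h
    have h0 : (x : K) ≠ 0 := fun h0 => by simp [h0] at h
    refine IsUnit.of_mul_eq_one ⟨(x : K)⁻¹, mem_integer_iff.2 (by rw [map_inv₀, h, inv_one])⟩ ?_
    exact Subtype.ext (mul_inv_cancel₀ h0)

theorem residue_eq_zero_iff {x : (valuation K).integer} :
    IsLocalRing.residue (valuation K).integer x = 0 ↔ intValuation K (x : K) < 1 := by
  rw [IsLocalRing.residue_eq_zero_iff, IsLocalRing.mem_maximalIdeal, mem_nonunits_iff,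
    isUnit_integer_iff]
  exact ⟨fun h => lt_of_le_of_ne (mem_integer_iff.1 x.2) h, fun h => h.ne⟩

theorem intValuation_two
    (hodd : ringChar (IsLocalRing.ResidueField (valuation K).integer) ≠ 2) :
    intValuation K 2 = 1 := by
  have h2 : intValuation K 2 ≤ 1 := mem_integer_iff.1 (by
    rw [← one_add_one_eq_two]; exact add_mem (one_mem _) (one_mem _))
  by_contra h
  have h3 : IsLocalRing.residue (valuation K).integer 2 = 0 :=
    residue_eq_zero_iff.2 (lt_of_le_of_ne h2 h)
  have h4 : ((2 : ℕ) : IsLocalRing.ResidueField (valuation K).integer) = 0 := by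
    rw [← h3, ← map_natCast (IsLocalRing.residue _)]; rfl
  rcases (Nat.dvd_prime Nat.prime_two).1 (ringChar.dvd h4) with h5 | h5
  · exact CharP.ringChar_ne_one h5
  · exact hodd h5

open Polynomial in
/-- Hensel's lemma for squares. -/
theorem exists_sq_of_near_one (h2 : intValuation K 2 = 1) {a : K}
    (ha : intValuation K (a - 1) < 1) : ∃ b : K, b ^ 2 = a := by
  let := IsTopologicalAddGroup.rightUniformSpace K
  have := isUniformAddGroup_of_addCommGroup (G := K)
  have hH : HenselianRing (valuation K).integer
    (IsLocalRing.maximalIdeal (valuation K).integer) := inferInstance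
  have hai : a ∈ (valuation K).integer := by
    rw [mem_integer_iff, ← sub_add_cancel a 1]
    exact Valuation.map_add_le _ ha.le (by simp)
  have h2u : IsUnit (2 : (valuation K).integer) := isUnit_integer_iff.2 h2
  obtain ⟨b, hb, -⟩ := hH.is_henselian (X ^ 2 - C (⟨a, hai⟩ : (valuation K).integer))
    (monic_X_pow_sub_C _ (by norm_num)) 1 (by
      rw [← IsLocalRing.residue_eq_zero_iff, residue_eq_zero_iff]
      simp only [eval_sub, eval_pow, eval_X, eval_C, one_pow]
      rw [Valuation.map_sub_swap] at ha
      exact ha) (by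
      have : (derivative (X ^ 2 - C (⟨a, hai⟩ : (valuation K).integer))).eval 1 = 2 := by
        simp [one_add_one_eq_two]
      rw [this]
      exact h2u.map _)
  refine ⟨b, ?_⟩
  have : (b ^ 2 - ⟨a, hai⟩ : (valuation K).integer) = 0 := by simpa [IsRoot] using hb
  have := congrArg Subtype.val (sub_eq_zero.1 this)
  simpa using this

theorem odd_card_residueField
    (hodd : ringChar (IsLocalRing.ResidueField (valuation K).integer) ≠ 2) :
    Nat.card (IsLocalRing.ResidueField (valuation K).integer) % 2 = 1 := by
  have := Fintype.ofFinite (IsLocalRing.ResidueField (valuation K).integer)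
  rw [Nat.card_eq_fintype_card]
  exact FiniteField.odd_card_of_char_ne_two hodd

open Polynomial in
/-- A binary quadratic form with unit coefficients represents every unit modulo the maximal
ideal. -/
theorem exists_sub_mul_sq_near
    (hodd : ringChar (IsLocalRing.ResidueField (valuation K).integer) ≠ 2) {a d : K}
    (ha : intValuation K a ≤ 1) (hd : intValuation K d = 1) :
    ∃ x y : K, intValuation K x ≤ 1 ∧ intValuation K y ≤ 1 ∧
      intValuation K (x ^ 2 - d * y ^ 2 - a) < 1 := by
  set k := IsLocalRing.ResidueField (valuation K).integer
  have := Fintype.ofFinite k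
  let a' : (valuation K).integer := ⟨a, mem_integer_iff.2 ha⟩
  let d' : (valuation K).integer := ⟨d, mem_integer_iff.2 hd.le⟩
  have hd' : IsLocalRing.residue _ d' ≠ 0 := fun h => (residue_eq_zero_iff.1 h).ne hd
  obtain ⟨x, y, hxy⟩ := FiniteField.exists_root_sum_quadratic (R := k)
    (f := X ^ 2 - C (IsLocalRing.residue _ a')) (g := C (-IsLocalRing.residue _ d') * X ^ 2)
    (degree_X_pow_sub_C (by norm_num) _) (degree_C_mul_X_pow 2 (neg_ne_zero.2 hd'))
    (by rw [← Nat.card_eq_fintype_card]; exact odd_card_residueField hodd)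
  obtain ⟨x', rfl⟩ := IsLocalRing.residue_surjective x
  obtain ⟨y', rfl⟩ := IsLocalRing.residue_surjective y
  refine ⟨x', y', mem_integer_iff.1 x'.2, mem_integer_iff.1 y'.2, ?_⟩
  have : IsLocalRing.residue _ (x' ^ 2 - d' * y' ^ 2 - a') = 0 := by
    simp only [eval_sub, eval_pow, eval_X, eval_C, eval_mul] at hxy
    rw [map_sub, map_sub, map_mul, map_pow, map_pow, ← hxy]
    ring
  exact residue_eq_zero_iff.1 this

/-- Multiplication by an element `t` of valuation `-n` identifies the `n`-th ball with the integers;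
the next ball is the kernel of reduction to the residue field. -/
theorem relIndex_ball (n : ℕ) (B : ℕ → AddSubgroup K)
    (hB : ∀ m x, x ∈ B m ↔ intValuation K x ≤ exp (-(m : ℤ))) :
    (B (n + 1)).relIndex (B n) =
      Nat.card (IsLocalRing.ResidueField (valuation K).integer) := by
  obtain ⟨t, ht⟩ := exists_intValuation_eq_exp (K := K) n
  obtain ⟨t', ht'⟩ := exists_intValuation_eq_exp (K := K) (-n)
  have htt : t ≠ 0 := fun h => by rw [h, map_zero] at ht; exact exp_ne_zero ht.symm
  have hmem : ∀ x : B n, t * (x : K) ∈ (valuation K).integer := by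
    intro x
    rw [mem_integer_iff, map_mul, ht]
    calc exp (n : ℤ) * intValuation K x ≤ exp (n : ℤ) * exp (-n : ℤ) := by
          gcongr; exact (hB _ _).1 x.2
      _ = 1 := by rw [← exp_add]; simp
  let f : B n →+ IsLocalRing.ResidueField (valuation K).integer :=
    { toFun := fun x => IsLocalRing.residue _ ⟨t * x, hmem x⟩
      map_zero' := by
        rw [residue_eq_zero_iff]; simp
      map_add' := by
        intro x y
        rw [← map_add]
        congr 1
        exact Subtype.ext (mul_add _ _ _) }
  have hker : f.ker = (B (n + 1)).addSubgroupOf (B n) := by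
    ext x
    rw [AddMonoidHom.mem_ker, AddSubgroup.mem_addSubgroupOf, hB]
    change IsLocalRing.residue _ _ = 0 ↔ _
    rw [residue_eq_zero_iff]
    change intValuation K (t * x) < 1 ↔ _
    rw [map_mul, ht]
    by_cases hx : intValuation K (x : K) = 0
    · simp [hx]
    · rw [← exp_log hx, ← exp_add, ← exp_zero, exp_lt_exp, exp_le_exp]
      push_cast
      constructor <;> intro h <;> omega
  have hsurj : Function.Surjective f := by
    intro y
    obtain ⟨y', rfl⟩ := IsLocalRing.residue_surjective y
    refine ⟨⟨t⁻¹ * y', (hB _ _).2 ?_⟩, ?_⟩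
    · rw [map_mul, map_inv₀, ht, ← exp_neg]
      exact mul_le_of_le_one_right' (mem_integer_iff.1 y'.2)
    · change IsLocalRing.residue _ _ = _
      congr 1
      exact Subtype.ext (mul_inv_cancel_left₀ htt _)
  rw [AddSubgroup.relIndex, ← hker, AddSubgroup.index_ker, AddMonoidHom.range_eq_top.2 hsurj]
  simp

theorem absF_eq {a : K} {n : ℤ} (h : intValuation K a = exp (-n)) :
    absF K a = (Nat.card (IsLocalRing.ResidueField (valuation K).integer) : ℝ) ^ (-n) := by
  rw [absF, ← intValuation_apply, h, WithZeroMulInt.toNNReal_neg_apply _ exp_ne_zero]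
  push_cast
  rfl

end OneField

variable {F E : Type*} [Field F] [ValuativeRel F] [TopologicalSpace F]
  [IsNonarchimedeanLocalField F]
  [Field E] [ValuativeRel E] [TopologicalSpace E] [IsNonarchimedeanLocalField E]
  [Algebra F E] [ValuativeExtension F E] {σ : E ≃ₐ[F] E}

theorem intValuation_algebraMap_le_iff {a b : F} :
    intValuation E (algebraMap F E a) ≤ intValuation E (algebraMap F E b) ↔
      intValuation F a ≤ intValuation F b := by
  rw [intValuation_le_iff, intValuation_le_iff, ← Valuation.Compatible.vle_iff_le,
    ← Valuation.Compatible.vle_iff_le]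
  exact ValuativeExtension.vle_iff_vle a b

theorem intValuation_algebraMap_eq_iff {a b : F} :
    intValuation E (algebraMap F E a) = intValuation E (algebraMap F E b) ↔
      intValuation F a = intValuation F b := by
  simp only [le_antisymm_iff, intValuation_algebraMap_le_iff]

/-- Restriction to `F` multiplies the exponents by some `e`. Being unramified makes the exponent
`-1` a value on `F`, so `e` divides one; it is positive because the extension preserves the order.
-/
theorem intValuation_algebraMap (hunram : IsUnramifiedExt F E) (a : F) :
    intValuation E (algebraMap F E a) = intValuation F a := by
  obtain ⟨p, hp⟩ := exists_intValuation_eq_exp (K := F) (-1)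
  have hzpow : ∀ n : ℤ, intValuation F (p ^ n) = exp (-n) := fun n => by
    rw [map_zpow₀, hp, ← exp_zsmul]; simp
  have hp0 : p ≠ 0 := fun h => by rw [h, map_zero] at hp; exact exp_ne_zero hp.symm
  obtain ⟨x, hx⟩ := exists_intValuation_eq_exp (K := E) (-1)
  obtain ⟨y, hy⟩ := hunram x
  have hy' : intValuation E (algebraMap F E y) = exp (-1) := by
    rw [← hx, intValuation_apply, hy, intValuation_apply]
  have hEp0 : intValuation E (algebraMap F E p) ≠ 0 := by simpa using hp0
  obtain ⟨e, he⟩ : ∃ e : ℤ, intValuation E (algebraMap F E p) = exp (-e) :=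
    ⟨-log (intValuation E (algebraMap F E p)), by rw [neg_neg, exp_log hEp0]⟩
  have key : ∀ b : F, b ≠ 0 → ∃ n : ℤ, intValuation F b = exp (-n) ∧
      intValuation E (algebraMap F E b) = exp (-(n * e)) := by
    intro b hb
    have hb0 : intValuation F b ≠ 0 := by simpa using hb
    refine ⟨-log (intValuation F b), by rw [neg_neg, exp_log hb0], ?_⟩
    have : intValuation F b = intValuation F (p ^ (-log (intValuation F b))) := by
      rw [hzpow, neg_neg, exp_log hb0]
    rw [intValuation_algebraMap_eq_iff.2 this, map_zpow₀, map_zpow₀, he, ← exp_zsmul]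
    congr 1
    simp
  have hy0 : y ≠ 0 := fun h => by rw [h, map_zero, map_zero] at hy'; exact exp_ne_zero hy'.symm
  obtain ⟨n, -, hn⟩ := key y hy0
  rw [hy', exp_inj] at hn
  have he1 : e = 1 := by
    have hlt : intValuation E (algebraMap F E p) < 1 := by
      rw [← map_one (intValuation E), ← map_one (algebraMap F E), ← not_le,
        intValuation_algebraMap_le_iff, not_le, hp, map_one, ← exp_zero, exp_lt_exp]
      omega
    rw [he, ← exp_zero, exp_lt_exp] at hlt
    exact Int.eq_one_of_dvd_one (by omega) ⟨n, by linarith [mul_comm n e]⟩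
  by_cases ha : a = 0
  · simp [ha]
  · obtain ⟨n, h1, h2⟩ := key a ha
    rw [h1, h2, he1, mul_one]

omit [ValuativeRel F] [TopologicalSpace F] [IsNonarchimedeanLocalField F] [ValuativeRel E]
  [TopologicalSpace E] [IsNonarchimedeanLocalField E] [ValuativeExtension F E] in
theorem card_aut_eq_two (hquad : Module.finrank F E = 2) (hσ : σ ≠ 1) :
    Nat.card (E ≃ₐ[F] E) = 2 := by
  have : FiniteDimensional F E := Module.finite_of_finrank_pos (by omega)
  have h1 : Nat.card (E ≃ₐ[F] E) ≤ 2 := by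
    rw [← hquad, Nat.card_eq_fintype_card]; exact AlgEquiv.card_le
  have h2 : 1 < Nat.card (E ≃ₐ[F] E) := by
    rw [Finite.one_lt_card_iff_nontrivial]
    exact ⟨σ, 1, hσ⟩
  omega

omit [ValuativeRel F] [TopologicalSpace F] [IsNonarchimedeanLocalField F] [ValuativeRel E]
  [TopologicalSpace E] [IsNonarchimedeanLocalField E] [ValuativeExtension F E] in
theorem aut_eq_one_or_eq (hquad : Module.finrank F E = 2) (hσ : σ ≠ 1) (f : E ≃ₐ[F] E) :
    f = 1 ∨ f = σ := by
  have h := card_aut_eq_two hquad hσ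
  have : Finite (E ≃ₐ[F] E) := Nat.finite_of_card_ne_zero (by omega)
  have := Fintype.ofFinite (E ≃ₐ[F] E)
  classical
  have h2 : ({1, σ} : Finset (E ≃ₐ[F] E)) = Finset.univ := by
    apply Finset.eq_univ_of_card
    rw [Finset.card_pair hσ.symm, ← Nat.card_eq_fintype_card, h]
  have := h2.symm ▸ Finset.mem_univ f
  simpa using this

omit [ValuativeRel F] [TopologicalSpace F] [IsNonarchimedeanLocalField F] [ValuativeRel E]
  [TopologicalSpace E] [IsNonarchimedeanLocalField E] [ValuativeExtension F E] in
theorem isGalois_of_quadratic (hquad : Module.finrank F E = 2) (hσ : σ ≠ 1) : IsGalois F E := by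
  have : FiniteDimensional F E := Module.finite_of_finrank_pos (by omega)
  exact IsGalois.of_card_aut_eq_finrank F E (by rw [card_aut_eq_two hquad hσ, hquad])

omit [ValuativeRel F] [TopologicalSpace F] [IsNonarchimedeanLocalField F] [ValuativeRel E]
  [TopologicalSpace E] [IsNonarchimedeanLocalField E] [ValuativeExtension F E] in
theorem exists_of_conj_eq (hquad : Module.finrank F E = 2) (hσ : σ ≠ 1) {z : E} (hz : σ z = z) :
    ∃ a : F, algebraMap F E a = z := by
  have : FiniteDimensional F E := Module.finite_of_finrank_pos (by omega)
  have := isGalois_of_quadratic hquad hσ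
  refine (IntermediateField.mem_bot).1 ((IsGalois.mem_bot_iff_fixed z).2 fun f => ?_)
  rcases aut_eq_one_or_eq hquad hσ f with rfl | rfl
  · rfl
  · exact hz

omit [ValuativeRel F] [TopologicalSpace F] [IsNonarchimedeanLocalField F] [ValuativeRel E]
  [TopologicalSpace E] [IsNonarchimedeanLocalField E] [ValuativeExtension F E] in
theorem algebraMap_norm_quadratic (hquad : Module.finrank F E = 2) (hσ : σ ≠ 1) (z : E) :
    algebraMap F E (Algebra.norm F z) = z * σ z := by
  have : FiniteDimensional F E := Module.finite_of_finrank_pos (by omega)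
  have := isGalois_of_quadratic hquad hσ
  classical
  rw [Algebra.norm_eq_prod_automorphisms]
  have h2 : (Finset.univ : Finset (E ≃ₐ[F] E)) = {1, σ} := by
    symm
    ext f
    simpa using aut_eq_one_or_eq hquad hσ f
  rw [h2, Finset.prod_pair hσ.symm]
  rfl

omit [ValuativeRel F] [TopologicalSpace F] [IsNonarchimedeanLocalField F] [ValuativeRel E]
  [TopologicalSpace E] [IsNonarchimedeanLocalField E] [ValuativeExtension F E] in
theorem conj_conj_of_quadratic (hquad : Module.finrank F E = 2) (hσ : σ ≠ 1) (z : E) :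
    σ (σ z) = z := by
  rcases aut_eq_one_or_eq hquad hσ (σ * σ) with h | h
  · exact DFunLike.congr_fun h z
  · exact absurd (mul_eq_left.1 h) hσ

/-- A unit `θ` with `σ θ = -θ` generates the extension, and it stays outside the residue field of
`F`, since otherwise Hensel's lemma would make `θ ^ 2` a square in `F`. The remaining properties
follow from the coordinates `a + b θ`. -/
theorem exists_unramifiedQuadratic
    (hodd : ringChar (IsLocalRing.ResidueField (valuation F).integer) ≠ 2)
    (hquad : Module.finrank F E = 2) (hunram : IsUnramifiedExt F E) (hσ : σ ≠ 1) :
    Nonempty (UnramifiedQuadratic σ (intValuation E)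
      (Nat.card (IsLocalRing.ResidueField (valuation F).integer))) := by
  have hv := intValuation_algebraMap (F := F) (E := E) hunram
  have hσσ := conj_conj_of_quadratic hquad hσ
  have h2F := intValuation_two hodd
  have h2 : intValuation E 2 = 1 := by rw [← map_ofNat (algebraMap F E) 2, hv, h2F]
  have h2E : (2 : E) ≠ 0 := fun h => by simp [h] at h2
  obtain ⟨p, hp⟩ := exists_intValuation_eq_exp (K := F) (-1)
  -- Any `z - σ z ≠ 0` is anti-invariant; as `E/F` is unramified it can be divided by an element of
  -- `F` of the same valuation.
  obtain ⟨θ, hθσ, hθv⟩ : ∃ θ : E, σ θ = -θ ∧ intValuation E θ = 1 := by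
    obtain ⟨z, hz⟩ : ∃ z, σ z ≠ z := by
      by_contra! h
      exact hσ (AlgEquiv.ext h)
    obtain ⟨y, hy⟩ := hunram (z - σ z)
    have hy' : intValuation E (algebraMap F E y) = intValuation E (z - σ z) := by
      rw [intValuation_apply, hy, intValuation_apply]
    have hne : z - σ z ≠ 0 := sub_ne_zero.2 hz.symm
    refine ⟨(z - σ z) / algebraMap F E y, ?_, ?_⟩
    · rw [map_div₀, map_sub, hσσ, AlgEquiv.commutes]; ring
    · rw [map_div₀, hy', div_self]
      simpa using hne
  have hθ0 : θ ≠ 0 := fun h => by simp [h] at hθv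
  obtain ⟨d, hd⟩ := exists_of_conj_eq hquad hσ (z := θ ^ 2) (by rw [map_pow, hθσ]; ring)
  have hdv : intValuation F d = 1 := by rw [← hv, hd, map_pow, hθv, one_pow]
  have hnotF : ∀ b : F, algebraMap F E b ≠ θ := by
    intro b hb
    have : σ θ = θ := by rw [← hb, AlgEquiv.commutes]
    rw [hθσ] at this
    have : 2 * θ = 0 := by linear_combination -this
    exact (mul_ne_zero h2E hθ0) this
  -- If `e + θ` were not a unit, `d / e ^ 2` would be congruent to one, hence a square, and `θ`
  -- would lie in `F`.
  have hunit : ∀ e : F, intValuation F e ≤ 1 →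
      intValuation E (algebraMap F E e + θ) = 1 := by
    intro e he
    have hle : intValuation E (algebraMap F E e + θ) ≤ 1 :=
      Valuation.map_add_le _ (by rwa [hv]) hθv.le
    by_contra hne
    have hlt := lt_of_le_of_ne hle hne
    have he1 : intValuation F e = 1 := by
      rw [← hv, show algebraMap F E e = (algebraMap F E e + θ) - θ by ring,
        Valuation.map_sub_eq_of_lt_right _ (by rwa [hθv]), hθv]
    have he0 : e ≠ 0 := fun h => by simp [h] at he1
    have h3 : intValuation F (d / e ^ 2 - 1) < 1 := by
      have : algebraMap F E (d / e ^ 2 - 1) =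
          -((algebraMap F E e + θ) * (algebraMap F E e - θ)) / algebraMap F E e ^ 2 := by
        have : algebraMap F E e ≠ 0 := by simpa using he0
        rw [map_sub, map_div₀, hd, map_pow, map_one]
        field_simp
        ring
      rw [← hv, this, map_div₀, map_pow, hv e, he1, one_pow, div_one, Valuation.map_neg, map_mul]
      exact mul_lt_one_of_lt_of_le hlt (Valuation.map_sub_le _ (by rwa [hv]) hθv.le)
    obtain ⟨b, hb⟩ := exists_sq_of_near_one h2F h3
    have h4 : θ ^ 2 = (algebraMap F E (b * e)) ^ 2 := by
      rw [← map_pow, mul_pow, hb, ← hd, div_mul_cancel₀ _ (pow_ne_zero 2 he0)]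
    rcases sq_eq_sq_iff_eq_or_eq_neg.1 h4 with h5 | h5
    · exact hnotF _ h5.symm
    · exact hnotF (-(b * e)) (by rw [map_neg, h5])
  have hmax : ∀ a b : F, intValuation E (algebraMap F E a + algebraMap F E b * θ) =
      max (intValuation E (algebraMap F E a)) (intValuation E (algebraMap F E b)) := by
    intro a b
    by_cases hb : b = 0
    · simp [hb]
    have hb' : algebraMap F E b ≠ 0 := by simpa using hb
    have hbv : intValuation F b ≠ 0 := by simpa using hb
    rcases le_or_gt (intValuation F a) (intValuation F b) with h | h
    · rw [hv, hv, max_eq_right h]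
      have : algebraMap F E a + algebraMap F E b * θ =
          algebraMap F E b * (algebraMap F E (a / b) + θ) := by
        rw [map_div₀]; field_simp
      rw [this, map_mul, hunit, mul_one, hv]
      rw [map_div₀]
      exact div_le_one_of_le₀ h zero_le
    · rw [Valuation.map_add_eq_of_lt_left, max_eq_left]
      · rw [hv, hv]; exact h.le
      · rwa [map_mul, hθv, mul_one, hv, hv]
  have hdecomp : ∀ z : E, ∃ a b : F, z = algebraMap F E a + algebraMap F E b * θ := by
    intro z
    obtain ⟨a, ha⟩ := exists_of_conj_eq hquad hσ (z := (z + σ z) / 2) (by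
      rw [map_div₀, map_add, hσσ, map_ofNat, add_comm])
    obtain ⟨b, hb⟩ := exists_of_conj_eq hquad hσ (z := (z - σ z) / (2 * θ)) (by
      rw [map_div₀, map_sub, hσσ, map_mul, map_ofNat, hθσ]
      field_simp
      ring)
    refine ⟨a, b, ?_⟩
    rw [ha, hb]
    field_simp
    ring
  refine ⟨{
    θ := θ
    ϖ := p
    conj_conj := hσσ
    exists_of_fixed := fun z hz => exists_of_conj_eq hquad hσ hz
    v_conj := ?_
    conj_θ := hθσ
    v_θ := hθv
    v_two := h2
    v_ϖ := by rw [hv, hp]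
    v_add_mul := hmax
    exists_norm := ?_
    one_lt_q := Finite.one_lt_card
    relIndex_succ := ?_ }⟩
  · intro z
    obtain ⟨a, b, rfl⟩ := hdecomp z
    have : σ (algebraMap F E a + algebraMap F E b * θ) =
        algebraMap F E a + algebraMap F E (-b) * θ := by
      rw [map_add, map_mul, AlgEquiv.commutes, AlgEquiv.commutes, hθσ, map_neg]; ring
    rw [this, hmax, hmax, map_neg, Valuation.map_neg]
  · intro a ha
    rw [hv] at ha
    have ha0 : a ≠ 0 := fun h => by simp [h] at ha
    -- The norm form `x ^ 2 - d y ^ 2` represents `a` modulo the maximal ideal; the remaining factor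
    -- is congruent to one, hence the square of some `f`, and `f ^ 2` is the norm of `f`.
    obtain ⟨x, y, -, -, hxy⟩ := exists_sub_mul_sq_near hodd ha.le hdv
    have hNv : intValuation F (x ^ 2 - d * y ^ 2) = 1 := by
      rw [show x ^ 2 - d * y ^ 2 = (x ^ 2 - d * y ^ 2 - a) + a by ring,
        Valuation.map_add_eq_of_lt_right _ (by rwa [ha]), ha]
    have hN0 : x ^ 2 - d * y ^ 2 ≠ 0 := fun h => by simp [h] at hNv
    obtain ⟨f, hf⟩ := exists_sq_of_near_one h2F (a := a / (x ^ 2 - d * y ^ 2)) (by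
      have : a / (x ^ 2 - d * y ^ 2) - 1 = -(x ^ 2 - d * y ^ 2 - a) / (x ^ 2 - d * y ^ 2) := by
        field_simp
        ring
      rw [this, map_div₀, hNv, div_one, Valuation.map_neg]
      exact hxy)
    refine ⟨algebraMap F E f * (algebraMap F E x + algebraMap F E y * θ), ?_⟩
    have h5 : algebraMap F E a = algebraMap F E f ^ 2 *
        (algebraMap F E x ^ 2 - θ ^ 2 * algebraMap F E y ^ 2) := by
      rw [← hd, ← map_pow, ← map_pow, ← map_pow, ← map_mul, ← map_sub, ← map_mul, hf,
        div_mul_cancel₀ _ hN0]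
    rw [h5, map_mul, map_add, map_mul, AlgEquiv.commutes, AlgEquiv.commutes, AlgEquiv.commutes,
      hθσ]
    ring
  · intro n
    have := relIndex_ball (K := F) n (fun m => baseBall F (intValuation E) m) (fun m x => by
      rw [mem_baseBall, hv])
    exact_mod_cast this

end LocalFields
end

/-! ### Orthogonal eigenframes and the character `κ`. -/

noncomputable section
section Frames

open WithZero

variable {F E : Type*} [Field F] [Field E] [Algebra F E] {σ : E ≃ₐ[F] E}
variable {m n : Type*} [Fintype m] [DecidableEq m] [Fintype n] [DecidableEq n]

theorem HermSpace.conjT_gram (V : HermSpace σ n) : conjT σ V.gram = V.gram := V.isHerm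

theorem HermSpace.adj_eq (V₁ : HermSpace σ m) (V₂ : HermSpace σ n) (X : Matrix m n E) :
    HermSpace.adj V₁ V₂ X = V₂.gram⁻¹ * conjT σ X * V₁.gram := rfl

theorem HermSpace.adj_mul (V₁ : HermSpace σ n) (V₂ : HermSpace σ n) (V₃ : HermSpace σ n)
    (X Y : Matrix n n E) :
    HermSpace.adj V₁ V₃ (X * Y) = HermSpace.adj V₂ V₃ Y * HermSpace.adj V₁ V₂ X := by
  simp only [HermSpace.adj_eq, conjT_mul]
  simp only [Matrix.mul_assoc, Matrix.mul_nonsing_inv_cancel_left _ _ V₂.nondeg]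

theorem HermSpace.mem_U_iff {V : HermSpace σ n} {g : GL n E} :
    g ∈ V.U ↔ conjT σ (g : Matrix n n E) * V.gram * (g : Matrix n n E) = V.gram := Iff.rfl

theorem HermSpace.adj_coe_U {V : HermSpace σ n} (g : V.U) :
    HermSpace.adj V V ((g : GL n E) : Matrix n n E) = (((g : GL n E)⁻¹ : GL n E) : Matrix n n E) := by
  have h := HermSpace.mem_U_iff.1 g.2
  have h2 : ((g : GL n E) : Matrix n n E) * (((g : GL n E)⁻¹ : GL n E) : Matrix n n E) = 1 := by
    rw [← Units.val_mul, mul_inv_cancel, Units.val_one]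
  rw [HermSpace.adj_eq]
  calc V.gram⁻¹ * conjT σ ((g : GL n E) : Matrix n n E) * V.gram
      = V.gram⁻¹ * (conjT σ ((g : GL n E) : Matrix n n E) * V.gram * ((g : GL n E) : Matrix n n E)) *
        (((g : GL n E)⁻¹ : GL n E) : Matrix n n E) := by
        simp only [Matrix.mul_assoc]; rw [h2, Matrix.mul_one]
    _ = _ := by rw [h, Matrix.nonsing_inv_mul _ V.nondeg, Matrix.one_mul]

theorem HermSpace.mem_U_of_adj_mul {V : HermSpace σ n} {g : GL n E}
    (h : HermSpace.adj V V (g : Matrix n n E) * (g : Matrix n n E) = 1) : g ∈ V.U := by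
  rw [HermSpace.mem_U_iff]
  have h2 : V.gram * (HermSpace.adj V V (g : Matrix n n E) * (g : Matrix n n E)) = V.gram := by
    rw [h, Matrix.mul_one]
  rwa [HermSpace.adj_eq, Matrix.mul_assoc V.gram⁻¹, Matrix.mul_assoc V.gram⁻¹,
    Matrix.mul_nonsing_inv_cancel_left _ _ V.nondeg] at h2

theorem HermSpace.det_adj (V : HermSpace σ n) (X : Matrix n n E) :
    (HermSpace.adj V V X).det = σ X.det := by
  rw [HermSpace.adj_eq, Matrix.det_mul, Matrix.det_mul, det_conjT, mul_comm, ← mul_assoc,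
    ← Matrix.det_mul, Matrix.mul_nonsing_inv _ V.nondeg, Matrix.det_one, one_mul]

/-- The contraction is self-adjoint. -/
theorem conjT_contraction_mul (hσ : ∀ z, σ (σ z) = z) (V₁ : HermSpace σ m) (V₂ : HermSpace σ n)
    (X : Matrix m n E) :
    conjT σ (contraction V₁ V₂ X) * V₁.gram = V₁.gram * contraction V₁ V₂ X := by
  have hcc : ∀ Y : Matrix m n E, conjT σ (conjT σ Y) = Y := fun Y => by ext; simp [conjT, hσ]
  have hneg : ∀ Y : Matrix m m E, conjT σ (-Y) = -conjT σ Y := fun Y => by ext; simp [conjT]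
  have hinv : conjT σ V₂.gram⁻¹ = V₂.gram⁻¹ := by
    have : conjT σ V₂.gram⁻¹ * V₂.gram = 1 := by
      conv_lhs => rw [← V₂.conjT_gram, ← conjT_mul, V₂.conjT_gram,
        Matrix.mul_nonsing_inv _ V₂.nondeg, conjT_one]
    exact (Matrix.inv_eq_left_inv this).symm
  rw [contraction, hneg, HermSpace.adj_eq, conjT_mul, conjT_mul, conjT_mul, hcc, hinv,
    V₁.conjT_gram]
  simp only [Matrix.mul_neg, Matrix.neg_mul, Matrix.mul_assoc]

namespace UnramifiedQuadratic

variable {v : Valuation E ℤᵐ⁰} {q : ℕ} (D : UnramifiedQuadratic σ v q)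

-- Fixed units are norms, and an even power of `ϖ` is the norm of its square root.
include D in
theorem exists_norm_of_even {a : E} (ha : σ a = a) {k : ℤ} (h : v a = exp (-(2 * k))) :
    ∃ z, z * σ z = a := by
  have hϖ := D.ϖE_ne_zero
  obtain ⟨z, hz, -⟩ := D.exists_norm_unit (a := D.ϖE ^ (-(2 * k)) * a)
    (by rw [map_mul, map_zpow₀, D.conj_ϖE, ha]) (by
      rw [map_mul, D.v_ϖE_zpow, h, ← exp_add, ← exp_zero]; congr 1; ring)
  refine ⟨D.ϖE ^ k * z, ?_⟩
  rw [map_mul, map_zpow₀, D.conj_ϖE, mul_mul_mul_comm, hz, ← mul_assoc, ← zpow_add₀ hϖ,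
    ← zpow_add₀ hϖ, show k + k + -(2 * k) = 0 by ring, zpow_zero, one_mul]

omit [Field F] [Algebra F E] in
theorem _root_.Valuation.exists_eq_exp_neg (v : Valuation E ℤᵐ⁰) {z : E} (hz : z ≠ 0) :
    ∃ k : ℤ, v z = exp (-k) :=
  ⟨-log (v z), by rw [neg_neg, exp_log ((v.ne_zero_iff).2 hz)]⟩

include D in
theorem exists_v_norm {z : E} (hz : z ≠ 0) : ∃ k : ℤ, v (z * σ z) = exp (-(2 * k)) := by
  obtain ⟨k, hk⟩ := v.exists_eq_exp_neg hz
  exact ⟨k, by rw [map_mul, D.v_conj, hk, ← exp_add]; congr 1; ring⟩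

/-- An orthogonal eigenbasis of `δ` whose vectors have norm `ϖ ^ ε`. -/
structure IsFrame (V : HermSpace σ n) (δ : Matrix n n E) (ca cb : F) (ε : ℤ)
    (P : Matrix n (Fin 2) E) (P' : Matrix (Fin 2) n E) : Prop where
  inv_mul : P' * P = 1
  mul_inv : P * P' = 1
  gram_eq : conjT σ P * V.gram * P = D.ϖE ^ ε • 1
  eig : δ * P = P * Matrix.diagonal ![algebraMap F E ca, algebraMap F E cb]

variable {D} {ca cb : F}

theorem IsFrame.conj_eq {V : HermSpace σ n} {δ : Matrix n n E} {ε : ℤ}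
    {P : Matrix n (Fin 2) E} {P' : Matrix (Fin 2) n E} (h : D.IsFrame V δ ca cb ε P P') :
    δ = P * Matrix.diagonal ![algebraMap F E ca, algebraMap F E cb] * P' := by
  rw [← h.eig, Matrix.mul_assoc, h.mul_inv, Matrix.mul_one]

theorem conjT_diagonal (a b : E) :
    conjT σ (Matrix.diagonal ![a, b]) = Matrix.diagonal ![σ a, σ b] := by
  ext i j
  fin_cases i <;> fin_cases j <;> simp [conjT]

theorem diagonal_mul_diagonal_two (a b c d : E) :
    Matrix.diagonal ![a, b] * Matrix.diagonal ![c, d] = Matrix.diagonal ![a * c, b * d] := by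
  rw [Matrix.diagonal_mul_diagonal]
  congr 1
  ext i
  fin_cases i <;> rfl

theorem diagonal_two_eq_one : Matrix.diagonal ![(1 : E), 1] = 1 := by
  rw [← Matrix.diagonal_one]
  congr 1
  ext i
  fin_cases i <;> rfl

/-- An orthogonal eigenbasis can be rescaled to a frame. -/
theorem exists_frame_of_diagonal {V : HermSpace σ n} {δ : Matrix n n E} {R : Matrix n (Fin 2) E}
    {R' : Matrix (Fin 2) n E} (h1 : R' * R = 1) (h2 : R * R' = 1) {ga gb : E} {a b ε : ℤ}
    (hG : conjT σ R * V.gram * R = Matrix.diagonal ![ga, gb]) (hga : σ ga = ga) (hgb : σ gb = gb)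
    (ha : v ga = exp (-a)) (hb : v gb = exp (-b)) (hae : Even (ε - a)) (hbe : Even (ε - b))
    (hδ : δ * R = R * Matrix.diagonal ![algebraMap F E ca, algebraMap F E cb]) :
    ∃ P P', D.IsFrame V δ ca cb ε P P' := by
  have hϖ := D.ϖE_ne_zero
  -- A vector of norm `g` can be rescaled to norm `ϖ ^ ε` because the quotient has even valuation.
  have key : ∀ (g : E) (c : ℤ), σ g = g → v g = exp (-c) → Even (ε - c) →
      ∃ x : E, x ≠ 0 ∧ x * σ x * g = D.ϖE ^ ε := by
    rintro g c hg hc ⟨k, hk⟩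
    have hg0 : g ≠ 0 := fun h => by rw [h, map_zero] at hc; exact exp_ne_zero hc.symm
    obtain ⟨x, hx⟩ := D.exists_norm_of_even (a := D.ϖE ^ ε / g) (k := k)
      (by rw [map_div₀, map_zpow₀, D.conj_ϖE, hg]) (by
        rw [map_div₀, D.v_ϖE_zpow, hc, ← exp_sub]; congr 1; omega)
    have hx2 : x * σ x * g = D.ϖE ^ ε := by rw [hx, div_mul_cancel₀ _ hg0]
    refine ⟨x, fun h => ?_, hx2⟩
    rw [h, zero_mul, zero_mul] at hx2
    exact zpow_ne_zero _ hϖ hx2.symm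
  obtain ⟨x, hx0, hx⟩ := key ga a hga ha hae
  obtain ⟨y, hy0, hy⟩ := key gb b hgb hb hbe
  have hd : Matrix.diagonal ![x, y] * Matrix.diagonal ![x⁻¹, y⁻¹] = 1 := by
    rw [diagonal_mul_diagonal_two, mul_inv_cancel₀ hx0, mul_inv_cancel₀ hy0, diagonal_two_eq_one]
  refine ⟨R * Matrix.diagonal ![x, y], Matrix.diagonal ![x⁻¹, y⁻¹] * R', ?_, ?_, ?_, ?_⟩
  · rw [Matrix.mul_assoc, ← Matrix.mul_assoc R', h1, Matrix.one_mul]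
    exact mul_eq_one_comm.1 hd
  · rw [Matrix.mul_assoc, ← Matrix.mul_assoc _ _ R', hd, Matrix.one_mul, h2]
  · rw [conjT_mul]
    calc _ = conjT σ (Matrix.diagonal ![x, y]) * (conjT σ R * V.gram * R) *
          Matrix.diagonal ![x, y] := by simp only [Matrix.mul_assoc]
      _ = D.ϖE ^ ε • 1 := by
        rw [hG, conjT_diagonal, diagonal_mul_diagonal_two, diagonal_mul_diagonal_two,
          ← diagonal_two_eq_one, ← Matrix.diagonal_smul]
        congr 1
        ext i
        fin_cases i
        · simp [← hx]; ring
        · simp [← hy]; ring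
  · rw [← Matrix.mul_assoc, hδ, Matrix.mul_assoc, Matrix.mul_assoc, diagonal_mul_diagonal_two,
      diagonal_mul_diagonal_two, mul_comm x, mul_comm y]

/-- The Hermitian form in the coordinates of a frame. -/
theorem IsFrame.form_eq {V : HermSpace σ n} {δ : Matrix n n E} {ε : ℤ}
    {P : Matrix n (Fin 2) E} {P' : Matrix (Fin 2) n E} (h : D.IsFrame V δ ca cb ε P P')
    (x y : Fin 2 → E) :
    V.form (P *ᵥ x) (P *ᵥ y) = D.ϖE ^ ε * (σ (x 0) * y 0 + σ (x 1) * y 1) := by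
  have h1 : (fun i => σ ((P *ᵥ x) i)) = (fun i => σ (x i)) ᵥ* conjT σ P := by
    funext i
    simp [conjT, Matrix.mulVec, Matrix.vecMul, dotProduct, mul_comm]
  rw [HermSpace.form, h1, ← Matrix.dotProduct_mulVec, Matrix.mulVec_mulVec, Matrix.mulVec_mulVec,
    h.gram_eq, Matrix.smul_mulVec, Matrix.one_mulVec, dotProduct_smul, smul_eq_mul]
  simp [dotProduct, Fin.sum_univ_two]

/-- The invariant `κ` of two operators with frames compares the types of the frames. -/
theorem kappaInv_eq (hnorm : ∀ z : E, algebraMap F E (Algebra.norm F z) = z * σ z) (hc : ca ≠ cb)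
    {V : HermSpace σ m} {V' : HermSpace σ n}
    {δ : Matrix m m E} {δ' : Matrix n n E} {ε ε' : ℤ} {P : Matrix m (Fin 2) E}
    {P' : Matrix (Fin 2) m E} {Q : Matrix n (Fin 2) E} {Q' : Matrix (Fin 2) n E}
    (hP : D.IsFrame V δ ca cb ε P P') (hQ : D.IsFrame V' δ' ca cb ε' Q Q')
    (hε : ε = 0 ∨ ε = 1) (hε' : ε' = 0 ∨ ε' = 1) :
    kappaInv V V' δ δ' cb = if ε = ε' then 1 else -1 := by
  have hϖ := D.ϖE_ne_zero
  rw [kappaInv]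
  split_ifs with h1 h2 h2
  · rfl
  · exfalso
    obtain ⟨s, hs0, ⟨P₀, Q₀, ⟨hPQ, hQP, hδ'⟩, hs⟩, hω⟩ := h1
    have hnz : ∃ z : E, Algebra.norm F z = s := by
      rw [omega] at hω
      by_contra h
      rw [if_neg h] at hω
      norm_num at hω
    obtain ⟨z, hz⟩ := hnz
    have hzs : algebraMap F E s = z * σ z := by rw [← hz, hnorm]
    have hs0' : algebraMap F E s ≠ 0 := by simpa using hs0
    have hz0 : z ≠ 0 := fun h => hs0' (by rw [hzs, h, zero_mul])
    -- Norms on the `cb`-eigenlines are compared. The vector `w = Q₀^* u` has norm `s ϖ ^ ε` and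
    -- lies on the `cb`-eigenline of `δ'`, where norms are `ϖ ^ ε'` times norms from `E`. Since `s`
    -- is a norm, `ε` and `ε'` have the same parity.
    set u : m → E := P *ᵥ ![0, 1] with hu
    have hdiag : Matrix.diagonal ![algebraMap F E ca, algebraMap F E cb] *ᵥ ![0, 1] =
        algebraMap F E cb • ![0, 1] := by
      ext i
      fin_cases i <;> simp [Matrix.mulVec_diagonal]
    have hδu : δ *ᵥ u = algebraMap F E cb • u := by
      rw [hu, Matrix.mulVec_mulVec, hP.eig, ← Matrix.mulVec_mulVec, hdiag, Matrix.mulVec_smul]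
    have hsu := hs u hδu
    set w : n → E := HermSpace.adj V V' Q₀ *ᵥ u with hw
    rw [← Matrix.mulVec_mulVec, ← hw] at hsu
    have hform : V'.form w w = algebraMap F E s * D.ϖE ^ ε := by
      have h3 := HermSpace.form_adj V V' Q₀ w u
      rw [hsu, ← hw, hu, ← Matrix.mulVec_smul, hP.form_eq] at h3
      rw [← h3]
      simp [AlgEquiv.commutes, mul_comm]
    have hwu : w = algebraMap F E s • (P₀ *ᵥ u) := by
      rw [← Matrix.mulVec_smul, ← hsu, Matrix.mulVec_mulVec, hPQ, Matrix.one_mulVec]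
    have hδw : δ' *ᵥ w = algebraMap F E cb • w := by
      have h4 : δ' *ᵥ (P₀ *ᵥ u) = algebraMap F E cb • (P₀ *ᵥ u) := by
        rw [Matrix.mulVec_mulVec, hδ', Matrix.mul_assoc, hQP, Matrix.mul_one,
          ← Matrix.mulVec_mulVec, hδu, Matrix.mulVec_smul]
      rw [hwu, Matrix.mulVec_smul, h4, smul_comm]
    set y : Fin 2 → E := Q' *ᵥ w with hy
    have hwy : w = Q *ᵥ y := by rw [hy, Matrix.mulVec_mulVec, hQ.mul_inv, Matrix.one_mulVec]
    have hdy : Matrix.diagonal ![algebraMap F E ca, algebraMap F E cb] *ᵥ y =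
        algebraMap F E cb • y := by
      have h5 : Q' * δ' = Matrix.diagonal ![algebraMap F E ca, algebraMap F E cb] * Q' := by
        rw [hQ.conj_eq, ← Matrix.mul_assoc, ← Matrix.mul_assoc, hQ.inv_mul, Matrix.one_mul]
      rw [hy, Matrix.mulVec_mulVec, ← h5, ← Matrix.mulVec_mulVec, hδw, Matrix.mulVec_smul]
    have hy0 : y 0 = 0 := by
      have h6 := congrFun hdy 0
      simp only [Matrix.mulVec_diagonal, Pi.smul_apply, smul_eq_mul, Matrix.cons_val_zero] at h6
      have h7 : (algebraMap F E ca - algebraMap F E cb) * y 0 = 0 := by linear_combination h6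
      rcases mul_eq_zero.1 h7 with h8 | h8
      · exact absurd ((algebraMap F E).injective (sub_eq_zero.1 h8)) hc
      · exact h8
    rw [hwy, hQ.form_eq, hy0, map_zero, zero_mul, zero_add, hzs] at hform
    have hy1 : y 1 ≠ 0 := by
      intro h
      rw [h, mul_zero, mul_zero] at hform
      exact mul_ne_zero (hzs ▸ hs0') (zpow_ne_zero _ hϖ) hform.symm
    obtain ⟨k, hk⟩ := D.exists_v_norm hy1
    obtain ⟨l, hl⟩ := D.exists_v_norm hz0
    have h9 := congrArg v hform
    rw [mul_comm (σ (y 1)), map_mul, map_mul _ (z * σ z), hk, hl, D.v_ϖE_zpow, D.v_ϖE_zpow,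
      ← exp_add, ← exp_add, exp_inj] at h9
    omega
  · exfalso
    apply h1
    subst h2
    -- For equal types the map from one frame to the other is an isometry, so the cocycle is trivial
    -- and `s = 1`.
    refine ⟨1, one_ne_zero, ⟨Q * P', P * Q', ⟨?_, ?_, ?_⟩, ?_⟩, ?_⟩
    · rw [Matrix.mul_assoc, ← Matrix.mul_assoc P', hP.inv_mul, Matrix.one_mul, hQ.mul_inv]
    · rw [Matrix.mul_assoc, ← Matrix.mul_assoc Q', hQ.inv_mul, Matrix.one_mul, hP.mul_inv]
    · rw [hQ.conj_eq, hP.conj_eq]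
      calc _ = Q * (P' * P) * Matrix.diagonal ![algebraMap F E ca, algebraMap F E cb] *
            (P' * P) * Q' := by rw [hP.inv_mul, Matrix.mul_one, Matrix.mul_one]
        _ = _ := by simp only [Matrix.mul_assoc]
    · intro u _
      have hQQ : conjT σ Q' * conjT σ Q = 1 := by rw [← conjT_mul, hQ.mul_inv, conjT_one]
      have h3 : conjT σ (P * Q') * V.gram * (P * Q') = V'.gram := by
        rw [conjT_mul]
        calc _ = conjT σ Q' * (conjT σ P * V.gram * P) * Q' := by simp only [Matrix.mul_assoc]
          _ = conjT σ Q' * (conjT σ Q * V'.gram * Q) * Q' := by rw [hP.gram_eq, hQ.gram_eq]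
          _ = (conjT σ Q' * conjT σ Q) * V'.gram * (Q * Q') := by simp only [Matrix.mul_assoc]
          _ = V'.gram := by rw [hQQ, hQ.mul_inv, Matrix.one_mul, Matrix.mul_one]
      have h4 : HermSpace.adj V V' (P * Q') * (P * Q') = 1 := by
        rw [HermSpace.adj_eq, Matrix.mul_assoc V'.gram⁻¹, Matrix.mul_assoc V'.gram⁻¹, h3,
          Matrix.nonsing_inv_mul _ V'.nondeg]
      have h5 : (P * Q') * (Q * P') = 1 := by
        rw [Matrix.mul_assoc, ← Matrix.mul_assoc Q', hQ.inv_mul, Matrix.one_mul, hP.mul_inv]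
      have h6 : P * Q' * HermSpace.adj V V' (P * Q') = 1 := by
        calc _ = P * Q' * HermSpace.adj V V' (P * Q') * ((P * Q') * (Q * P')) := by
              rw [h5, Matrix.mul_one]
          _ = P * Q' * (HermSpace.adj V V' (P * Q') * (P * Q')) * (Q * P') := by
              simp only [Matrix.mul_assoc]
          _ = 1 := by rw [h4, Matrix.mul_one, h5]
      rw [h6, Matrix.one_mulVec, map_one, one_smul]
    · rw [omega, if_pos ⟨1, map_one _⟩]
  · rfl

end UnramifiedQuadratic
end Frames
end

/-! ### Types of elements and the orbits in a stable class. -/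

noncomputable section
section Types

open WithZero

variable {F E : Type*} [Field F] [Field E] [Algebra F E] {σ : E ≃ₐ[F] E}
variable {n : Type*} [Fintype n] [DecidableEq n]

theorem HermSpace.gram_mul_adj (V : HermSpace σ n) (X : Matrix n n E) :
    V.gram * HermSpace.adj V V X = conjT σ X * V.gram := by
  rw [HermSpace.adj_eq, Matrix.mul_assoc, Matrix.mul_nonsing_inv_cancel_left _ _ V.nondeg]

theorem HermSpace.adj_one (V : HermSpace σ n) : HermSpace.adj V V (1 : Matrix n n E) = 1 := by
  rw [HermSpace.adj_eq, conjT_one, Matrix.mul_one, Matrix.nonsing_inv_mul _ V.nondeg]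

theorem HermSpace.adj_adj (hσ : ∀ z, σ (σ z) = z) (V : HermSpace σ n) (X : Matrix n n E) :
    HermSpace.adj V V (HermSpace.adj V V X) = X := by
  have hcc : conjT σ (conjT σ X) = X := by ext; simp [conjT, hσ]
  have h := congrArg (conjT σ) (V.gram_mul_adj X)
  rw [conjT_mul, conjT_mul, hcc, V.conjT_gram] at h
  rw [HermSpace.adj_eq, Matrix.mul_assoc, h, Matrix.nonsing_inv_mul_cancel_left _ _ V.nondeg]

/-- Conjugate contractions come from elements that are stably conjugate. -/
theorem exists_intertwiner {V : HermSpace σ n} {x x' g g' : Matrix n n E} (hx : x.det ≠ 0)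
    (hx' : x'.det ≠ 0) (hg : g * g' = 1)
    (h : contraction V V x' * g = g * contraction V V x) :
    ∃ k : GL n E, x' * (k : Matrix n n E) = g * x ∧
      (k : Matrix n n E) * HermSpace.adj V V x = HermSpace.adj V V x' * g := by
  have hxu : IsUnit x.det := isUnit_iff_ne_zero.2 hx
  have hxu' : IsUnit x'.det := isUnit_iff_ne_zero.2 hx'
  have hgg := mul_eq_one_comm.1 hg
  -- The first equation determines the source isomorphism, as `x'` is invertible; the second
  -- equation is then the conjugacy of the contractions.
  refine ⟨⟨x'⁻¹ * g * x, x⁻¹ * g' * x', ?_, ?_⟩, ?_, ?_⟩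
  · calc _ = x'⁻¹ * (g * ((x * x⁻¹) * g')) * x' := by simp only [Matrix.mul_assoc]
      _ = 1 := by rw [Matrix.mul_nonsing_inv _ hxu, Matrix.one_mul, hg, Matrix.mul_one,
                    Matrix.nonsing_inv_mul _ hxu']
  · calc _ = x⁻¹ * (g' * ((x' * x'⁻¹) * g)) * x := by simp only [Matrix.mul_assoc]
      _ = 1 := by rw [Matrix.mul_nonsing_inv _ hxu', Matrix.one_mul, hgg, Matrix.mul_one,
                    Matrix.nonsing_inv_mul _ hxu]
  · change x' * (x'⁻¹ * g * x) = _
    rw [Matrix.mul_assoc, Matrix.mul_nonsing_inv_cancel_left _ _ hxu']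
  · change x'⁻¹ * g * x * HermSpace.adj V V x = _
    rw [contraction, contraction, Matrix.neg_mul, Matrix.mul_neg, neg_inj] at h
    rw [Matrix.mul_assoc, Matrix.mul_assoc, ← h, Matrix.mul_assoc,
      Matrix.nonsing_inv_mul_cancel_left _ _ hxu']

theorem contraction_mul_of_stablyConj {V : HermSpace σ n} {x x' : Matrix n n E}
    (h : StablyConj V V x x') : ∃ g : GL n E,
      contraction V V x' * (g : Matrix n n E) = (g : Matrix n n E) * contraction V V x := by
  obtain ⟨g, k, h1, h2⟩ := h
  refine ⟨g, ?_⟩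
  have hk : ((k⁻¹ : GL n E) : Matrix n n E) * (k : Matrix n n E) = 1 := by
    rw [← Units.val_mul, inv_mul_cancel, Units.val_one]
  have hg : ((g⁻¹ : GL n E) : Matrix n n E) * (g : Matrix n n E) = 1 := by
    rw [← Units.val_mul, inv_mul_cancel, Units.val_one]
  rw [contraction, contraction, Matrix.neg_mul, Matrix.mul_neg, h2, h1]
  congr 1
  calc _ = (g : Matrix n n E) * x * (((k⁻¹ : GL n E) : Matrix n n E) * (k : Matrix n n E)) *
        HermSpace.adj V V x * (((g⁻¹ : GL n E) : Matrix n n E) * (g : Matrix n n E)) := by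
        simp only [Matrix.mul_assoc]
    _ = _ := by rw [hk, hg, Matrix.mul_one, Matrix.mul_one, Matrix.mul_assoc]

theorem stablyConj_of_contraction {V : HermSpace σ n} {x x' g g' : Matrix n n E} (hx : x.det ≠ 0)
    (hx' : x'.det ≠ 0) (hg : g * g' = 1)
    (h : contraction V V x' * g = g * contraction V V x) : StablyConj V V x x' := by
  obtain ⟨k, h1, h2⟩ := exists_intertwiner hx hx' hg h
  have hk : (k : Matrix n n E) * ((k⁻¹ : GL n E) : Matrix n n E) = 1 := by
    rw [← Units.val_mul, mul_inv_cancel, Units.val_one]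
  refine ⟨⟨g, g', hg, mul_eq_one_comm.1 hg⟩, k, ?_, ?_⟩
  · change x' = g * x * _
    rw [← h1, Matrix.mul_assoc, hk, Matrix.mul_one]
  · change _ = k * HermSpace.adj V V x * g'
    rw [h2, Matrix.mul_assoc, hg, Matrix.mul_one]

theorem smul_hom_eq {V₁ : HermSpace σ n} {V₂ : HermSpace σ n} (g : V₁.U × V₂.U)
    (X : Matrix n n E) : g • X = ((g.1 : GL n E) : Matrix n n E) * X *
      (((g.2 : GL n E)⁻¹ : GL n E) : Matrix n n E) := rfl

/-- A unitary conjugation of contractions lifts to the action of `U(V) × U(V)`: the forced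
isomorphism `k` at the source is again unitary. -/
theorem exists_smul_eq_of_contraction {V : HermSpace σ n} {x x' g g' : Matrix n n E}
    (hx : x.det ≠ 0) (hx' : x'.det ≠ 0) (hg : g * g' = 1) (hgU : HermSpace.adj V V g * g = 1)
    (h : contraction V V x' * g = g * contraction V V x) : ∃ γ : V.U × V.U, γ • x = x' := by
  obtain ⟨k, h1, h2⟩ := exists_intertwiner hx hx' hg h
  have hk : (k : Matrix n n E) * ((k⁻¹ : GL n E) : Matrix n n E) = 1 := by
    rw [← Units.val_mul, mul_inv_cancel, Units.val_one]
  -- The two intertwining relations show that `k^* k` fixes the invertible operator `x^*` under left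
  -- multiplication, so `k^* k = 1`.
  have h3 : HermSpace.adj V V (k : Matrix n n E) * (k : Matrix n n E) * HermSpace.adj V V x =
      HermSpace.adj V V x := by
    rw [Matrix.mul_assoc, h2, ← Matrix.mul_assoc, ← HermSpace.adj_mul, h1, HermSpace.adj_mul V V V,
      Matrix.mul_assoc, hgU, Matrix.mul_one]
  have hau : IsUnit (HermSpace.adj V V x).det := by
    rw [HermSpace.det_adj, isUnit_iff_ne_zero]; simpa using hx
  have h4 : HermSpace.adj V V (k : Matrix n n E) * (k : Matrix n n E) = 1 := by
    rw [← Matrix.mul_nonsing_inv_cancel_right _ (HermSpace.adj V V (k : Matrix n n E) *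
      (k : Matrix n n E)) hau, h3,
      Matrix.mul_nonsing_inv _ hau]
  refine ⟨(⟨⟨g, g', hg, mul_eq_one_comm.1 hg⟩, HermSpace.mem_U_of_adj_mul hgU⟩,
    ⟨k, HermSpace.mem_U_of_adj_mul h4⟩), ?_⟩
  rw [smul_hom_eq]
  change g * x * _ = _
  rw [← h1, Matrix.mul_assoc, hk, Matrix.mul_one]

namespace UnramifiedQuadratic

variable {v : Valuation E ℤᵐ⁰} {q : ℕ} (D : UnramifiedQuadratic σ v q)

/-- A self-adjoint operator of a unimodular plane with distinct eigenvalues in the base field has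
a frame. -/
theorem exists_frame_of_eigenbasis {V : HermSpace σ (Fin 2)} (hV : v V.gram.det = 1) {ca cb : F}
    (hc : ca ≠ cb) {δ R R' : Matrix (Fin 2) (Fin 2) E} (hδ : conjT σ δ * V.gram = V.gram * δ)
    (hR : R * R' = 1)
    (heig : δ * R = R * Matrix.diagonal ![algebraMap F E ca, algebraMap F E cb]) :
    ∃ ε : ℤ, (ε = 0 ∨ ε = 1) ∧ ∃ P P', D.IsFrame V δ ca cb ε P P' := by
  set G := conjT σ R * V.gram * R with hG
  set d := Matrix.diagonal ![algebraMap F E ca, algebraMap F E cb] with hd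
  have hcc : ∀ Y : Matrix (Fin 2) (Fin 2) E, conjT σ (conjT σ Y) = Y := fun Y => by
    ext; simp [conjT, D.conj_conj]
  have hGH : conjT σ G = G := by
    rw [hG, conjT_mul, conjT_mul, hcc, V.conjT_gram, Matrix.mul_assoc]
  have hdd : conjT σ d = d := by
    rw [hd, conjT_diagonal, AlgEquiv.commutes, AlgEquiv.commutes]
  -- Self-adjointness of `δ` makes the Gram matrix of the eigenbasis commute with the eigenvalue
  -- matrix. As the eigenvalues are distinct, the eigenlines are orthogonal.
  have hcomm : G * d = d * G := by
    calc G * d = conjT σ R * (V.gram * δ) * R := by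
          rw [hG, Matrix.mul_assoc, ← heig]; simp only [Matrix.mul_assoc]
      _ = conjT σ (δ * R) * V.gram * R := by
          rw [← hδ, conjT_mul]; simp only [Matrix.mul_assoc]
      _ = d * G := by rw [heig, conjT_mul, hdd, hG]; simp only [Matrix.mul_assoc]
  have hc' : algebraMap F E ca - algebraMap F E cb ≠ 0 :=
    sub_ne_zero.2 fun h => hc ((algebraMap F E).injective h)
  have h01 : G 0 1 = 0 := by
    have := congrFun (congrFun hcomm 0) 1
    simp only [hd, Matrix.mul_diagonal, Matrix.diagonal_mul, Matrix.cons_val_zero,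
      Matrix.cons_val_one] at this
    have h3 : (algebraMap F E ca - algebraMap F E cb) * G 0 1 = 0 := by linear_combination -this
    exact (mul_eq_zero.1 h3).resolve_left hc'
  have h00 : σ (G 0 0) = G 0 0 := congrFun (congrFun hGH 0) 0
  have h11 : σ (G 1 1) = G 1 1 := congrFun (congrFun hGH 1) 1
  have h10 : G 1 0 = 0 := by
    rw [← congrFun (congrFun hGH 1) 0]
    change σ (G 0 1) = 0
    rw [h01, map_zero]
  have hGd : G = Matrix.diagonal ![G 0 0, G 1 1] := by
    ext i j
    fin_cases i <;> fin_cases j <;> simp [h01, h10]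
  have hRdet : R.det ≠ 0 := by
    intro h
    have := congrArg Matrix.det hR
    rw [Matrix.det_mul, h, zero_mul, Matrix.det_one] at this
    exact zero_ne_one this
  have hdet : G 0 0 * G 1 1 = R.det * σ R.det * V.gram.det := by
    have h1 : G.det = G 0 0 * G 1 1 := by rw [Matrix.det_fin_two, h01]; ring
    rw [← h1, hG, Matrix.det_mul, Matrix.det_mul, det_conjT]
    ring
  have hne : G 0 0 * G 1 1 ≠ 0 := by
    rw [hdet]
    exact mul_ne_zero (mul_ne_zero hRdet (by simpa using hRdet)) V.nondeg.ne_zero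
  obtain ⟨a, ha⟩ := v.exists_eq_exp_neg (left_ne_zero_of_mul hne)
  obtain ⟨b, hb⟩ := v.exists_eq_exp_neg (right_ne_zero_of_mul hne)
  obtain ⟨k, hk⟩ := D.exists_v_norm hRdet
  -- The product of the two norms is a unit times the norm of `det R`, so both have the same parity,
  -- and a single `ε` serves both vectors.
  have hab : a + b = 2 * k := by
    have := congrArg v hdet
    rw [map_mul, ha, hb, map_mul, hk, hV, mul_one, ← exp_add, exp_inj] at this
    omega
  refine ⟨a % 2, by omega, exists_frame_of_diagonal (mul_eq_one_comm.1 hR) hR (hG.symm.trans hGd)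
    h00 h11 ha hb ?_ ?_ heig⟩
  · rw [Int.even_iff]; omega
  · rw [Int.even_iff]; omega

/-- The contraction of `x` has eigenvalues `ca`, `cb`, and eigenvectors of norm `ϖ ^ ε`. -/
def HasType (V : HermSpace σ (Fin 2)) (ca cb : F) (ε : ℤ) (x : Matrix (Fin 2) (Fin 2) E) : Prop :=
  ∃ P P', D.IsFrame V (contraction V V x) ca cb ε P P'

variable {D} {V : HermSpace σ (Fin 2)} {ca cb : F} {ε ε' : ℤ} {x x' : Matrix (Fin 2) (Fin 2) E}

omit [Algebra F E] in
theorem _root_.det_dsum_eigen (a b : E) :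
    (dsum (Matrix.of fun _ _ : Fin 1 => a) (Matrix.of fun _ _ : Fin 1 => b)).submatrix
      (finSumFinEquiv (m := 1) (n := 1)).symm (finSumFinEquiv (m := 1) (n := 1)).symm =
      Matrix.diagonal ![a, b] := by
  ext i j
  fin_cases i <;> fin_cases j <;> rfl

/-- The inverse of the conjugating isomorphism has an eigenbasis as its columns, which can be
rescaled to a frame. -/
theorem exists_hasType (hV : v V.gram.det = 1) (hc : ca ≠ cb)
    (h : IsJLTransfer (contraction V V x)
      (dsum (Matrix.of fun _ _ : Fin 1 => algebraMap F E ca)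
        (Matrix.of fun _ _ : Fin 1 => algebraMap F E cb))) :
    ∃ ε : ℤ, (ε = 0 ∨ ε = 1) ∧ D.HasType V ca cb ε x := by
  obtain ⟨P, Q, hPQ, hQP, h⟩ := h
  set e := (finSumFinEquiv (m := 1) (n := 1)).symm
  refine D.exists_frame_of_eigenbasis hV hc (R := Q.submatrix id e) (R' := P.submatrix e id)
    (conjT_contraction_mul D.conj_conj V V x) ?_ ?_
  · rw [Matrix.submatrix_mul_equiv, hQP, Matrix.submatrix_id_id]
  · rw [← det_dsum_eigen, h]
    change _ = _ * (P * contraction V V x * Q).submatrix e e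
    rw [Matrix.submatrix_mul_equiv, ← Matrix.mul_assoc, ← Matrix.mul_assoc, hQP, Matrix.one_mul]
    rfl

theorem HasType.det_contraction (h : D.HasType V ca cb ε x) :
    x.det * σ x.det = algebraMap F E (ca * cb) := by
  obtain ⟨P, P', hP⟩ := h
  have h1 : (contraction V V x).det = x.det * σ x.det := by
    rw [contraction, Matrix.det_neg, Matrix.det_mul, HermSpace.det_adj]; simp
  have h2 : P.det * P'.det = 1 := by rw [← Matrix.det_mul, hP.mul_inv, Matrix.det_one]
  rw [← h1, hP.conj_eq, Matrix.det_mul, Matrix.det_mul, Matrix.det_diagonal, Fin.prod_univ_two,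
    map_mul, mul_right_comm, h2, one_mul]
  rfl

theorem HasType.det_ne_zero (h : D.HasType V ca cb ε x) (ha : ca ≠ 0) (hb : cb ≠ 0) :
    x.det ≠ 0 := by
  intro h0
  have := h.det_contraction
  rw [h0, zero_mul, eq_comm, map_eq_zero] at this
  exact mul_ne_zero ha hb this

/-- `ca * cb` is the norm of `det x`. -/
theorem HasType.even_add (h : D.HasType V ca cb ε x) {a b : ℤ}
    (ha : v (algebraMap F E ca) = exp (-a)) (hb : v (algebraMap F E cb) = exp (-b)) :
    Even (a + b) := by
  have h1 : ca ≠ 0 := fun h => by rw [h, map_zero, map_zero] at ha; exact exp_ne_zero ha.symm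
  have h2 : cb ≠ 0 := fun h => by rw [h, map_zero, map_zero] at hb; exact exp_ne_zero hb.symm
  obtain ⟨k, hk⟩ := D.exists_v_norm (h.det_ne_zero h1 h2)
  rw [h.det_contraction, map_mul, map_mul, ha, hb, ← exp_add, exp_inj] at hk
  exact ⟨k, by omega⟩

/-- Stable conjugacy only sees the eigenvalues, so the types may differ here. -/
theorem HasType.stablyConj (h : D.HasType V ca cb ε x) (h' : D.HasType V ca cb ε' x')
    (ha : ca ≠ 0) (hb : cb ≠ 0) : StablyConj V V x x' := by
  have hx := h.det_ne_zero ha hb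
  have hx' := h'.det_ne_zero ha hb
  obtain ⟨P, P', hP⟩ := h
  obtain ⟨Q, Q', hQ⟩ := h'
  refine stablyConj_of_contraction (g := Q * P') (g' := P * Q') hx hx' ?_ ?_
  · rw [Matrix.mul_assoc, ← Matrix.mul_assoc P', hP.inv_mul, Matrix.one_mul, hQ.mul_inv]
  · rw [← Matrix.mul_assoc, hQ.eig, hP.conj_eq, Matrix.mul_assoc Q, Matrix.mul_assoc Q,
      Matrix.mul_assoc P, ← Matrix.mul_assoc P', hP.inv_mul, Matrix.one_mul]

/-- The map between two frames of the same type is unitary, which refines stable conjugacy to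
conjugacy. -/
theorem HasType.exists_smul_eq (h : D.HasType V ca cb ε x) (h' : D.HasType V ca cb ε x')
    (ha : ca ≠ 0) (hb : cb ≠ 0) : ∃ γ : V.U × V.U, γ • x = x' := by
  have hx := h.det_ne_zero ha hb
  have hx' := h'.det_ne_zero ha hb
  obtain ⟨P, P', hP⟩ := h
  obtain ⟨Q, Q', hQ⟩ := h'
  have hPP : conjT σ P' * conjT σ P = 1 := by rw [← conjT_mul, hP.mul_inv, conjT_one]
  refine exists_smul_eq_of_contraction (g := Q * P') (g' := P * Q') hx hx' ?_ ?_ ?_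
  · rw [Matrix.mul_assoc, ← Matrix.mul_assoc P', hP.inv_mul, Matrix.one_mul, hQ.mul_inv]
  · rw [HermSpace.adj_eq, Matrix.mul_assoc, Matrix.mul_assoc, conjT_mul]
    have : conjT σ P' * conjT σ Q * (V.gram * (Q * P')) = V.gram := by
      calc _ = conjT σ P' * (conjT σ Q * V.gram * Q) * P' := by simp only [Matrix.mul_assoc]
        _ = conjT σ P' * (conjT σ P * V.gram * P) * P' := by rw [hP.gram_eq, hQ.gram_eq]
        _ = (conjT σ P' * conjT σ P) * V.gram * (P * P') := by simp only [Matrix.mul_assoc]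
        _ = V.gram := by rw [hPP, hP.mul_inv, Matrix.one_mul, Matrix.mul_one]
    rw [this, Matrix.nonsing_inv_mul _ V.nondeg]
  · rw [← Matrix.mul_assoc, hQ.eig, hP.conj_eq, Matrix.mul_assoc Q, Matrix.mul_assoc Q,
      Matrix.mul_assoc P, ← Matrix.mul_assoc P', hP.inv_mul, Matrix.one_mul]

theorem HasType.exists_of_stablyConj (hV : v V.gram.det = 1) (hc : ca ≠ cb)
    (h : D.HasType V ca cb ε x) (hs : StablyConj V V x x') :
    ∃ ε' : ℤ, (ε' = 0 ∨ ε' = 1) ∧ D.HasType V ca cb ε' x' := by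
  obtain ⟨P, P', hP⟩ := h
  obtain ⟨g, hg⟩ := contraction_mul_of_stablyConj hs
  have hgg : (g : Matrix (Fin 2) (Fin 2) E) * ((g⁻¹ : GL (Fin 2) E) : Matrix (Fin 2) (Fin 2) E) =
      1 := by rw [← Units.val_mul, mul_inv_cancel, Units.val_one]
  refine D.exists_frame_of_eigenbasis hV hc (R := g * P)
    (R' := P' * ((g⁻¹ : GL (Fin 2) E) : Matrix (Fin 2) (Fin 2) E))
    (conjT_contraction_mul D.conj_conj V V x') ?_ ?_
  · rw [Matrix.mul_assoc, ← Matrix.mul_assoc P, hP.mul_inv, Matrix.one_mul, hgg]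
  · rw [← Matrix.mul_assoc, hg, Matrix.mul_assoc, hP.eig, Matrix.mul_assoc]

/-- The preimage of a frame under `x`. -/
theorem IsFrame.gram_preimage {P P' : Matrix (Fin 2) (Fin 2) E}
    (hP : D.IsFrame V (contraction V V x) ca cb ε P P') (hx : x.det ≠ 0) (ha : ca ≠ 0)
    (hb : cb ≠ 0) : conjT σ (x⁻¹ * P) * V.gram * (x⁻¹ * P) =
      Matrix.diagonal ![-D.ϖE ^ ε / algebraMap F E ca, -D.ϖE ^ ε / algebraMap F E cb] := by
  have hxu : IsUnit x.det := isUnit_iff_ne_zero.2 hx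
  have ha' : algebraMap F E ca ≠ 0 := by simpa using ha
  have hb' : algebraMap F E cb ≠ 0 := by simpa using hb
  set R := x⁻¹ * P with hR
  have hxR : x * R = P := by rw [hR, Matrix.mul_nonsing_inv_cancel_left _ _ hxu]
  set d := Matrix.diagonal ![algebraMap F E ca, algebraMap F E cb] with hd
  -- The eigenvalue equation `-x x^* P = P d`, divided by `x`; it turns the form on the preimages
  -- into the form on the frame divided by the eigenvalues.
  have h1 : HermSpace.adj V V x * P = -(R * d) := by
    have := hP.eig
    rw [contraction, Matrix.neg_mul, neg_eq_iff_eq_neg, Matrix.mul_assoc] at this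
    rw [← Matrix.nonsing_inv_mul_cancel_left _ (HermSpace.adj V V x * P) hxu, this, Matrix.mul_neg,
      ← Matrix.mul_assoc]
  have h2 : conjT σ R * V.gram * R * d = -(D.ϖE ^ ε • 1) := by
    have h3 : conjT σ R * (V.gram * (HermSpace.adj V V x * P)) = D.ϖE ^ ε • 1 := by
      rw [← Matrix.mul_assoc V.gram, V.gram_mul_adj, ← hP.gram_eq]
      calc _ = conjT σ (x * R) * V.gram * P := by rw [conjT_mul x R]; simp only [Matrix.mul_assoc]
        _ = _ := by rw [hxR]
    rw [← h3, h1]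
    simp only [Matrix.mul_neg, neg_neg, Matrix.mul_assoc]
  have hdd : d * Matrix.diagonal ![(algebraMap F E ca)⁻¹, (algebraMap F E cb)⁻¹] = 1 := by
    rw [hd, diagonal_mul_diagonal_two, mul_inv_cancel₀ ha', mul_inv_cancel₀ hb',
      diagonal_two_eq_one]
  calc conjT σ R * V.gram * R = conjT σ R * V.gram * R * d *
        Matrix.diagonal ![(algebraMap F E ca)⁻¹, (algebraMap F E cb)⁻¹] := by
        rw [Matrix.mul_assoc _ d, hdd, Matrix.mul_one]
    _ = _ := by
      rw [h2]
      ext i j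
      fin_cases i <;> fin_cases j <;> simp [div_eq_mul_inv]

/-- The adjoint has the opposite type if the eigenvalues have odd valuation. -/
theorem HasType.adj (h : D.HasType V ca cb ε x) {a b : ℤ}
    (ha : v (algebraMap F E ca) = exp (-a)) (hb : v (algebraMap F E cb) = exp (-b))
    (hoa : Odd a) (hob : Odd b) : D.HasType V ca cb (1 - ε) (HermSpace.adj V V x) := by
  have h1 : ca ≠ 0 := fun h => by rw [h, map_zero, map_zero] at ha; exact exp_ne_zero ha.symm
  have h2 : cb ≠ 0 := fun h => by rw [h, map_zero, map_zero] at hb; exact exp_ne_zero hb.symm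
  have hx := h.det_ne_zero h1 h2
  have hxu : IsUnit x.det := isUnit_iff_ne_zero.2 hx
  obtain ⟨P, P', hP⟩ := h
  have hxx : x * x⁻¹ = 1 := Matrix.mul_nonsing_inv _ hxu
  have hvv : ∀ (c : F) (k : ℤ), v (algebraMap F E c) = exp (-k) →
      v (-D.ϖE ^ ε / algebraMap F E c) = exp (-(ε - k)) := by
    intro c k hk
    rw [map_div₀, Valuation.map_neg, D.v_ϖE_zpow, hk, ← exp_sub]; congr 1; ring
  -- The preimages of the frame are eigenvectors of `-x^* x`, with norms `-ϖ ^ ε` divided by the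
  -- eigenvalues. Odd valuations switch the parity.
  refine exists_frame_of_diagonal (R := x⁻¹ * P) (R' := P' * x) ?_ ?_
    (hP.gram_preimage hx h1 h2) ?_ ?_ (hvv ca a ha) (hvv cb b hb) ?_ ?_ ?_
  · rw [Matrix.mul_assoc, ← Matrix.mul_assoc x, hxx, Matrix.one_mul, hP.inv_mul]
  · rw [Matrix.mul_assoc, ← Matrix.mul_assoc P, hP.mul_inv, Matrix.one_mul,
      Matrix.nonsing_inv_mul _ hxu]
  · rw [map_div₀, map_neg, map_zpow₀, D.conj_ϖE, AlgEquiv.commutes]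
  · rw [map_div₀, map_neg, map_zpow₀, D.conj_ϖE, AlgEquiv.commutes]
  · obtain ⟨k, rfl⟩ := hoa; exact ⟨1 - ε + k, by ring⟩
  · obtain ⟨k, rfl⟩ := hob; exact ⟨1 - ε + k, by ring⟩
  · have := hP.eig
    rw [contraction, Matrix.neg_mul, neg_eq_iff_eq_neg, Matrix.mul_assoc] at this
    rw [contraction, HermSpace.adj_adj D.conj_conj, Matrix.neg_mul, Matrix.mul_assoc,
      Matrix.mul_nonsing_inv_cancel_left _ _ hxu,
      ← Matrix.nonsing_inv_mul_cancel_left _ (HermSpace.adj V V x * P) hxu, this, Matrix.mul_neg,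
      neg_neg, Matrix.mul_assoc]

/-- A frame at the source of `x`, if the negatives of the eigenvalues are norms. -/
theorem IsFrame.gram_source {P P' : Matrix (Fin 2) (Fin 2) E}
    (hP : D.IsFrame V (contraction V V x) ca cb ε P P') (hx : x.det ≠ 0) {ta tb : E}
    (hta : ta ≠ 0) (htb : tb ≠ 0)
    (ha : -algebraMap F E ca = ta * σ ta) (hb : -algebraMap F E cb = tb * σ tb) :
    conjT σ (x⁻¹ * P * Matrix.diagonal ![ta, tb]) * V.gram *
      (x⁻¹ * P * Matrix.diagonal ![ta, tb]) = D.ϖE ^ ε • 1 := by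
  have hta' : σ ta ≠ 0 := by simpa using hta
  have htb' : σ tb ≠ 0 := by simpa using htb
  have ha0 : algebraMap F E ca ≠ 0 := by
    rw [← neg_ne_zero, ha]; exact mul_ne_zero hta hta'
  have hb0 : algebraMap F E cb ≠ 0 := by
    rw [← neg_ne_zero, hb]; exact mul_ne_zero htb htb'
  have h := hP.gram_preimage hx (by simpa using ha0) (by simpa using hb0)
  rw [conjT_mul]
  calc _ = conjT σ (Matrix.diagonal ![ta, tb]) * (conjT σ (x⁻¹ * P) * V.gram * (x⁻¹ * P)) *
        Matrix.diagonal ![ta, tb] := by simp only [Matrix.mul_assoc]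
    _ = _ := by
      rw [h, conjT_diagonal, diagonal_mul_diagonal_two, diagonal_mul_diagonal_two,
        ← diagonal_two_eq_one, ← Matrix.diagonal_smul, neg_div, ← div_neg, ha, neg_div, ← div_neg,
        hb]
      congr 1
      ext i
      fin_cases i
      · simp; field_simp
      · simp; field_simp

/-- There is a similitude of a unimodular plane whose factor is a uniformizer. -/
theorem exists_similitude (D : UnramifiedQuadratic σ v q) (hVi : IsIntegralMatrix v V.gram)
    (hV : v V.gram.det = 1) :
    ∃ T T' : Matrix (Fin 2) (Fin 2) E, T * T' = 1 ∧ conjT σ T * V.gram * T = D.ϖE • V.gram := by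
  obtain ⟨C, -, hCd, hC⟩ := D.exists_conjT_mul_self hVi hV V.conjT_gram
  have hCu : IsUnit C.det := isUnit_iff_ne_zero.2 fun h => by simp [h] at hCd
  have hϖ := D.ϖE_ne_zero
  have hvϖ : v D.ϖE = exp (-1) := D.v_ϖ
  -- `ϖ - 1` is a unit, hence a norm; then `1 + b σ(b) = ϖ` is the factor of the standard similitude
  -- `S`, which `C` transports to `V`.
  obtain ⟨b, hb, -⟩ := D.exists_norm_unit (a := D.ϖE - 1)
    (by rw [map_sub, D.conj_ϖE, map_one]) (by
      rw [v.map_sub_eq_of_lt_right, map_one]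
      rw [hvϖ, map_one, ← exp_zero, exp_lt_exp]; norm_num)
  set S : Matrix (Fin 2) (Fin 2) E := !![1, -σ b; b, 1] with hS
  have hSS : conjT σ S * S = D.ϖE • 1 := by
    have h1 : conjT σ S = !![1, σ b; -b, 1] := by
      ext i j
      fin_cases i <;> fin_cases j <;> simp [conjT, hS, D.conj_conj]
    rw [h1, hS, Matrix.mul_fin_two]
    ext i j
    fin_cases i <;> fin_cases j <;> simp
    · linear_combination hb
    · linear_combination hb
  have hSd : IsUnit S.det := by
    rw [hS, Matrix.det_fin_two_of, isUnit_iff_ne_zero]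
    intro h
    apply hϖ
    linear_combination h - hb
  have hCC : conjT σ C⁻¹ * conjT σ C = 1 := by
    rw [← conjT_mul, Matrix.mul_nonsing_inv _ hCu, conjT_one]
  refine ⟨C⁻¹ * S * C, C⁻¹ * S⁻¹ * C, ?_, ?_⟩
  · calc _ = C⁻¹ * (S * ((C * C⁻¹) * S⁻¹)) * C := by simp only [Matrix.mul_assoc]
      _ = 1 := by rw [Matrix.mul_nonsing_inv _ hCu, Matrix.one_mul, Matrix.mul_nonsing_inv _ hSd,
                    Matrix.mul_one, Matrix.nonsing_inv_mul _ hCu]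
  · rw [conjT_mul, conjT_mul]
    calc _ = conjT σ C * (conjT σ S * ((conjT σ C⁻¹ * V.gram * C⁻¹) * S)) * C := by
          simp only [Matrix.mul_assoc]
      _ = conjT σ C * (conjT σ S * (((conjT σ C⁻¹ * conjT σ C) * (C * C⁻¹)) * S)) * C := by
          rw [← hC]; simp only [Matrix.mul_assoc]
      _ = D.ϖE • V.gram := by
          rw [hCC, Matrix.mul_nonsing_inv _ hCu, Matrix.one_mul, Matrix.one_mul, hSS,
            Matrix.mul_smul, Matrix.mul_one, Matrix.smul_mul, hC]

/-- Both types occur in a stable class. -/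
theorem HasType.exists_opposite (h : D.HasType V ca cb ε x) (hVi : IsIntegralMatrix v V.gram)
    (hV : v V.gram.det = 1) : ∃ x', D.HasType V ca cb (1 - ε) x' := by
  obtain ⟨P, P', hP⟩ := h
  have hϖ := D.ϖE_ne_zero
  obtain ⟨T, T', hT, hTT⟩ := exists_similitude D hVi hV
  have hT' := mul_eq_one_comm.1 hT
  have h1 : HermSpace.adj V V T = D.ϖE • T' := by
    rw [HermSpace.adj_eq]
    calc _ = V.gram⁻¹ * (conjT σ T * V.gram * T) * T' := by
          simp only [Matrix.mul_assoc]; rw [hT, Matrix.mul_one]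
      _ = _ := by rw [hTT, Matrix.mul_smul, Matrix.nonsing_inv_mul _ V.nondeg, Matrix.smul_mul,
                    Matrix.one_mul]
  have h2 : HermSpace.adj V V T' = D.ϖE⁻¹ • T := by
    have h3 : HermSpace.adj V V T' * (D.ϖE • T') = 1 := by
      rw [← h1, ← HermSpace.adj_mul, hT, HermSpace.adj_one]
    calc _ = HermSpace.adj V V T' * (D.ϖE • T') * (D.ϖE⁻¹ • T) := by
          rw [Matrix.mul_assoc, Matrix.smul_mul, Matrix.mul_smul T', hT', smul_smul,
            mul_inv_cancel₀ hϖ, one_smul, Matrix.mul_one]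
      _ = _ := by rw [h3, Matrix.one_mul]
  -- The factors of the similitude and of its inverse cancel, so conjugation by `T` keeps the
  -- eigenvalues, while it multiplies the norms of the frame by `ϖ`.
  have h3 : contraction V V (T * x * T') = T * contraction V V x * T' := by
    rw [contraction, contraction, HermSpace.adj_mul V V V, HermSpace.adj_mul V V V, h1, h2]
    simp only [Matrix.smul_mul, Matrix.mul_smul, smul_smul, mul_inv_cancel₀ hϖ,
      one_smul, Matrix.mul_neg, Matrix.neg_mul]
    congr 1
    calc _ = T * x * (T' * T) * (HermSpace.adj V V x * T') := by simp only [Matrix.mul_assoc]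
      _ = _ := by rw [hT', Matrix.mul_one]; simp only [Matrix.mul_assoc]
  have hvv : v (D.ϖE ^ (ε + 1)) = exp (-(ε + 1)) := D.v_ϖE_zpow _
  have hσσ : σ (D.ϖE ^ (ε + 1)) = D.ϖE ^ (ε + 1) := by rw [map_zpow₀, D.conj_ϖE]
  refine ⟨T * x * T', ?_⟩
  refine exists_frame_of_diagonal (R := T * P) (R' := P' * T') ?_ ?_ (ga := D.ϖE ^ (ε + 1))
    (gb := D.ϖE ^ (ε + 1)) ?_ hσσ hσσ hvv hvv ?_ ?_ ?_
  · rw [Matrix.mul_assoc, ← Matrix.mul_assoc T', hT', Matrix.one_mul, hP.inv_mul]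
  · rw [Matrix.mul_assoc, ← Matrix.mul_assoc P, hP.mul_inv, Matrix.one_mul, hT]
  · rw [conjT_mul]
    calc _ = conjT σ P * (conjT σ T * V.gram * T) * P := by simp only [Matrix.mul_assoc]
      _ = D.ϖE • (conjT σ P * V.gram * P) := by rw [hTT]; simp
      _ = _ := by
        rw [hP.gram_eq, smul_smul, zpow_add_one₀ hϖ, mul_comm, ← diagonal_two_eq_one,
          ← Matrix.diagonal_smul]
        congr 1
        ext i
        fin_cases i <;> simp
  · exact ⟨-ε, by ring⟩
  · exact ⟨-ε, by ring⟩
  · rw [h3, Matrix.mul_assoc, ← Matrix.mul_assoc T', hT', Matrix.one_mul, Matrix.mul_assoc,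
      hP.eig, Matrix.mul_assoc]

theorem kappaInv_eq_of_hasType (hnorm : ∀ z : E, algebraMap F E (Algebra.norm F z) = z * σ z)
    (hc : ca ≠ cb) (h : D.HasType V ca cb ε x) (h' : D.HasType V ca cb ε' x')
    (hε : ε = 0 ∨ ε = 1) (hε' : ε' = 0 ∨ ε' = 1) :
    kappaInv V V (contraction V V x) (contraction V V x') cb = if ε = ε' then 1 else -1 := by
  obtain ⟨P, P', hP⟩ := h
  obtain ⟨Q, Q', hQ⟩ := h'
  exact kappaInv_eq hnorm hc hP hQ hε hε'

/-- The sum of two unimodular lines has a frame of type zero. -/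
theorem exists_frame_sum (D : UnramifiedQuadratic σ v q) {V₁ : HermSpace σ (Fin 1)}
    (hV₁ : v (V₁.gram 0 0) = 1) :
    ∃ P P', D.IsFrame (V₁.sum V₁) (dsum (Matrix.of fun _ _ : Fin 1 => algebraMap F E ca)
        (Matrix.of fun _ _ : Fin 1 => algebraMap F E cb)) ca cb 0 P P' := by
  set e := (finSumFinEquiv (m := 1) (n := 1)).symm
  have h1 : σ (V₁.gram 0 0) = V₁.gram 0 0 := congrFun (congrFun V₁.conjT_gram 0) 0
  have hv : v (V₁.gram 0 0) = exp (-0) := by rw [hV₁]; simp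
  refine exists_frame_of_diagonal (R := (1 : Matrix (Fin 1 ⊕ Fin 1) (Fin 1 ⊕ Fin 1) E).submatrix id e)
    (R' := (1 : Matrix (Fin 1 ⊕ Fin 1) (Fin 1 ⊕ Fin 1) E).submatrix e id) ?_ ?_
    (ga := V₁.gram 0 0) (gb := V₁.gram 0 0) ?_ h1 h1 hv hv (by simp) (by simp) ?_
  · change (Matrix.submatrix _ e id) * (Matrix.submatrix _ id e) = 1
    rw [← Matrix.submatrix_mul _ _ e id e Function.bijective_id, Matrix.one_mul,
      Matrix.submatrix_one_equiv]
  · rw [Matrix.submatrix_mul_equiv, Matrix.one_mul, Matrix.submatrix_id_id]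
  · have h2 : conjT σ ((1 : Matrix (Fin 1 ⊕ Fin 1) (Fin 1 ⊕ Fin 1) E).submatrix id e) =
        (1 : Matrix (Fin 1 ⊕ Fin 1) (Fin 1 ⊕ Fin 1) E).submatrix e id := by
      ext i j
      simp only [conjT, Matrix.transpose_apply, Matrix.map_apply, Matrix.submatrix_apply, id,
        Matrix.one_apply, eq_comm]
      split_ifs <;> simp
    rw [h2]
    have h3 : (1 : Matrix (Fin 1 ⊕ Fin 1) (Fin 1 ⊕ Fin 1) E).submatrix e id * (V₁.sum V₁).gram *
        (1 : Matrix (Fin 1 ⊕ Fin 1) (Fin 1 ⊕ Fin 1) E).submatrix id e =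
        (V₁.sum V₁).gram.submatrix e e := by
      ext i j
      simp [Matrix.mul_apply, Matrix.one_apply]
    rw [h3]
    ext i j
    fin_cases i <;> fin_cases j <;> rfl
  · rw [← det_dsum_eigen]
    change _ = (Matrix.submatrix _ id e) * (Matrix.submatrix _ e e)
    rw [Matrix.submatrix_mul_equiv, Matrix.one_mul]
    ext i j
    simp [Matrix.mul_apply, Matrix.one_apply]

end UnramifiedQuadratic
end Types
end

/-! ### Topology of local fields, integral matrices and unitary groups. -/

noncomputable section
section Topology

open WithZero

variable (E : Type*) [Field E] [ValuativeRel E] [TopologicalSpace E] [IsNonarchimedeanLocalField E]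

theorem intValuation_hasBasis_nhds_zero :
    (nhds (0 : E)).HasBasis (fun _ : ℕ => True) fun n => {x | intValuation E x ≤ exp (-(n : ℤ))} := by
  have h := IsValuativeTopology.hasBasis_nhds_zero' E
  refine h.to_hasBasis (fun γ hγ => ?_) (fun n _ => ?_)
  · set e := IsNonarchimedeanLocalField.valueGroupWithZeroIsoInt E with he
    have h0 : e γ ≠ 0 := by simpa using hγ
    obtain ⟨k, hk⟩ : ∃ k : ℤ, e γ = exp k := ⟨log (e γ), (exp_log h0).symm⟩
    -- One more than `-k`, because the given neighbourhood is an open ball with strict inequality;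
    -- `toNat` only enlarges the exponent.
    refine ⟨(1 - k).toNat, trivial, fun x hx => ?_⟩
    change valuation E x < γ
    rw [← map_lt_map_iff e, hk]
    refine lt_of_le_of_lt hx ?_
    rw [exp_lt_exp]
    omega
  · obtain ⟨x, hx⟩ := exists_intValuation_eq_exp (K := E) (-(n : ℤ))
    refine ⟨valuation E x, ?_, fun y hy => ?_⟩
    · intro h0
      rw [intValuation_apply, h0, map_zero] at hx
      exact exp_ne_zero hx.symm
    · change intValuation E y ≤ _
      rw [← hx, intValuation_le_iff]
      exact le_of_lt hy

theorem isOpen_intValuation_ball (k : ℤ) : IsOpen {x : E | intValuation E x ≤ exp k} := by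
  rw [isOpen_iff_mem_nhds]
  intro x hx
  have h1 : {y : E | intValuation E y ≤ exp (-((-k).toNat : ℤ))} ∈ nhds 0 :=
    (intValuation_hasBasis_nhds_zero E).mem_of_mem trivial
  have h2 : (fun y => y - x) ⁻¹' {y : E | intValuation E y ≤ exp (-((-k).toNat : ℤ))} ∈ nhds x := by
    have : Continuous fun y : E => y - x := by fun_prop
    exact this.continuousAt.preimage_mem_nhds (by simpa using h1)
  refine Filter.mem_of_superset h2 fun y hy => ?_
  have h3 : y = (y - x) + x := by ring
  change intValuation E y ≤ _
  rw [h3]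
  refine (Valuation.map_add _ _ _).trans (max_le (le_trans hy ?_) hx)
  rw [exp_le_exp]
  omega

theorem isClosed_intValuation_ball (k : ℤ) : IsClosed {x : E | intValuation E x ≤ exp k} := by
  rw [← isOpen_compl_iff, isOpen_iff_mem_nhds]
  intro x hx
  have h2 : (fun y => y - x) ⁻¹' {y : E | intValuation E y ≤ exp k} ∈ nhds x := by
    have : Continuous fun y : E => y - x := by fun_prop
    refine this.continuousAt.preimage_mem_nhds ?_
    rw [sub_self]
    exact (isOpen_intValuation_ball E k).mem_nhds (by simp)
  refine Filter.mem_of_superset h2 fun y hy => ?_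
  contrapose! hx
  have h3 : x = y - (y - x) := by ring
  rw [Set.notMem_compl_iff] at hx ⊢
  change intValuation E x ≤ _
  rw [h3]
  exact (Valuation.map_sub _ _ _).trans (max_le hx hy)

theorem isCompact_intValuation_ball (k : ℤ) : IsCompact {x : E | intValuation E x ≤ exp k} := by
  obtain ⟨x, hx⟩ := exists_intValuation_eq_exp (K := E) k
  have h := IsNonarchimedeanLocalField.isCompact_closedBall E (valuation E x)
  simpa only [← intValuation_le_iff, hx] using h

instance localField_t2Space : T2Space E := by
  have : IsClosed ({0} : Set E) := by
    have : ({0} : Set E) = ⋂ n : ℕ, {x | intValuation E x ≤ exp (-(n : ℤ))} := by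
      ext x
      simp only [Set.mem_singleton_iff, Set.mem_iInter]
      refine ⟨fun h n => by simp [h], fun h => ?_⟩
      by_contra hx
      obtain ⟨k, hk⟩ := (intValuation E).exists_eq_exp_neg hx
      have := h (k.toNat + 1)
      rw [Set.mem_ofPred_eq, hk, exp_le_exp] at this
      omega
    rw [this]
    exact isClosed_iInter fun n => isClosed_intValuation_ball E _
  have : T1Space E := IsTopologicalAddGroup.t1Space E this
  infer_instance

instance localField_sigmaCompactSpace : SigmaCompactSpace E := by
  refine ⟨⟨fun n : ℕ => {x | intValuation E x ≤ exp (n : ℤ)},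
    fun n => isCompact_intValuation_ball E _, ?_⟩⟩
  rw [Set.eq_univ_iff_forall]
  intro x
  rw [Set.mem_iUnion]
  by_cases hx : x = 0
  · exact ⟨0, by simp [hx]⟩
  obtain ⟨k, hk⟩ := (intValuation E).exists_eq_exp_neg hx
  refine ⟨(-k).toNat, ?_⟩
  rw [Set.mem_ofPred_eq, hk, exp_le_exp]
  omega

/-- Passes to the unitary groups, where it is used for the Borel structure on products and for the
existence of quotient measures. -/
instance localField_secondCountableTopology : SecondCountableTopology E := by
  let _ := IsTopologicalAddGroup.rightUniformSpace E
  have : IsUniformAddGroup E := isUniformAddGroup_of_addCommGroup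
  have : (nhds (0 : E)).IsCountablyGenerated :=
    (intValuation_hasBasis_nhds_zero E).isCountablyGenerated
  have := IsUniformAddGroup.uniformity_countably_generated (α := E)
  let _ := TopologicalSpace.pseudoMetrizableSpacePseudoMetric E
  exact EMetric.secondCountable_of_sigmaCompact E

instance matrix_localField_t2Space (m n : Type*) : T2Space (Matrix m n E) :=
  inferInstanceAs (T2Space (m → n → E))

instance matrix_localField_secondCountableTopology (m n : Type*) [Finite m] [Finite n] :
    SecondCountableTopology (Matrix m n E) :=
  inferInstanceAs (SecondCountableTopology (m → n → E))

instance matrix_localField_locallyCompactSpace (m n : Type*) [Finite m] [Finite n] :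
    LocallyCompactSpace (Matrix m n E) :=
  inferInstanceAs (LocallyCompactSpace (m → n → E))

instance gl_localField_secondCountableTopology (n : Type*) [Fintype n] [DecidableEq n] :
    SecondCountableTopology (GL n E) :=
  have : SecondCountableTopology (Matrix n n E)ᵐᵒᵖ :=
    MulOpposite.opHomeomorph.symm.secondCountableTopology
  Units.isEmbedding_embedProduct.isInducing.secondCountableTopology

theorem isClosed_isIntegralMatrix (n : Type*) :
    IsClosed {X : Matrix n n E | IsIntegralMatrix (intValuation E) X} := by
  have : {X : Matrix n n E | IsIntegralMatrix (intValuation E) X} =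
      ⋂ i, ⋂ j, {X | intValuation E (X i j) ≤ exp 0} := by
    ext X; simp [IsIntegralMatrix]
  rw [this]
  exact isClosed_iInter fun i => isClosed_iInter fun j =>
    (isClosed_intValuation_ball E 0).preimage (by fun_prop)

theorem isOpen_isIntegralMatrix (n : Type*) [Finite n] :
    IsOpen {X : Matrix n n E | IsIntegralMatrix (intValuation E) X} := by
  have : {X : Matrix n n E | IsIntegralMatrix (intValuation E) X} =
      ⋂ i, ⋂ j, {X | intValuation E (X i j) ≤ exp 0} := by
    ext X; simp [IsIntegralMatrix]
  rw [this]
  exact isOpen_iInter_of_finite fun i => isOpen_iInter_of_finite fun j =>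
    (isOpen_intValuation_ball E 0).preimage (by fun_prop)

theorem isCompact_isIntegralMatrix (n : Type*) :
    IsCompact {X : Matrix n n E | IsIntegralMatrix (intValuation E) X} := by
  have h := isCompact_univ_pi (X := fun _ : n => n → E) fun _ =>
    isCompact_univ_pi (X := fun _ : n => E) fun _ => isCompact_intValuation_ball E 0
  have he : {X : Matrix n n E | IsIntegralMatrix (intValuation E) X} =
      Set.pi (α := fun _ : n => n → E) Set.univ fun _ => Set.pi (α := fun _ : n => E) Set.univ
        fun _ => {x : E | intValuation E x ≤ exp 0} := by
    apply Set.ext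
    intro X
    simp only [exp_zero]
    exact ⟨fun h i _ j _ => h i j, fun h i j => h i trivial j trivial⟩
  rw [he]
  exact h

variable {E}
variable {n : Type*} [Fintype n] [DecidableEq n]

omit [Fintype n] [DecidableEq n] in
theorem mem_stdLattice_iff {v : n → E} :
    v ∈ stdLattice E n ↔ ∀ i, intValuation E (v i) ≤ 1 :=
  forall_congr' fun _ => mem_integer_iff

theorem mem_endLattice_iff {X : Matrix n n E} :
    X ∈ endLattice E n ↔ IsIntegralMatrix (intValuation E) X := by
  constructor
  · intro h i j
    have h1 := mem_stdLattice_iff.1 (h (Pi.single j 1) (mem_stdLattice_iff.2 fun k => by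
      by_cases hk : k = j
      · subst hk; simp
      · simp [hk])) i
    simpa using h1
  · intro h w hw
    rw [mem_stdLattice_iff] at hw ⊢
    intro i
    refine Valuation.map_sum_le _ fun j _ => ?_
    rw [map_mul]
    exact mul_le_one' (h i j) (hw j)

theorem isSchwartz_endIndicator : IsSchwartz (endIndicator E n) := by
  have hE : endLattice E n = {X | IsIntegralMatrix (intValuation E) X} :=
    Set.ext fun X => mem_endLattice_iff
  have hc : IsClopen (endLattice E n) := by
    rw [hE]
    exact ⟨isClosed_isIntegralMatrix E n, isOpen_isIntegralMatrix E n⟩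
  refine ⟨?_, HasCompactSupport.intro (K := endLattice E n) ?_ fun x hx =>
    Set.indicator_of_notMem hx _⟩
  · exact (LocallyConstant.charFn ℂ hc).isLocallyConstant
  · rw [hE]
    exact isCompact_isIntegralMatrix E n

theorem HermSpace.mem_latticeStab_iff {F : Type*} [Field F] [Algebra F E] {σ : E ≃ₐ[F] E}
    {V : HermSpace σ n} {g : V.U} :
    g ∈ V.latticeStab ↔ IsIntegralMatrix (intValuation E) ((g : GL n E) : Matrix n n E) ∧
      IsIntegralMatrix (intValuation E) (((g : GL n E)⁻¹ : GL n E) : Matrix n n E) := by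
  rw [← mem_endLattice_iff, ← mem_endLattice_iff]
  rfl


end Topology

/-! ### Closedness of unitary groups and compactness of lattice stabilizers. -/

section Unitary

open WithZero

variable {F E : Type*} [Field F] [Field E] [ValuativeRel E] [TopologicalSpace E]
  [IsNonarchimedeanLocalField E] [Algebra F E] {σ : E ≃ₐ[F] E}
variable {n : Type*} [Fintype n] [DecidableEq n]

theorem continuous_of_intValuation_eq (hv : ∀ z, intValuation E (σ z) = intValuation E z) :
    Continuous σ := by
  refine continuous_of_continuousAt_zero (σ : E →+ E) ?_
  have h := intValuation_hasBasis_nhds_zero E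
  change Filter.Tendsto σ (nhds 0) (nhds (σ 0))
  rw [map_zero, h.tendsto_iff h]
  exact fun k _ => ⟨k, trivial, fun x hx => by simpa only [Set.mem_ofPred_eq, hv] using hx⟩

instance HermSpace.secondCountableTopology_U (V : HermSpace σ n) : SecondCountableTopology V.U :=
  TopologicalSpace.Subtype.secondCountableTopology (V.U : Set (GL n E))

theorem HermSpace.isClosed_U (hv : ∀ z, intValuation E (σ z) = intValuation E z)
    (V : HermSpace σ n) : IsClosed (V.U : Set (GL n E)) := by
  have hσ := continuous_of_intValuation_eq hv
  have h1 : Continuous fun g : GL n E => ((g : Matrix n n E).map σ)ᵀ * V.gram * (g : Matrix n n E) := by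
    have h2 : Continuous fun g : GL n E => (g : Matrix n n E) := Units.continuous_val
    exact (((h2.matrix_map hσ).matrix_transpose).mul continuous_const).mul h2
  exact isClosed_singleton.preimage h1

/-- Reduces compactness in `U(V)` to a condition on `g` and `g⁻¹` simultaneously. -/
theorem HermSpace.isClosedEmbedding_U (hv : ∀ z, intValuation E (σ z) = intValuation E z)
    (V : HermSpace σ n) :
    Topology.IsClosedEmbedding fun g : V.U => Units.embedProduct (Matrix n n E) (g : GL n E) :=
  Units.isClosedEmbedding_embedProduct.comp (V.isClosed_U hv).isClosedEmbedding_subtypeVal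

theorem HermSpace.locallyCompactSpace_U (hv : ∀ z, intValuation E (σ z) = intValuation E z)
    (V : HermSpace σ n) : LocallyCompactSpace V.U := by
  have : LocallyCompactSpace (Matrix n n E)ᵐᵒᵖ :=
    MulOpposite.opHomeomorph.symm.isClosedEmbedding.locallyCompactSpace
  exact (V.isClosedEmbedding_U hv).locallyCompactSpace

/-- The elements of `U(V)` that stabilize a given lattice form a compact set. -/
theorem HermSpace.isCompact_lattice_stabilizer
    (hv : ∀ z, intValuation E (σ z) = intValuation E z) (V : HermSpace σ n)
    {R R' : Matrix n n E} (hR : R * R' = 1) :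
    IsCompact {g : V.U | IsIntegralMatrix (intValuation E) (R' * ((g : GL n E) : Matrix n n E) * R) ∧
      IsIntegralMatrix (intValuation E)
        (R' * (((g : GL n E)⁻¹ : GL n E) : Matrix n n E) * R)} := by
  have hR' : R' * R = 1 := mul_eq_one_comm.1 hR
  have hK : IsCompact {X : Matrix n n E | IsIntegralMatrix (intValuation E) (R' * X * R)} := by
    have h := (isCompact_isIntegralMatrix E n).image
      (f := fun X => R * X * R') (by fun_prop)
    convert h using 1
    ext X
    constructor
    · intro hX
      refine ⟨_, hX, ?_⟩
      calc R * (R' * X * R) * R' = (R * R') * X * (R * R') := by noncomm_ring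
        _ = X := by rw [hR]; simp
    · rintro ⟨Y, hY, rfl⟩
      have : R' * (R * Y * R') * R = Y := by
        calc R' * (R * Y * R') * R = (R' * R) * Y * (R' * R) := by noncomm_ring
          _ = Y := by rw [hR']; simp
      change IsIntegralMatrix _ (R' * (R * Y * R') * R)
      rw [this]
      exact hY
  convert (V.isClosedEmbedding_U hv).isCompact_preimage
    (hK.prod (hK.image MulOpposite.continuous_op)) using 1
  ext g
  constructor
  · exact fun h => ⟨h.1, _, h.2, rfl⟩
  · rintro ⟨h1, Y, h2, h3⟩
    obtain rfl := MulOpposite.op_injective h3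
    exact ⟨h1, h2⟩

end Unitary
end

/-! ### Indexing the unimodular lattices by radius and gluing class. -/

noncomputable section
section Cells

open WithZero

variable {F E : Type*} [Field F] [Field E] [Algebra F E] {σ : E ≃ₐ[F] E}

namespace UnramifiedQuadratic

variable {v : Valuation E ℤᵐ⁰} {q : ℕ} (D : UnramifiedQuadratic σ v q)

/-- Index set of the unimodular lattices in a plane that is split by a frame of type `e`. -/
abbrev CellIndex : Type _ := Σ k : ℕ, normOne σ ⧸ D.level k

/-- The coordinates `A` of a basis, with respect to a frame of type `e`, span the lattice with
index `i`. -/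
def InCell (e : ℕ) (i : D.CellIndex) (A : Matrix (Fin 2) (Fin 2) E) : Prop :=
  i.1 % 2 = e ∧
    IsIntegralMatrix v (D.glueInv (((i.1 : ℤ) - e) / 2) (((i.1 : ℤ) + e) / 2) (D.rep i.2) * A)

variable {D} {e : ℕ} {A₁ A₂ M : Matrix (Fin 2) (Fin 2) E}

theorem v_det_glueInv_mul {m s : ℤ} {z : E} {A : Matrix (Fin 2) (Fin 2) E}
    (hA : v A.det = exp (s - m)) : v (D.glueInv m s z * A).det = 1 := by
  rw [Matrix.det_mul, D.det_glueInv, map_mul, D.v_ϖE_zpow, hA, ← exp_add]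
  simp

/-- Each basis differs from the glued basis of its cell by a unimodular matrix, so inclusion may be
tested on glued bases. The common parity of the radii makes `n` an integer, and `e` drops out of the
inequalities. -/
theorem isIntegralMatrix_iff_of_inCell {i₁ i₂ : D.CellIndex} (h₁ : D.InCell e i₁ A₁)
    (h₂ : D.InCell e i₂ A₂) (hA₁ : v A₁.det = exp (e : ℤ)) (hA₂ : v A₂.det = exp (e : ℤ))
    {n : ℕ} (hn : 2 * n = i₁.1 + i₂.1) (ta tb : E) :
    IsIntegralMatrix v (A₁⁻¹ * Matrix.diagonal ![ta, tb] * A₂) ↔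
      v ta ≤ exp ((i₁.1 : ℤ) - n) ∧ v tb ≤ exp ((n : ℤ) - i₁.1) ∧
        v (D.rep i₂.2 * tb - D.rep i₁.2 * ta) ≤ exp (-(n : ℤ)) := by
  obtain ⟨he₁, h₁⟩ := h₁
  obtain ⟨he₂, h₂⟩ := h₂
  obtain ⟨k₁, c₁⟩ := i₁
  obtain ⟨k₂, c₂⟩ := i₂
  simp only at he₁ he₂ h₁ h₂ hn ⊢
  set m₁ : ℤ := ((k₁ : ℤ) - e) / 2 with hm₁
  set s₁ : ℤ := ((k₁ : ℤ) + e) / 2 with hs₁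
  set m₂ : ℤ := ((k₂ : ℤ) - e) / 2 with hm₂
  set s₂ : ℤ := ((k₂ : ℤ) + e) / 2 with hs₂
  have e1 : s₁ - m₁ = e := by omega
  have e2 : s₂ - m₂ = e := by omega
  have hd₁ : v (D.glueInv m₁ s₁ (D.rep c₁) * A₁).det = 1 := v_det_glueInv_mul (by rw [hA₁, e1])
  have hd₂ : v (D.glueInv m₂ s₂ (D.rep c₂) * A₂).det = 1 := v_det_glueInv_mul (by rw [hA₂, e2])
  have hkey := UnramifiedQuadratic.isIntegralMatrix_mul_mul_iff
    (X := D.glueInv m₁ s₁ (D.rep c₁) * Matrix.diagonal ![ta, tb] * D.glue m₂ s₂ (D.rep c₂))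
    h₁ hd₁ h₂ hd₂
  have hg₁ := D.glue_mul_glueInv m₁ s₁ (D.rep c₁)
  have hg₁' := D.glueInv_mul_glue m₁ s₁ (D.rep c₁)
  have hg₂ := D.glue_mul_glueInv m₂ s₂ (D.rep c₂)
  have hinv : (D.glueInv m₁ s₁ (D.rep c₁) * A₁)⁻¹ = A₁⁻¹ * D.glue m₁ s₁ (D.rep c₁) := by
    rw [Matrix.mul_inv_rev, Matrix.inv_eq_right_inv hg₁']
  have hmat : (D.glueInv m₁ s₁ (D.rep c₁) * A₁)⁻¹ *
      (D.glueInv m₁ s₁ (D.rep c₁) * Matrix.diagonal ![ta, tb] * D.glue m₂ s₂ (D.rep c₂)) *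
      (D.glueInv m₂ s₂ (D.rep c₂) * A₂) = A₁⁻¹ * Matrix.diagonal ![ta, tb] * A₂ := by
    rw [hinv]
    calc _ = A₁⁻¹ * (D.glue m₁ s₁ (D.rep c₁) * D.glueInv m₁ s₁ (D.rep c₁)) *
          Matrix.diagonal ![ta, tb] * (D.glue m₂ s₂ (D.rep c₂) * D.glueInv m₂ s₂ (D.rep c₂)) *
          A₂ := by noncomm_ring
      _ = _ := by rw [hg₁, hg₂, mul_one, mul_one]
  rw [hmat] at hkey
  rw [hkey, D.isIntegralMatrix_glue_iff]
  have a1 : s₁ - s₂ = (k₁ : ℤ) - n := by omega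
  have a2 : m₂ - m₁ = (n : ℤ) - k₁ := by omega
  have a3 : m₁ + s₂ = n := by omega
  rw [a1, a2, a3]

/-- Applied to the identity map, the inclusion criterion forces equal radii and congruent gluing
elements. -/
theorem InCell.unique {i₁ i₂ : D.CellIndex} (h₁ : D.InCell e i₁ A₁) (h₂ : D.InCell e i₂ A₁)
    (hA₁ : v A₁.det = exp (e : ℤ)) : i₁ = i₂ := by
  obtain ⟨n, hn⟩ : ∃ n, 2 * n = i₁.1 + i₂.1 :=
    ⟨(i₁.1 + i₂.1) / 2, by have := h₁.1; have := h₂.1; omega⟩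
  have hu : IsUnit A₁.det := isUnit_iff_ne_zero.2 fun h => by
    rw [h, map_zero] at hA₁
    exact exp_ne_zero hA₁.symm
  have h1 := (isIntegralMatrix_iff_of_inCell h₁ h₂ hA₁ hA₁ hn 1 1).1 (by
    rw [diagonal_two_eq_one, mul_one, Matrix.nonsing_inv_mul _ hu]
    intro i j
    by_cases hij : i = j
    · subst hij; simp
    · simp [hij])
  obtain ⟨k₁, c₁⟩ := i₁
  obtain ⟨k₂, c₂⟩ := i₂
  simp only [map_one, mul_one, ← exp_zero (M := ℤ), exp_le_exp] at h1 hn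
  have : k₂ = k₁ := by omega
  subst this
  have : n = k₂ := by omega
  subst this
  have h3 := D.inv_mul_mem_level.2 h1.2.2
  rw [← QuotientGroup.eq, QuotientGroup.out_eq', QuotientGroup.out_eq'] at h3
  rw [h3]

theorem exists_inCell (he : e ≤ 1) (hMi : IsIntegralMatrix v M) (hM : v M.det = 1)
    (hA : D.ϖE ^ (e : ℤ) • (conjT σ A₁ * A₁) = M) : ∃ i, D.InCell e i A₁ := by
  obtain ⟨s, k, z, hk, h⟩ := D.exists_glueInv_mul hMi hM hA
  refine ⟨⟨k, QuotientGroup.mk z⟩, by simp only; omega, ?_⟩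
  have h1 : ((k : ℤ) - e) / 2 = s - e := by omega
  have h2 : ((k : ℤ) + e) / 2 = s := by omega
  simp only [h1, h2]
  apply h
  rw [← D.inv_mul_mem_level, ← QuotientGroup.eq, QuotientGroup.out_eq']

theorem exists_of_cellIndex {i : D.CellIndex} (hi : i.1 % 2 = e) (hMi : IsIntegralMatrix v M)
    (hM : v M.det = 1) (hH : conjT σ M = M) :
    ∃ A, D.ϖE ^ (e : ℤ) • (conjT σ A * A) = M ∧ D.InCell e i A := by
  obtain ⟨A, h1, h2⟩ := D.exists_isIntegralMatrix_glueInv_mul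
    (m := ((i.1 : ℤ) - e) / 2) (s := ((i.1 : ℤ) + e) / 2) (by omega) hMi hM hH (Quotient.out i.2)
  refine ⟨A, ?_, hi, h2⟩
  rwa [show ((i.1 : ℤ) + e) / 2 - ((i.1 : ℤ) - e) / 2 = e by omega] at h1

/-- Two bases of the same lattice differ by a unimodular matrix. -/
theorem InCell.iff_isIntegralMatrix {i : D.CellIndex} (h₁ : D.InCell e i A₁)
    (hA₁ : v A₁.det = exp (e : ℤ)) (hA₂ : v A₂.det = exp (e : ℤ)) :
    D.InCell e i A₂ ↔ IsIntegralMatrix v (A₁⁻¹ * A₂) := by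
  constructor
  · intro h₂
    have h := isIntegralMatrix_iff_of_inCell h₁ h₂ hA₁ hA₂ (n := i.1) (by ring) 1 1
    rw [diagonal_two_eq_one, mul_one] at h
    exact h.2 (by simp)
  · intro h
    have hu : IsUnit A₁.det := isUnit_iff_ne_zero.2 fun h => by
      rw [h, map_zero] at hA₁
      exact exp_ne_zero hA₁.symm
    refine ⟨h₁.1, ?_⟩
    have h2 := h₁.2.mul h
    rwa [Matrix.mul_assoc, Matrix.mul_nonsing_inv_cancel_left _ _ hu] at h2

end UnramifiedQuadratic
end Cells
end

/-! ### Orbital integrals as numbers of pairs of lattices. -/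

noncomputable section
section OrbitalVolume

/-- If the stabilizer is compact, an orbital integral is an integral over the group. -/
theorem orbitalIntegral_eq_integral {G X : Type*} [Group G] [TopologicalSpace G]
    [IsTopologicalGroup G] [SecondCountableTopology G] [T2Space G]
    [MeasurableSpace G] [BorelSpace G] [MulAction G X] (μ : Measure G) [μ.IsHaarMeasure]
    [SFinite μ] (x : X) [CompactSpace (MulAction.stabilizer G x)] {f : X → ℂ}
    (hf : Measurable fun g : G => f (g⁻¹ • x)) :
    orbitalIntegral μ x f = ∫ g, f (g⁻¹ • x) ∂μ := by
  have hν : quotientMeasure μ x = μ.map (fun g => (Quotient.mk _ g : StabQuot G x)) :=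
    (isQuotientMeasure_iff μ x _).1
      (Classical.epsilon_spec ⟨_, (isQuotientMeasure_iff μ x _).2 rfl⟩)
  -- The chosen representative differs from `g` by a stabilizer element on the left, which
  -- disappears when its inverse is applied to `x`.
  have hfo : ∀ g : G, f ((Quotient.out (Quotient.mk _ g : StabQuot G x))⁻¹ • x) = f (g⁻¹ • x) := by
    intro g
    have h1 : (QuotientGroup.rightRel (MulAction.stabilizer G x))
        (Quotient.out (Quotient.mk _ g : StabQuot G x)) g := Quotient.exact (Quotient.out_eq _)
    rw [QuotientGroup.rightRel_apply, MulAction.mem_stabilizer_iff, mul_smul] at h1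
    rw [eq_inv_smul_iff.2 h1]
  have hm : Measurable fun q : StabQuot G x => f ((Quotient.out q)⁻¹ • x) := by
    apply measurable_from_quotient.2
    simp only [Function.comp_def]
    change Measurable fun g => f ((Quotient.out (Quotient.mk _ g : StabQuot G x))⁻¹ • x)
    simpa only [hfo] using hf
  rw [orbitalIntegral, hν, integral_map measurable_quotient_mk''.aemeasurable
    hm.aestronglyMeasurable]
  simp only [hfo]

open WithZero

variable {F E : Type*} [Field F] [Field E] [ValuativeRel E] [TopologicalSpace E]
  [IsNonarchimedeanLocalField E] [Algebra F E] {σ : E ≃ₐ[F] E}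
variable {n : Type*} [Fintype n] [DecidableEq n]

omit [Algebra F E] [Field F] in
theorem IsIntegralMatrix.det_le_one {X : Matrix n n E}
    (hX : IsIntegralMatrix (intValuation E) X) : intValuation E X.det ≤ 1 := by
  rw [Matrix.det_apply]
  refine Valuation.map_sum_le _ fun τ _ => ?_
  rw [Units.smul_def, zsmul_eq_mul, map_mul, map_prod]
  refine mul_le_one' ?_ (Finset.prod_le_one' fun i _ => hX _ _)
  rcases Int.units_eq_one_or (Equiv.Perm.sign τ) with h | h <;> simp [h]

theorem HermSpace.IsSelfDual.isIntegralMatrix {V : HermSpace σ n} (h : V.IsSelfDual) :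
    IsIntegralMatrix (intValuation E) V.gram := by
  intro i j
  have hs : ∀ k : n, (Pi.single k 1 : n → E) ∈ stdLattice E n := fun k =>
    mem_stdLattice_iff.2 fun l => by
      by_cases hl : l = k
      · subst hl; simp
      · simp [hl]
  have h1 := mem_integer_iff.1 ((h _).1 (hs i) _ (hs j))
  have h2 : V.form (Pi.single i 1) (Pi.single j 1) = V.gram i j := by
    have h3 : (fun k => σ ((Pi.single i 1 : n → E) k)) = Pi.single i 1 := by
      ext k
      by_cases hk : k = i
      · subst hk; simp
      · simp [hk]
    rw [HermSpace.form, h3]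
    simp
  rwa [h2] at h1

theorem HermSpace.IsSelfDual.v_det (hv : ∀ z, intValuation E (σ z) = intValuation E z)
    {V : HermSpace σ n} (h : V.IsSelfDual) : intValuation E V.gram.det = 1 := by
  have hinv : IsIntegralMatrix (intValuation E) V.gram⁻¹ := by
    intro j i
    -- The rows of the inverse Gram matrix, conjugated because the form is conjugate linear in its
    -- first variable, are the dual basis; self-duality puts it inside the lattice. So the Gram
    -- matrix and its inverse both have integral determinant.
    have h1 : (fun i => σ.symm (V.gram⁻¹ j i)) ∈ stdLattice E n := by
      rw [h]
      intro w hw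
      have h2 : V.form (fun i => σ.symm (V.gram⁻¹ j i)) w = w j := by
        rw [HermSpace.form, Matrix.dotProduct_mulVec]
        have h3 : (fun i => σ (σ.symm (V.gram⁻¹ j i))) ᵥ* V.gram = Pi.single j 1 := by
          ext i
          have h4 := congrFun (congrFun (Matrix.nonsing_inv_mul _ V.nondeg) j) i
          simpa [Matrix.vecMul, Matrix.mul_apply, dotProduct, Matrix.one_apply, Pi.single_apply,
            eq_comm] using h4
        rw [h3]
        simp
      rw [h2]
      exact hw j
    have h5 := mem_stdLattice_iff.1 h1 i
    rwa [← hv, AlgEquiv.apply_symm_apply] at h5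
  have h1 := h.isIntegralMatrix.det_le_one
  have h2 := hinv.det_le_one
  have h3 : intValuation E V.gram.det * intValuation E V.gram⁻¹.det = 1 := by
    rw [← map_mul, ← Matrix.det_mul, Matrix.mul_nonsing_inv _ V.nondeg, Matrix.det_one, map_one]
  refine le_antisymm h1 ?_
  rw [← h3]
  exact mul_le_of_le_one_right' h2

theorem HermSpace.isOpen_latticeStab (V : HermSpace σ n) : IsOpen V.latticeStab := by
  have he : V.latticeStab =
      {g : V.U | IsIntegralMatrix (intValuation E) ((g : GL n E) : Matrix n n E)} ∩
      {g : V.U | IsIntegralMatrix (intValuation E) (((g : GL n E)⁻¹ : GL n E) : Matrix n n E)} :=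
    Set.ext fun g => V.mem_latticeStab_iff
  rw [he]
  exact ((isOpen_isIntegralMatrix E n).preimage
    (Units.continuous_val.comp continuous_subtype_val)).inter
    ((isOpen_isIntegralMatrix E n).preimage
    (Units.continuous_val.comp (continuous_subtype_val.inv)))

theorem HermSpace.sigmaFinite_of_isUnitHaar (hv : ∀ z, intValuation E (σ z) = intValuation E z)
    {V : HermSpace σ n} {μ : Measure V.U} (hμ : V.IsUnitHaar μ) : SigmaFinite μ := by
  have := V.locallyCompactSpace_U hv
  have := hμ.1
  infer_instance

variable {V : HermSpace σ (Fin 2)} {q : ℕ} {D : UnramifiedQuadratic σ (intValuation E) q}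

/-- The orbital integral of the indicator function of `End(Λ)` is a volume. -/
theorem orbitalIntegral_endIndicator (hv : ∀ z, intValuation E (σ z) = intValuation E z)
    {μ : Measure V.U} (hμ : V.IsUnitHaar μ) (x : Matrix (Fin 2) (Fin 2) E)
    [CompactSpace (MulAction.stabilizer (V.U × V.U) x)] :
    orbitalIntegral (μ.prod μ) x (endIndicator E (Fin 2)) =
      (((μ.prod μ).real {g | IsIntegralMatrix (intValuation E)
        ((((g.1⁻¹ : V.U) : GL (Fin 2) E) : Matrix (Fin 2) (Fin 2) E) * x *
          ((g.2 : GL (Fin 2) E) : Matrix (Fin 2) (Fin 2) E))} : ℝ) : ℂ) := by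
  have := V.locallyCompactSpace_U hv
  have := hμ.1
  set S := {g : V.U × V.U | IsIntegralMatrix (intValuation E)
        ((((g.1⁻¹ : V.U) : GL (Fin 2) E) : Matrix (Fin 2) (Fin 2) E) * x *
          ((g.2 : GL (Fin 2) E) : Matrix (Fin 2) (Fin 2) E))} with hS
  have hSm : MeasurableSet S := by
    refine ((isOpen_isIntegralMatrix E (Fin 2)).preimage ?_).measurableSet
    have h1 : Continuous fun g : V.U => ((g : GL (Fin 2) E) : Matrix (Fin 2) (Fin 2) E) :=
      Units.continuous_val.comp continuous_subtype_val
    exact ((h1.comp continuous_fst.inv).mul continuous_const).mul (h1.comp continuous_snd)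
  have hfun : (fun g : V.U × V.U => endIndicator E (Fin 2) (g⁻¹ • x)) = S.indicator 1 := by
    funext g
    have h1 : g⁻¹ • x = (((g.1⁻¹ : V.U) : GL (Fin 2) E) : Matrix (Fin 2) (Fin 2) E) * x *
        ((g.2 : GL (Fin 2) E) : Matrix (Fin 2) (Fin 2) E) := by
      rw [smul_hom_eq]
      simp
    have h2 : g⁻¹ • x ∈ endLattice E (Fin 2) ↔ g ∈ S := by
      rw [mem_endLattice_iff, h1]
      rfl
    by_cases hg : g ∈ S
    · rw [Set.indicator_of_mem hg, endIndicator, Set.indicator_of_mem (h2.2 hg)]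
      rfl
    · rw [Set.indicator_of_notMem hg, endIndicator, Set.indicator_of_notMem (mt h2.1 hg)]
  rw [orbitalIntegral_eq_integral]
  · rw [hfun]
    change ∫ g, S.indicator (fun _ => (1 : ℂ)) g ∂(μ.prod μ) = _
    rw [integral_indicator_const _ hSm]
    simp
  · rw [hfun]
    exact measurable_one.indicator hSm


namespace UnramifiedQuadratic

variable {ca cb : F} {e : ℕ} {x P P' : Matrix (Fin 2) (Fin 2) E}

/-- The frame coordinates of a translate of the standard basis keep the Gram matrix of `V`, so the
classification of lattices applies to them. -/
theorem gram_of_mem_U (hP : P * P' = 1) (hg : conjT σ P * V.gram * P = D.ϖE ^ (e : ℤ) • 1)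
    (g : V.U) : D.ϖE ^ (e : ℤ) • (conjT σ (P' * ((g : GL (Fin 2) E) : Matrix (Fin 2) (Fin 2) E)) *
      (P' * ((g : GL (Fin 2) E) : Matrix (Fin 2) (Fin 2) E))) = V.gram := by
  set γ : Matrix (Fin 2) (Fin 2) E := ((g : GL (Fin 2) E) : Matrix (Fin 2) (Fin 2) E) with hγ
  have h1 : conjT σ P' * conjT σ P = 1 := by rw [← conjT_mul, hP, conjT_one]
  have h2 : D.ϖE ^ (e : ℤ) • (conjT σ (P' * γ) * (P' * γ)) =
      conjT σ (P' * γ) * (D.ϖE ^ (e : ℤ) • 1) * (P' * γ) := by simp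
  rw [h2, ← hg, conjT_mul]
  calc _ = conjT σ γ * (conjT σ P' * conjT σ P) * V.gram * (P * P') * γ := by noncomm_ring
    _ = conjT σ γ * V.gram * γ := by rw [h1, hP, mul_one, mul_one]
    _ = V.gram := HermSpace.mem_U_iff.1 g.2

theorem v_det_of_mem_U (hV : intValuation E V.gram.det = 1) (hP : P * P' = 1)
    (hg : conjT σ P * V.gram * P = D.ϖE ^ (e : ℤ) • 1) (g : V.U) : intValuation E
      (P' * ((g : GL (Fin 2) E) : Matrix (Fin 2) (Fin 2) E)).det = exp (e : ℤ) :=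
  D.v_det_of_conjT_mul hV (gram_of_mem_U hP hg g)

/-- Each lattice is stabilized by a conjugate of the stabilizer of the standard lattice. -/
theorem measurableSet_and_measure_cell {μ : Measure V.U} (hμ : V.IsUnitHaar μ)
    (hVi : IsIntegralMatrix (intValuation E) V.gram)
    (hV : intValuation E V.gram.det = 1) (hP : P * P' = 1)
    (hg : conjT σ P * V.gram * P = D.ϖE ^ (e : ℤ) • 1) {i : D.CellIndex} (hi : i.1 % 2 = e) :
    MeasurableSet {g : V.U | D.InCell e i
      (P' * ((g : GL (Fin 2) E) : Matrix (Fin 2) (Fin 2) E))} ∧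
    μ {g : V.U | D.InCell e i (P' * ((g : GL (Fin 2) E) : Matrix (Fin 2) (Fin 2) E))} = 1 := by
  have := hμ.1
  obtain ⟨A, hA, hAi⟩ := exists_of_cellIndex hi hVi hV V.conjT_gram
  have hP' : P' * P = 1 := mul_eq_one_comm.1 hP
  have hAd : intValuation E A.det = exp (e : ℤ) := D.v_det_of_conjT_mul hV hA
  have hPAU : conjT σ (P * A) * V.gram * (P * A) = V.gram := by
    rw [conjT_mul]
    calc _ = conjT σ A * (conjT σ P * V.gram * P) * A := by noncomm_ring
      _ = V.gram := by rw [hg, ← hA]; simp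
  have hdet : (P * A).det ≠ 0 := by
    rw [Matrix.det_mul]
    refine mul_ne_zero (fun h => ?_) (fun h => ?_)
    · have := congrArg Matrix.det hP
      rw [Matrix.det_mul, h, zero_mul, Matrix.det_one] at this
      exact zero_ne_one this
    · rw [h, map_zero] at hAd
      exact exp_ne_zero hAd.symm
  -- A basis in the cell with the Gram matrix of `V` is a point of the unitary group, and the cell
  -- is the left translate by it of the stabilizer of `Λ`.
  set g₀ : V.U := ⟨Matrix.GeneralLinearGroup.mkOfDetNeZero (P * A) hdet,
    HermSpace.mem_U_iff.2 hPAU⟩ with hg₀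
  have hg₀v : ((g₀ : GL (Fin 2) E) : Matrix (Fin 2) (Fin 2) E) = P * A := rfl
  have hPA : A = P' * ((g₀ : GL (Fin 2) E) : Matrix (Fin 2) (Fin 2) E) := by
    rw [hg₀v, ← mul_assoc, hP', one_mul]
  have hset : {g : V.U | D.InCell e i (P' * ((g : GL (Fin 2) E) : Matrix (Fin 2) (Fin 2) E))} =
      (fun g => g₀⁻¹ * g) ⁻¹' V.latticeStab := by
    ext g
    rw [Set.mem_preimage, HermSpace.mem_latticeStab_iff]
    have hgd := v_det_of_mem_U (D := D) hV hP hg g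
    change D.InCell e i _ ↔ _
    rw [hAi.iff_isIntegralMatrix hAd hgd]
    have hcoe : A⁻¹ * (P' * ((g : GL (Fin 2) E) : Matrix (Fin 2) (Fin 2) E)) =
        (((g₀⁻¹ * g : V.U) : GL (Fin 2) E) : Matrix (Fin 2) (Fin 2) E) := by
      rw [hPA, Matrix.mul_inv_rev, Matrix.inv_eq_right_inv hP']
      calc _ = ((g₀ : GL (Fin 2) E) : Matrix (Fin 2) (Fin 2) E)⁻¹ * (P * P') *
            ((g : GL (Fin 2) E) : Matrix (Fin 2) (Fin 2) E) := by noncomm_ring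
        _ = _ := by
          rw [hP, mul_one, ← Matrix.coe_units_inv]
          rfl
    have hd1 : intValuation E (((g₀⁻¹ * g : V.U) : GL (Fin 2) E) :
        Matrix (Fin 2) (Fin 2) E).det = 1 := by
      rw [← hcoe, Matrix.det_mul, Matrix.det_nonsing_inv, Ring.inverse_eq_inv', map_mul, map_inv₀,
        hAd, hgd, inv_mul_cancel₀ exp_ne_zero]
    rw [hcoe]
    -- The determinant is a unit, so integrality of the inverse is automatic.
    refine ⟨fun h => ⟨h, ?_⟩, fun h => h.1⟩
    rw [Matrix.coe_units_inv]
    exact h.inv hd1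
  rw [hset]
  have hm := V.isOpen_latticeStab.measurableSet
  exact ⟨hm.preimage (measurable_const_mul _), by rw [measure_preimage_mul, hμ.2]⟩

/-- The integral points of an orbit, counted by pairs of lattices. -/
theorem volume_integral_points {μ : Measure V.U} [SFinite μ] (hμ : V.IsUnitHaar μ)
    (hVi : IsIntegralMatrix (intValuation E) V.gram)
    (hV : intValuation E V.gram.det = 1) {Q Q' : Matrix (Fin 2) (Fin 2) E} (he : e ≤ 1)
    (hP : P * P' = 1) (hgP : conjT σ P * V.gram * P = D.ϖE ^ (e : ℤ) • 1)
    (hQ : Q * Q' = 1) (hgQ : conjT σ Q * V.gram * Q = D.ϖE ^ (e : ℤ) • 1) {ta tb : E}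
    (hx : x = P * Matrix.diagonal ![ta, tb] * Q') {N : ℕ}
    (hN : ∀ n k c₁ c₂, D.PairCond ta tb n k c₁ c₂ → k ≤ 2 * n → n < N) :
    (μ.prod μ) {g | IsIntegralMatrix (intValuation E)
        ((((g.1⁻¹ : V.U) : GL (Fin 2) E) : Matrix (Fin 2) (Fin 2) E) * x *
          ((g.2 : GL (Fin 2) E) : Matrix (Fin 2) (Fin 2) E))} =
      ((∑ n ∈ Finset.range N, ∑ k ∈ (Finset.range (2 * n + 1)).filter (fun k => k % 2 = e),
        D.pairCount ta tb n k : ℕ) : ℝ≥0∞) := by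
  have := hμ.1
  have hP' : P' * P = 1 := mul_eq_one_comm.1 hP
  set cP : D.CellIndex → Set V.U := fun i => {g | D.InCell e i
    (P' * ((g : GL (Fin 2) E) : Matrix (Fin 2) (Fin 2) E))} with hcP
  set cQ : D.CellIndex → Set V.U := fun i => {g | D.InCell e i
    (Q' * ((g : GL (Fin 2) E) : Matrix (Fin 2) (Fin 2) E))} with hcQ
  have hiff : ∀ (g : V.U × V.U), IsIntegralMatrix (intValuation E)
        ((((g.1⁻¹ : V.U) : GL (Fin 2) E) : Matrix (Fin 2) (Fin 2) E) * x *
          ((g.2 : GL (Fin 2) E) : Matrix (Fin 2) (Fin 2) E)) ↔ IsIntegralMatrix (intValuation E)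
        ((P' * ((g.1 : GL (Fin 2) E) : Matrix (Fin 2) (Fin 2) E))⁻¹ *
          Matrix.diagonal ![ta, tb] *
          (Q' * ((g.2 : GL (Fin 2) E) : Matrix (Fin 2) (Fin 2) E))) := by
    intro g
    have : (((g.1⁻¹ : V.U) : GL (Fin 2) E) : Matrix (Fin 2) (Fin 2) E) =
        ((g.1 : GL (Fin 2) E) : Matrix (Fin 2) (Fin 2) E)⁻¹ := by
      rw [← Matrix.coe_units_inv]; rfl
    rw [Matrix.mul_inv_rev, Matrix.inv_eq_right_inv hP', this, hx]
    simp only [mul_assoc]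
  -- The pairs `(g₁, g₂)` with radii `k` and `2n - k`: a disjoint union of products of cells, each
  -- of volume one.
  set T : (Σ _ : ℕ, ℕ) → Set (V.U × V.U) := fun p =>
    ⋃ c : {c : (normOne σ ⧸ D.level p.2) × (normOne σ ⧸ D.level (2 * p.1 - p.2)) //
      D.PairCond ta tb p.1 p.2 c.1 c.2}, cP ⟨p.2, c.1.1⟩ ×ˢ cQ ⟨2 * p.1 - p.2, c.1.2⟩ with hT
  set I : Finset (Σ _ : ℕ, ℕ) := (Finset.range N).sigma fun n =>
    (Finset.range (2 * n + 1)).filter (fun k => k % 2 = e) with hI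
  have hmem : ∀ {p : Σ _ : ℕ, ℕ}, p ∈ I ↔ p.1 < N ∧ p.2 < 2 * p.1 + 1 ∧ p.2 % 2 = e := by
    intro p
    simp [hI]
  have huP : ∀ {i j : D.CellIndex} {g : V.U}, g ∈ cP i → g ∈ cP j → i = j := fun h1 h2 =>
    InCell.unique h1 h2 (v_det_of_mem_U hV hP hgP _)
  have huQ : ∀ {i j : D.CellIndex} {g : V.U}, g ∈ cQ i → g ∈ cQ j → i = j := fun h1 h2 =>
    InCell.unique h1 h2 (v_det_of_mem_U hV hQ hgQ _)
  have hS : {g : V.U × V.U | IsIntegralMatrix (intValuation E)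
        ((((g.1⁻¹ : V.U) : GL (Fin 2) E) : Matrix (Fin 2) (Fin 2) E) * x *
          ((g.2 : GL (Fin 2) E) : Matrix (Fin 2) (Fin 2) E))} = ⋃ p ∈ I, T p := by
    ext g
    rw [Set.mem_ofPred_eq, hiff]
    simp only [Set.mem_iUnion, hT, Set.mem_prod, exists_prop]
    constructor
    · intro h
      obtain ⟨⟨k₁, c₁⟩, h₁⟩ := exists_inCell he hVi hV (gram_of_mem_U hP hgP g.1)
      obtain ⟨⟨k₂, c₂⟩, h₂⟩ := exists_inCell he hVi hV (gram_of_mem_U hQ hgQ g.2)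
      have e₁ : k₁ % 2 = e := h₁.1
      have e₂ : k₂ % 2 = e := h₂.1
      -- Both radii have the parity of the type, so their sum is even. The bound `k₁ ≤ 2n` keeps the
      -- natural subtraction exact.
      obtain ⟨n, hn⟩ : ∃ n, k₂ = 2 * n - k₁ ∧ k₁ ≤ 2 * n := ⟨(k₁ + k₂) / 2, by omega⟩
      obtain ⟨rfl, hn⟩ := hn
      have hc := (isIntegralMatrix_iff_of_inCell h₁ h₂ (v_det_of_mem_U hV hP hgP _)
        (v_det_of_mem_U hV hQ hgQ _) (n := n) (by simp only; omega) ta tb).1 h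
      exact ⟨⟨n, k₁⟩, hmem.2 ⟨hN n k₁ c₁ c₂ hc hn, by simp only; omega, e₁⟩, ⟨⟨c₁, c₂⟩, hc⟩, h₁, h₂⟩
    · rintro ⟨⟨n, k⟩, hp, ⟨⟨c₁, c₂⟩, hc⟩, h₁, h₂⟩
      obtain ⟨h3, h4, h5⟩ := hmem.1 hp
      simp only at h3 h4 h5 hc h₁ h₂
      exact (isIntegralMatrix_iff_of_inCell h₁ h₂ (v_det_of_mem_U hV hP hgP _)
        (v_det_of_mem_U hV hQ hgQ _) (n := n) (by simp only; omega) ta tb).2 hc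
  have hcellP : ∀ i : D.CellIndex, i.1 % 2 = e → MeasurableSet (cP i) ∧ μ (cP i) = 1 := fun i hi =>
    measurableSet_and_measure_cell hμ hVi hV hP hgP hi
  have hcellQ : ∀ i : D.CellIndex, i.1 % 2 = e → MeasurableSet (cQ i) ∧ μ (cQ i) = 1 := fun i hi =>
    measurableSet_and_measure_cell hμ hVi hV hQ hgQ hi
  have hTm : ∀ p ∈ I, MeasurableSet (T p) := by
    intro p hp
    obtain ⟨h3, h4, h5⟩ := hmem.1 hp
    exact MeasurableSet.iUnion fun c => ((hcellP _ h5).1).prod (hcellQ _ (by simp only; omega)).1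
  have hTμ : ∀ p ∈ I, (μ.prod μ) (T p) = (D.pairCount ta tb p.1 p.2 : ℝ≥0∞) := by
    intro p hp
    obtain ⟨h3, h4, h5⟩ := hmem.1 hp
    rw [hT, measure_iUnion]
    · have h6 : ∀ c : {c : (normOne σ ⧸ D.level p.2) × (normOne σ ⧸ D.level (2 * p.1 - p.2)) //
          D.PairCond ta tb p.1 p.2 c.1 c.2},
          (μ.prod μ) (cP ⟨p.2, c.1.1⟩ ×ˢ cQ ⟨2 * p.1 - p.2, c.1.2⟩) = 1 := fun c => by
        rw [Measure.prod_prod, (hcellP ⟨p.2, c.1.1⟩ h5).2,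
          (hcellQ ⟨2 * p.1 - p.2, c.1.2⟩ (by simp only; omega)).2, one_mul]
      simp only [h6]
      rw [ENNReal.tsum_const, mul_one, pairCount, ENat.card_eq_coe_natCard]
      rfl
    · intro c c' hcc
      rw [Function.onFun, Set.disjoint_left]
      rintro g ⟨h7, h8⟩ ⟨h9, h10⟩
      apply hcc
      have h11 := huP h7 h9
      have h12 := huQ h8 h10
      simp only [Sigma.mk.injEq, heq_eq_eq, true_and] at h11 h12
      exact Subtype.ext (Prod.ext h11 h12)
    · intro c
      exact ((hcellP _ h5).1).prod (hcellQ _ (by simp only; omega)).1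
  have hTd : (I : Set (Σ _ : ℕ, ℕ)).PairwiseDisjoint T := by
    intro p hp p' hp' hne
    rw [Function.onFun, Set.disjoint_left]
    intro g h1 h2
    simp only [hT, Set.mem_iUnion] at h1 h2
    obtain ⟨c, h7, h8⟩ := h1
    obtain ⟨c', h9, h10⟩ := h2
    apply hne
    have h11 := congrArg Sigma.fst (huP h7 h9)
    have h12 := congrArg Sigma.fst (huQ h8 h10)
    obtain ⟨h3, h4, h5⟩ := hmem.1 (Finset.mem_coe.1 hp)
    obtain ⟨h3', h4', h5'⟩ := hmem.1 (Finset.mem_coe.1 hp')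
    obtain ⟨n, k⟩ := p
    obtain ⟨n', k'⟩ := p'
    simp only at h11 h12 h4 h4'
    obtain rfl : k = k' := h11
    obtain rfl : n = n' := by omega
    rfl
  rw [hS, measure_biUnion_finset hTd hTm, Finset.sum_congr rfl hTμ, hI, Finset.sum_sigma]
  push_cast
  rfl

end UnramifiedQuadratic
end OrbitalVolume
end

/-! ### The `κ`-orbital integral on `End(V₂)`. -/

noncomputable section
section KappaOrbitalIntegral

open WithZero

variable {F E : Type*} [Field F] [Field E] [ValuativeRel E] [TopologicalSpace E]
  [IsNonarchimedeanLocalField E] [Algebra F E] {σ : E ≃ₐ[F] E}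

namespace UnramifiedQuadratic

variable {V : HermSpace σ (Fin 2)} {q : ℕ} {D : UnramifiedQuadratic σ (intValuation E) q}
variable {ca cb : F} {x x' P P' : Matrix (Fin 2) (Fin 2) E} {ε ε' : ℤ}

-- The second unitary factor cancels in `x x^*`, so the action conjugates the contraction by the
-- first factor.
omit [ValuativeRel E] [TopologicalSpace E] [IsNonarchimedeanLocalField E] in
theorem _root_.mul_contraction_of_smul_eq {g : V.U × V.U} (h : g • x = x') :
    ((g.1 : GL (Fin 2) E) : Matrix (Fin 2) (Fin 2) E) * contraction V V x =
      contraction V V x' * ((g.1 : GL (Fin 2) E) : Matrix (Fin 2) (Fin 2) E) := by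
  rw [smul_hom_eq] at h
  subst h
  have h1 : HermSpace.adj V V (((g.2 : GL (Fin 2) E)⁻¹ : GL (Fin 2) E) : Matrix (Fin 2) (Fin 2) E) =
      ((g.2 : GL (Fin 2) E) : Matrix (Fin 2) (Fin 2) E) := by
    have := HermSpace.adj_coe_U g.2⁻¹
    simpa using this
  rw [contraction, contraction, HermSpace.adj_mul V V V, HermSpace.adj_mul V V V, h1,
    HermSpace.adj_coe_U g.1]
  set A := ((g.1 : GL (Fin 2) E) : Matrix (Fin 2) (Fin 2) E)
  set A' := (((g.1 : GL (Fin 2) E)⁻¹ : GL (Fin 2) E) : Matrix (Fin 2) (Fin 2) E)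
  set B := ((g.2 : GL (Fin 2) E) : Matrix (Fin 2) (Fin 2) E)
  set B' := (((g.2 : GL (Fin 2) E)⁻¹ : GL (Fin 2) E) : Matrix (Fin 2) (Fin 2) E)
  have hA : A' * A = 1 := Units.inv_mul _
  have hB : B' * B = 1 := Units.inv_mul _
  calc A * -(x * HermSpace.adj V V x) = -(A * x * 1 * HermSpace.adj V V x * 1) := by noncomm_ring
    _ = -(A * x * (B' * B) * HermSpace.adj V V x * (A' * A)) := by rw [hA, hB]
    _ = _ := by noncomm_ring

theorem HasType.smul (h : D.HasType V ca cb ε x) {g : V.U × V.U} (hg : g • x = x') :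
    D.HasType V ca cb ε x' := by
  obtain ⟨P, P', hP⟩ := h
  have hc := mul_contraction_of_smul_eq hg
  set A := ((g.1 : GL (Fin 2) E) : Matrix (Fin 2) (Fin 2) E) with hAdef
  set A' := (((g.1 : GL (Fin 2) E)⁻¹ : GL (Fin 2) E) : Matrix (Fin 2) (Fin 2) E)
  have hA : A' * A = 1 := Units.inv_mul _
  have hA' : A * A' = 1 := Units.mul_inv _
  refine ⟨A * P, P' * A', ?_, ?_, ?_, ?_⟩
  · calc P' * A' * (A * P) = P' * (A' * A) * P := by noncomm_ring
      _ = 1 := by rw [hA, mul_one, hP.inv_mul]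
  · calc A * P * (P' * A') = A * (P * P') * A' := by noncomm_ring
      _ = 1 := by rw [hP.mul_inv, mul_one, hA']
  · rw [← hP.gram_eq, conjT_mul]
    calc _ = conjT σ P * (conjT σ A * V.gram * A) * P := by noncomm_ring
      _ = _ := by rw [HermSpace.mem_U_iff.1 g.1.2]
  · rw [← mul_assoc, ← hc, mul_assoc, hP.eig, mul_assoc]

/-- Two frames of one operator compute the same value of `κ`. -/
theorem HasType.unique (hnorm : ∀ z : E, algebraMap F E (Algebra.norm F z) = z * σ z)
    (hc : ca ≠ cb) (h : D.HasType V ca cb ε x) (h' : D.HasType V ca cb ε' x)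
    (hε : ε = 0 ∨ ε = 1) (hε' : ε' = 0 ∨ ε' = 1) : ε = ε' := by
  have h1 := kappaInv_eq_of_hasType hnorm hc h h hε hε
  rw [kappaInv_eq_of_hasType hnorm hc h h' hε hε', if_pos rfl] at h1
  by_contra hne
  rw [if_neg hne] at h1
  norm_num at h1

/-- The first component of a stabilizer element commutes with the contraction; in the frame it is
diagonal with norm-one entries. -/
theorem IsFrame.isIntegralMatrix_of_smul_eq
    (hP : D.IsFrame V (contraction V V x) ca cb ε P P') (hc : ca ≠ cb) {g : V.U × V.U}
    (hg : g • x = x) : IsIntegralMatrix (intValuation E)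
      (P' * ((g.1 : GL (Fin 2) E) : Matrix (Fin 2) (Fin 2) E) * P) := by
  have h1 := mul_contraction_of_smul_eq hg
  set A := ((g.1 : GL (Fin 2) E) : Matrix (Fin 2) (Fin 2) E) with hAdef
  set M := P' * A * P with hM
  have hPM : P * M = A * P := by
    rw [hM, ← mul_assoc, ← mul_assoc, hP.mul_inv, one_mul]
  have hcomm : M * Matrix.diagonal ![algebraMap F E ca, algebraMap F E cb] =
      Matrix.diagonal ![algebraMap F E ca, algebraMap F E cb] * M := by
    have h2 : P * (M * Matrix.diagonal ![algebraMap F E ca, algebraMap F E cb]) =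
        P * (Matrix.diagonal ![algebraMap F E ca, algebraMap F E cb] * M) := by
      rw [← mul_assoc, hPM, mul_assoc, ← hP.eig, ← mul_assoc, h1, ← mul_assoc, ← hP.eig,
        mul_assoc, mul_assoc, hPM]
    have h3 := congrArg (P' * ·) h2
    simpa only [← mul_assoc, hP.inv_mul, one_mul] using h3
  have hne : algebraMap F E ca ≠ algebraMap F E cb := fun h => hc ((algebraMap F E).injective h)
  have h01 : M 0 1 = 0 := by
    have := congrFun (congrFun hcomm 0) 1
    simp [Matrix.mul_apply, Fin.sum_univ_two] at this
    have h4 : M 0 1 * (algebraMap F E cb - algebraMap F E ca) = 0 := by linear_combination this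
    exact (mul_eq_zero.1 h4).resolve_right (sub_ne_zero.2 hne.symm)
  have h10 : M 1 0 = 0 := by
    have := congrFun (congrFun hcomm 1) 0
    simp [Matrix.mul_apply, Fin.sum_univ_two] at this
    have h4 : M 1 0 * (algebraMap F E ca - algebraMap F E cb) = 0 := by linear_combination this
    exact (mul_eq_zero.1 h4).resolve_right (sub_ne_zero.2 hne)
  have hU : conjT σ M * M = 1 := by
    have h5 : D.ϖE ^ ε • (conjT σ M * M) = D.ϖE ^ ε • (1 : Matrix (Fin 2) (Fin 2) E) := by
      calc D.ϖE ^ ε • (conjT σ M * M) = conjT σ M * (D.ϖE ^ ε • 1) * M := by simp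
        _ = conjT σ (P * M) * V.gram * (P * M) := by
          rw [← hP.gram_eq, conjT_mul P M]; simp only [mul_assoc]
        _ = conjT σ P * (conjT σ A * V.gram * A) * P := by
          rw [hPM, conjT_mul]; noncomm_ring
        _ = D.ϖE ^ ε • 1 := by rw [HermSpace.mem_U_iff.1 g.1.2, hP.gram_eq]
    exact smul_right_injective _ (zpow_ne_zero _ D.ϖE_ne_zero) h5
  have hone : ∀ z : E, σ z * z = 1 → intValuation E z ≤ 1 := fun z hz => by
    have h6 := congrArg (intValuation E) hz
    rw [map_mul, D.v_conj, map_one, ← sq] at h6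
    exact ((pow_eq_one_iff_of_nonneg zero_le (by norm_num)).1 h6).le
  have h00 := congrFun (congrFun hU 0) 0
  have h11 := congrFun (congrFun hU 1) 1
  simp [conjT, Matrix.mul_apply, Fin.sum_univ_two, h01, h10] at h00 h11
  intro i j
  fin_cases i <;> fin_cases j
  · exact hone _ h00
  · simp [h01]
  · simp [h10]
  · exact hone _ h11

/-- A stabilizer element satisfies `g₂ = x⁻¹ g₁ x`, so both components and their inverses preserve
fixed lattices, those of the frame and of its preimage under `x`. The stabilizer is closed in the
resulting compact set. -/
theorem HasType.compactSpace_stabilizer (h : D.HasType V ca cb ε x) (hc : ca ≠ cb)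
    (ha : ca ≠ 0) (hb : cb ≠ 0) : CompactSpace (MulAction.stabilizer (V.U × V.U) x) := by
  have hx := h.det_ne_zero ha hb
  obtain ⟨P, P', hP⟩ := h
  have hu : IsUnit x.det := isUnit_iff_ne_zero.2 hx
  have hR : x⁻¹ * P * (P' * x) = 1 := by
    calc _ = x⁻¹ * (P * P') * x := by noncomm_ring
      _ = 1 := by rw [hP.mul_inv, mul_one, Matrix.nonsing_inv_mul _ hu]
  have hC := (V.isCompact_lattice_stabilizer D.v_conj hP.mul_inv).prod
    (V.isCompact_lattice_stabilizer D.v_conj hR)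
  suffices hs : IsCompact (MulAction.stabilizer (V.U × V.U) x : Set (V.U × V.U)) from
    isCompact_iff_compactSpace.1 hs
  refine hC.of_isClosed_subset ?_ ?_
  · have h1 : Continuous fun g : V.U => ((g : GL (Fin 2) E) : Matrix (Fin 2) (Fin 2) E) :=
      Units.continuous_val.comp continuous_subtype_val
    have h2 : Continuous fun g : V.U × V.U => g • x := by
      have h3 : (fun g : V.U × V.U => g • x) = fun g : V.U × V.U =>
          ((g.1 : GL (Fin 2) E) : Matrix (Fin 2) (Fin 2) E) * x *
          (((g.2⁻¹ : V.U) : GL (Fin 2) E) : Matrix (Fin 2) (Fin 2) E) := by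
        funext g
        rw [smul_hom_eq]
        rfl
      rw [h3]
      exact ((h1.comp continuous_fst).mul continuous_const).mul (h1.comp continuous_snd.inv)
    exact isClosed_singleton.preimage h2
  · have hsnd : ∀ g : V.U × V.U, g • x = x →
        P' * x * ((g.2 : GL (Fin 2) E) : Matrix (Fin 2) (Fin 2) E) * (x⁻¹ * P) =
          P' * ((g.1 : GL (Fin 2) E) : Matrix (Fin 2) (Fin 2) E) * P := by
      intro g hg
      rw [smul_hom_eq] at hg
      have h4 : x * ((g.2 : GL (Fin 2) E) : Matrix (Fin 2) (Fin 2) E) =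
          ((g.1 : GL (Fin 2) E) : Matrix (Fin 2) (Fin 2) E) * x := by
        nth_rewrite 1 [← hg]
        rw [mul_assoc, Units.inv_mul, mul_one]
      calc _ = P' * (x * ((g.2 : GL (Fin 2) E) : Matrix (Fin 2) (Fin 2) E)) * x⁻¹ * P := by
            noncomm_ring
        _ = P' * ((g.1 : GL (Fin 2) E) : Matrix (Fin 2) (Fin 2) E) * (x * x⁻¹) * P := by
            rw [h4]; noncomm_ring
        _ = _ := by rw [Matrix.mul_nonsing_inv _ hu, mul_one]
    intro g hg
    have hg1 : g • x = x := hg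
    have hg2 : g⁻¹ • x = x := by rw [inv_smul_eq_iff, hg1]
    have i1 := hP.isIntegralMatrix_of_smul_eq hc hg1
    have i2 := hP.isIntegralMatrix_of_smul_eq hc hg2
    have i3 := i1
    have i4 := i2
    rw [← hsnd _ hg1] at i3
    rw [← hsnd _ hg2] at i4
    rw [Prod.fst_inv] at i2
    rw [Prod.snd_inv] at i4
    exact Set.mk_mem_prod ⟨i1, i2⟩ ⟨i3, i4⟩

/-- The orbital integral only depends on the type. -/
theorem HasType.orbitalIntegral_eq {μ : Measure V.U} (hμ : V.IsUnitHaar μ)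
    (h : D.HasType V ca cb ε x) (h' : D.HasType V ca cb ε x') (hc : ca ≠ cb)
    (ha : ca ≠ 0) (hb : cb ≠ 0) :
    orbitalIntegral (μ.prod μ) x (endIndicator E (Fin 2)) =
      orbitalIntegral (μ.prod μ) x' (endIndicator E (Fin 2)) := by
  have := V.locallyCompactSpace_U D.v_conj
  have := hμ.1
  have := h.compactSpace_stabilizer hc ha hb
  have := h'.compactSpace_stabilizer hc ha hb
  obtain ⟨γ, rfl⟩ := h.exists_smul_eq h' ha hb
  rw [orbitalIntegral_endIndicator D.v_conj hμ, orbitalIntegral_endIndicator D.v_conj hμ]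
  congr 1
  have hcoe : ∀ (g : V.U × V.U) (y : Matrix (Fin 2) (Fin 2) E),
      (((g.1⁻¹ : V.U) : GL (Fin 2) E) : Matrix (Fin 2) (Fin 2) E) * y *
        ((g.2 : GL (Fin 2) E) : Matrix (Fin 2) (Fin 2) E) = g⁻¹ • y := by
    intro g y
    rw [smul_hom_eq]
    simp
  simp only [hcoe]
  -- The two sets of integral points are left translates of each other.
  have hset : {g : V.U × V.U | IsIntegralMatrix (intValuation E) (g⁻¹ • γ • x)} =
      (fun g => γ⁻¹ * g) ⁻¹' {g : V.U × V.U | IsIntegralMatrix (intValuation E) (g⁻¹ • x)} := by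
    ext g
    simp [mul_smul]
  rw [hset, measureReal_def, measureReal_def, measure_preimage_mul]

omit [TopologicalSpace E] [IsNonarchimedeanLocalField E] [ValuativeRel E] in
theorem isIntegralMatrix_adj {v : Valuation E ℤᵐ⁰} (D : UnramifiedQuadratic σ v q)
    (hVi : IsIntegralMatrix v V.gram) (hV : v V.gram.det = 1)
    {X : Matrix (Fin 2) (Fin 2) E} (hX : IsIntegralMatrix v X) :
    IsIntegralMatrix v (HermSpace.adj V V X) := by
  rw [HermSpace.adj_eq]
  exact ((hVi.inv hV).mul (D.isIntegralMatrix_conjT hX)).mul hVi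

/-- The adjoint has the same orbital integral. -/
theorem orbitalIntegral_adj (D : UnramifiedQuadratic σ (intValuation E) q) {μ : Measure V.U}
    (hμ : V.IsUnitHaar μ)
    (hVi : IsIntegralMatrix (intValuation E) V.gram) (hV : intValuation E V.gram.det = 1)
    [CompactSpace (MulAction.stabilizer (V.U × V.U) x)]
    [CompactSpace (MulAction.stabilizer (V.U × V.U) (HermSpace.adj V V x))] :
    orbitalIntegral (μ.prod μ) (HermSpace.adj V V x) (endIndicator E (Fin 2)) =
      orbitalIntegral (μ.prod μ) x (endIndicator E (Fin 2)) := by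
  have := HermSpace.sigmaFinite_of_isUnitHaar D.v_conj hμ
  rw [orbitalIntegral_endIndicator D.v_conj hμ, orbitalIntegral_endIndicator D.v_conj hμ]
  congr 1
  -- Adjunction exchanges the two unitary factors and, the plane being unimodular, preserves
  -- integrality; the product measure is symmetric.
  have hadj : ∀ (g : V.U × V.U) (y : Matrix (Fin 2) (Fin 2) E), HermSpace.adj V V
      ((((g.1⁻¹ : V.U) : GL (Fin 2) E) : Matrix (Fin 2) (Fin 2) E) * y *
        ((g.2 : GL (Fin 2) E) : Matrix (Fin 2) (Fin 2) E)) =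
      (((g.2⁻¹ : V.U) : GL (Fin 2) E) : Matrix (Fin 2) (Fin 2) E) * HermSpace.adj V V y *
        ((g.1 : GL (Fin 2) E) : Matrix (Fin 2) (Fin 2) E) := by
    intro g y
    rw [HermSpace.adj_mul V V V, HermSpace.adj_mul V V V, HermSpace.adj_coe_U,
      HermSpace.adj_coe_U, ← mul_assoc]
    simp
  set S : Set (V.U × V.U) := {g | IsIntegralMatrix (intValuation E)
        ((((g.1⁻¹ : V.U) : GL (Fin 2) E) : Matrix (Fin 2) (Fin 2) E) * x *
          ((g.2 : GL (Fin 2) E) : Matrix (Fin 2) (Fin 2) E))} with hS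
  have hset : {g : V.U × V.U | IsIntegralMatrix (intValuation E)
        ((((g.1⁻¹ : V.U) : GL (Fin 2) E) : Matrix (Fin 2) (Fin 2) E) * HermSpace.adj V V x *
          ((g.2 : GL (Fin 2) E) : Matrix (Fin 2) (Fin 2) E))} = Prod.swap ⁻¹' S := by
    ext ⟨g₁, g₂⟩
    rw [Set.mem_preimage, Prod.swap_prod_mk, hS, Set.mem_ofPred_eq, Set.mem_ofPred_eq]
    constructor
    · intro h
      have h1 := isIntegralMatrix_adj D hVi hV h
      rwa [hadj (g₁, g₂), HermSpace.adj_adj D.conj_conj] at h1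
    · intro h
      have h1 := isIntegralMatrix_adj D hVi hV h
      rwa [hadj (g₂, g₁)] at h1
  have hm : MeasurePreserving (MeasurableEquiv.prodComm (α := V.U) (β := V.U)) (μ.prod μ)
      (μ.prod μ) := Measure.measurePreserving_swap
  have hp := hm.measure_preimage_equiv S
  rw [hset, measureReal_def, measureReal_def]
  exact congrArg ENNReal.toReal hp

/-- The `κ`-orbital integral is a difference of two orbital integrals. -/
theorem HasType.kappaOrbitalIntegral_eq
    (hnorm : ∀ z : E, algebraMap F E (Algebra.norm F z) = z * σ z)
    {μ : Measure V.U} (hμ : V.IsUnitHaar μ)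
    (hV : intValuation E V.gram.det = 1)
    (h : D.HasType V ca cb ε x) (hε : ε = 0 ∨ ε = 1) (hc : ca ≠ cb) (ha : ca ≠ 0) (hb : cb ≠ 0)
    (h' : D.HasType V ca cb (1 - ε) x') :
    relKappaOrbitalIntegral V μ cb x (endIndicator E (Fin 2)) =
      orbitalIntegral (μ.prod μ) x (endIndicator E (Fin 2)) -
        orbitalIntegral (μ.prod μ) x' (endIndicator E (Fin 2)) := by
  have hε' : 1 - ε = 0 ∨ 1 - ε = 1 := by omega
  have hout : ∀ {η : ℤ} {y : Matrix (Fin 2) (Fin 2) E}, D.HasType V ca cb η y →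
      D.HasType V ca cb η (Quotient.out
        (Quotient.mk _ y : MulAction.orbitRel.Quotient (V.U × V.U) (Matrix (Fin 2) (Fin 2) E))) := by
    intro η y hy
    have h1 : (MulAction.orbitRel (V.U × V.U) (Matrix (Fin 2) (Fin 2) E)) (Quotient.out
        (Quotient.mk _ y : MulAction.orbitRel.Quotient (V.U × V.U) (Matrix (Fin 2) (Fin 2) E))) y :=
      Quotient.exact (Quotient.out_eq _)
    obtain ⟨g, hg⟩ := MulAction.orbitRel_apply.1 h1
    exact hy.smul hg
  have heq : ∀ {η : ℤ} {y : Matrix (Fin 2) (Fin 2) E}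
      {o : MulAction.orbitRel.Quotient (V.U × V.U) (Matrix (Fin 2) (Fin 2) E)},
      D.HasType V ca cb η y → D.HasType V ca cb η (Quotient.out o) → o = Quotient.mk _ y := by
    intro η y o hy ho
    obtain ⟨g, hg⟩ := hy.exists_smul_eq ho ha hb
    rw [← Quotient.out_eq o]
    apply Quotient.sound
    exact MulAction.orbitRel_apply.2 ⟨g, hg⟩
  set s₀ : {o : MulAction.orbitRel.Quotient (V.U × V.U) (Matrix (Fin 2) (Fin 2) E) //
    StablyConj V V x (Quotient.out o)} := ⟨Quotient.mk _ x, h.stablyConj (hout h) ha hb⟩ with hs₀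
  set s₁ : {o : MulAction.orbitRel.Quotient (V.U × V.U) (Matrix (Fin 2) (Fin 2) E) //
    StablyConj V V x (Quotient.out o)} := ⟨Quotient.mk _ x', h.stablyConj (hout h') ha hb⟩ with hs₁
  have hne : s₀ ≠ s₁ := by
    intro hss
    have h1 : D.HasType V ca cb ε (Quotient.out s₁.1) := by
      rw [← hss]
      exact hout h
    have := HasType.unique hnorm hc h1 (hout h') hε hε'
    omega
  -- The type of a stably conjugate element is `ε` or `1 - ε`, and it determines the orbit.
  have huniv : (Set.univ : Set {o : MulAction.orbitRel.Quotient (V.U × V.U)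
      (Matrix (Fin 2) (Fin 2) E) // StablyConj V V x (Quotient.out o)}) = {s₀, s₁} := by
    symm
    rw [Set.eq_univ_iff_forall]
    rintro ⟨o, ho⟩
    obtain ⟨η, hη, ht⟩ := HasType.exists_of_stablyConj hV hc h ho
    by_cases hηε : η = ε
    · subst hηε
      exact Or.inl (Subtype.ext (heq h ht))
    · obtain rfl : η = 1 - ε := by omega
      exact Or.inr (Subtype.ext (heq h' ht))
  rw [relKappaOrbitalIntegral, kappaOrbitalIntegral, ← finsum_mem_univ, huniv, finsum_mem_pair hne,
    kappaInv_eq_of_hasType hnorm hc h (hout h) hε hε, if_pos rfl, one_mul,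
    kappaInv_eq_of_hasType hnorm hc h (hout h') hε hε', if_neg (by omega), neg_one_mul,
    ← sub_eq_add_neg, HasType.orbitalIntegral_eq hμ (hout h) h hc ha hb,
    HasType.orbitalIntegral_eq hμ (hout h') h' hc ha hb]

/-- The `κ`-orbital integral vanishes if the eigenvalues of the contraction have odd valuation. -/
theorem HasType.kappaOrbitalIntegral_eq_zero
    (hnorm : ∀ z : E, algebraMap F E (Algebra.norm F z) = z * σ z)
    {μ : Measure V.U} (hμ : V.IsUnitHaar μ)
    (hVi : IsIntegralMatrix (intValuation E) V.gram) (hV : intValuation E V.gram.det = 1)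
    (h : D.HasType V ca cb ε x) (hε : ε = 0 ∨ ε = 1) (hc : ca ≠ cb) {a b : ℤ}
    (ha : intValuation E (algebraMap F E ca) = exp (-a))
    (hb : intValuation E (algebraMap F E cb) = exp (-b)) (hoa : Odd a) (hob : Odd b) :
    relKappaOrbitalIntegral V μ cb x (endIndicator E (Fin 2)) = 0 := by
  have ha0 : ca ≠ 0 := fun h0 => by rw [h0, map_zero, map_zero] at ha; exact exp_ne_zero ha.symm
  have hb0 : cb ≠ 0 := fun h0 => by rw [h0, map_zero, map_zero] at hb; exact exp_ne_zero hb.symm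
  have h' := h.adj ha hb hoa hob
  have := h.compactSpace_stabilizer hc ha0 hb0
  have := h'.compactSpace_stabilizer hc ha0 hb0
  rw [HasType.kappaOrbitalIntegral_eq hnorm hμ hV h hε hc ha0 hb0 h',
    orbitalIntegral_adj D hμ hVi hV, sub_self]

/-- The orbital integral if the negatives of the eigenvalues are norms. -/
theorem HasType.orbitalIntegral_eq_sum {μ : Measure V.U} (hμ : V.IsUnitHaar μ)
    (hVi : IsIntegralMatrix (intValuation E) V.gram) (hV : intValuation E V.gram.det = 1)
    {e : ℕ} (he : e ≤ 1) (h : D.HasType V ca cb e x) (hc : ca ≠ cb) {ta tb : E}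
    (hta : ta ≠ 0) (htb : tb ≠ 0)
    (ha : -algebraMap F E ca = ta * σ ta) (hb : -algebraMap F E cb = tb * σ tb) {N : ℕ}
    (hN : ∀ n k c₁ c₂, D.PairCond ta tb n k c₁ c₂ → k ≤ 2 * n → n < N) :
    orbitalIntegral (μ.prod μ) x (endIndicator E (Fin 2)) =
      ((∑ n ∈ Finset.range N, ∑ k ∈ (Finset.range (2 * n + 1)).filter (fun k => k % 2 = e),
        D.pairCount ta tb n k : ℕ) : ℂ) := by
  have hs : ∀ {z : E}, z ≠ 0 → σ z ≠ 0 := fun hz => by simpa using hz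
  have ha0 : ca ≠ 0 := fun h0 => by
    rw [h0, map_zero, neg_zero] at ha
    exact mul_ne_zero hta (hs hta) ha.symm
  have hb0 : cb ≠ 0 := fun h0 => by
    rw [h0, map_zero, neg_zero] at hb
    exact mul_ne_zero htb (hs htb) hb.symm
  have hx := h.det_ne_zero ha0 hb0
  have hu : IsUnit x.det := isUnit_iff_ne_zero.2 hx
  have := HermSpace.sigmaFinite_of_isUnitHaar D.v_conj hμ
  have := h.compactSpace_stabilizer hc ha0 hb0
  obtain ⟨P, P', hP⟩ := h
  have hQ : x⁻¹ * P * Matrix.diagonal ![ta, tb] *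
      (Matrix.diagonal ![ta⁻¹, tb⁻¹] * P' * x) = 1 := by
    calc _ = x⁻¹ * P * (Matrix.diagonal ![ta, tb] * Matrix.diagonal ![ta⁻¹, tb⁻¹]) * P' * x := by
          noncomm_ring
      _ = x⁻¹ * (P * P') * x := by
          rw [diagonal_mul_diagonal_two, mul_inv_cancel₀ hta, mul_inv_cancel₀ htb,
            diagonal_two_eq_one, mul_one, mul_assoc]
          noncomm_ring
      _ = 1 := by rw [hP.mul_inv, mul_one, Matrix.nonsing_inv_mul _ hu]
  -- Here `x` is diagonal between the frame `P` at the target and the rescaled preimage frame at the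
  -- source, which has the same type.
  have hxe : x = P * Matrix.diagonal ![ta, tb] * (Matrix.diagonal ![ta⁻¹, tb⁻¹] * P' * x) := by
    calc x = P * P' * x := by rw [hP.mul_inv, one_mul]
      _ = P * (Matrix.diagonal ![ta, tb] * Matrix.diagonal ![ta⁻¹, tb⁻¹]) * P' * x := by
          rw [diagonal_mul_diagonal_two, mul_inv_cancel₀ hta, mul_inv_cancel₀ htb,
            diagonal_two_eq_one, mul_one]
      _ = _ := by noncomm_ring
  rw [orbitalIntegral_endIndicator D.v_conj hμ, measureReal_def,
    volume_integral_points hμ hVi hV he hP.mul_inv hP.gram_eq hQ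
      (hP.gram_source hx hta htb ha hb) hxe hN, ENNReal.toReal_natCast, Complex.ofReal_natCast]

end UnramifiedQuadratic
end KappaOrbitalIntegral
end

/-! ### Separability of the characteristic polynomials. -/

noncomputable section
section Separable

open Polynomial

variable {K : Type*} [Field K] {n : Type*} [Fintype n] [DecidableEq n]

/-- Right multiplication of the characteristic matrix by a lower triangular block matrix makes it
upper triangular; a power of `X` then cancels from the determinants. -/
theorem Matrix.charpoly_fromBlocks_zero_diagonal (A B : Matrix n n K) :
    (Matrix.fromBlocks 0 A B 0).charpoly = expand K 2 (A * B).charpoly := by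
  have h1 : Matrix.charmatrix (Matrix.fromBlocks 0 A B 0) =
      Matrix.fromBlocks (Matrix.scalar n X) (-A.map C) (-B.map C) (Matrix.scalar n (X : K[X])) := by
    rw [Matrix.charmatrix_fromBlocks]
    simp [Matrix.charmatrix]
  have h2 : Matrix.fromBlocks (Matrix.scalar n X) (-A.map C) (-B.map C) (Matrix.scalar n (X : K[X])) *
      Matrix.fromBlocks (Matrix.scalar n X) 0 (B.map C) 1 =
      Matrix.fromBlocks (Matrix.scalar n (X ^ 2) - (A * B).map C) (-A.map C) 0
        (Matrix.scalar n X) := by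
    rw [Matrix.fromBlocks_multiply]
    have hc : (Matrix.scalar n X) * B.map C = B.map C * Matrix.scalar n (X : K[X]) :=
      (Matrix.scalar_commute X (fun r => Commute.all _ _) _)
    congr 1
    · rw [← map_mul, ← sq, Matrix.map_mul]
      noncomm_ring
    · simp
    · rw [hc]; simp
    · simp
  have h3 : (Matrix.scalar n (X ^ 2) - (A * B).map C).det = expand K 2 (A * B).charpoly := by
    rw [Matrix.charpoly, ← AlgHom.coe_toRingHom, RingHom.map_det]
    congr 1
    ext i j
    by_cases hij : i = j
    · subst hij
      simp [Matrix.charmatrix, -Matrix.map_mul]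
    · simp [Matrix.charmatrix, hij, -Matrix.map_mul]
  have h4 := congrArg Matrix.det h2
  rw [Matrix.det_mul, Matrix.det_fromBlocks_zero₁₂, Matrix.det_fromBlocks_zero₂₁, Matrix.det_one,
    mul_one, ← h1, h3] at h4
  refine mul_right_cancel₀ ?_ h4
  simp

theorem Matrix.charpoly_diagonal_two (a b : K) :
    (Matrix.diagonal ![a, b]).charpoly = (X - C a) * (X - C b) := by
  rw [Matrix.charpoly_of_isUpperTriangular _ (Matrix.blockTriangular_diagonal _)]
  simp [Fin.prod_univ_two]

/-- `X ^ 2 - a` and `X ^ 2 - b` are separable, and coprime because they differ by a nonzero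
constant. -/
theorem separable_expand_two (h2 : (2 : K) ≠ 0) {a b : K} (ha : a ≠ 0) (hb : b ≠ 0) (hab : a ≠ b) :
    (expand K 2 ((X - C a) * (X - C b))).Separable := by
  have he : expand K 2 ((X - C a) * (X - C b)) = (X ^ 2 - C a) * (X ^ 2 - C b) := by
    simp
  rw [he]
  refine (separable_X_pow_sub_C a (by exact_mod_cast h2) ha).mul
    (separable_X_pow_sub_C b (by exact_mod_cast h2) hb) ?_
  have hne : b - a ≠ 0 := sub_ne_zero.2 hab.symm
  refine ⟨C (b - a)⁻¹, -C (b - a)⁻¹, ?_⟩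
  have : C (b - a)⁻¹ * (C b - C a) = (1 : K[X]) := by
    rw [← C_sub, ← C_mul, inv_mul_cancel₀ hne, C_1]
  linear_combination this

theorem not_separable_sq {p : K[X]} (hp : ¬ IsUnit p) : ¬ (p * p).Separable := fun h =>
  hp (h.squarefree p dvd_rfl)

end Separable

/-! ### One-dimensional Hermitian spaces, `ω` and the existence of matching elements. -/

section DimensionOne

open WithZero

variable {F E : Type*} [Field F] [Field E] [Algebra F E] {σ : E ≃ₐ[F] E}

theorem Matrix.inv_fin_one {K : Type*} [Field K] (A : Matrix (Fin 1) (Fin 1) K) :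
    A⁻¹ 0 0 = (A 0 0)⁻¹ := by
  rw [Matrix.inv_subsingleton]
  simp

theorem HermSpace.gram_fin_one_ne_zero (V : HermSpace σ (Fin 1)) : V.gram 0 0 ≠ 0 := by
  have := V.nondeg.ne_zero
  rwa [Matrix.det_fin_one] at this

theorem HermSpace.conj_gram_fin_one (V : HermSpace σ (Fin 1)) : σ (V.gram 0 0) = V.gram 0 0 :=
  congrFun (congrFun V.isHerm 0) 0

theorem contraction_fin_one (V V' : HermSpace σ (Fin 1)) (y : Matrix (Fin 1) (Fin 1) E) :
    contraction V V' y =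
      Matrix.of fun _ _ => -(y 0 0 * σ (y 0 0) * (V.gram 0 0 / V'.gram 0 0)) := by
  ext i j
  fin_cases i; fin_cases j
  simp only [contraction, HermSpace.adj, Matrix.neg_apply, Matrix.mul_apply, Fin.sum_univ_one,
    Matrix.inv_fin_one, Matrix.transpose_apply, Matrix.map_apply, Matrix.of_apply, Fin.zero_eta]
  ring

theorem eigF_of (c : F) : eigF F (Matrix.of fun _ _ => algebraMap F E c) = c :=
  Function.leftInverse_invFun (algebraMap F E).injective c

/-- At zero the characteristic polynomial is `X ^ 2`. -/
theorem IsRegSS.apply_ne_zero {V V' : HermSpace σ (Fin 1)} {y : Matrix (Fin 1) (Fin 1) E}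
    (h : IsRegSS V V' y) : y 0 0 ≠ 0 := by
  intro h0
  have hy : y = 0 := by
    ext i j
    fin_cases i; fin_cases j
    exact h0
  rw [IsRegSS, hy, Matrix.charpoly_fromBlocks_zero_diagonal] at h
  simp only [zero_mul, Matrix.charpoly_zero, Fintype.card_fin, pow_one, Polynomial.expand_X, sq]
    at h
  exact not_separable_sq Polynomial.not_isUnit_X h

theorem ne_of_separable_dsum {a b : E}
    (h : (dsum (Matrix.of fun _ _ : Fin 1 => a) (Matrix.of fun _ _ : Fin 1 => b)).charpoly.Separable) :
    a ≠ b := by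
  rintro rfl
  rw [dsum, Matrix.charpoly_fromBlocks_zero₁₂] at h
  refine not_separable_sq (fun hu => ?_) h
  have h1 := Matrix.charpoly_natDegree_eq_dim (Matrix.of fun _ _ : Fin 1 => a)
  rw [Polynomial.natDegree_eq_zero_of_isUnit hu] at h1
  simp at h1

namespace UnramifiedQuadratic

variable {v : Valuation E ℤᵐ⁰} {q : ℕ} (D : UnramifiedQuadratic σ v q)
include D

theorem exists_contraction_eq (V V' : HermSpace σ (Fin 1)) (y : Matrix (Fin 1) (Fin 1) E) :
    ∃ c : F, contraction V V' y = Matrix.of (fun _ _ => algebraMap F E c) ∧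
      algebraMap F E c = -(y 0 0 * σ (y 0 0) * (V.gram 0 0 / V'.gram 0 0)) := by
  obtain ⟨c, hc⟩ := D.exists_of_fixed (-(y 0 0 * σ (y 0 0) * (V.gram 0 0 / V'.gram 0 0))) (by
    simp only [map_neg, map_mul, map_div₀, V.conj_gram_fin_one, V'.conj_gram_fin_one, D.conj_conj]
    ring)
  exact ⟨c, by rw [hc, contraction_fin_one], hc⟩

/-- The ratio of the two Gram entries has even valuation, hence is a norm. -/
theorem isometric_of_even {V V' : HermSpace σ (Fin 1)} (hV : v (V.gram 0 0) = 1) {k : ℤ}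
    (hV' : v (V'.gram 0 0) = exp (-(2 * k))) : V'.Isometric V := by
  obtain ⟨z, hz⟩ := D.exists_norm_of_even (a := V'.gram 0 0 / V.gram 0 0) (k := k)
    (by rw [map_div₀, V.conj_gram_fin_one, V'.conj_gram_fin_one])
    (by rw [map_div₀, hV, hV', div_one])
  have hz0 : z ≠ 0 := by
    rintro rfl
    rw [zero_mul, eq_comm, div_eq_zero_iff] at hz
    exact hz.elim V'.gram_fin_one_ne_zero V.gram_fin_one_ne_zero
  refine ⟨Matrix.of fun _ _ => z, Matrix.of fun _ _ => z⁻¹, ?_, ?_, ?_⟩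
  · ext i j; fin_cases i; fin_cases j
    simp [Matrix.mul_apply, hz0]
  · ext i j; fin_cases i; fin_cases j
    simp [Matrix.mul_apply, hz0]
  · ext i j; fin_cases i; fin_cases j
    rw [eq_div_iff V.gram_fin_one_ne_zero] at hz
    simp only [Matrix.mul_apply, Fin.sum_univ_one, Matrix.transpose_apply, Matrix.map_apply,
      Matrix.of_apply, Fin.zero_eta]
    linear_combination hz

/-- In the unramified case the norms are exactly the elements of even valuation. -/
theorem omega_eq (hnorm : ∀ z : E, algebraMap F E (Algebra.norm F z) = z * σ z) {a : F} {n : ℤ}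
    (h : v (algebraMap F E a) = exp (-n)) : omega F E a = (-1) ^ n := by
  have ha : algebraMap F E a ≠ 0 := fun h0 => by
    rw [h0, map_zero] at h
    exact exp_ne_zero h.symm
  rcases Int.even_or_odd n with hn | hn
  · rw [hn.neg_one_zpow, omega, if_pos]
    obtain ⟨k, rfl⟩ := hn
    obtain ⟨z, hz⟩ := D.exists_norm_of_even (a := algebraMap F E a) (k := k) (by simp)
      (by rw [h]; congr 1; ring)
    exact ⟨z, (algebraMap F E).injective (by rw [hnorm, hz])⟩
  · rw [hn.neg_one_zpow, omega, if_neg]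
    rintro ⟨z, rfl⟩
    rw [hnorm] at h ha
    obtain ⟨k, hk⟩ := D.exists_v_norm (z := z) (fun h0 => ha (by simp [h0]))
    rw [hk, exp_inj] at h
    rw [show n = 2 * k by omega] at hn
    exact Int.not_even_iff_odd.2 hn ⟨k, by ring⟩

/-- Every pair of eigenvalues that are negatives of norms occurs in a unimodular plane. -/
theorem exists_isJLTransfer {V : HermSpace σ (Fin 2)} (hVi : IsIntegralMatrix v V.gram)
    (hV : v V.gram.det = 1) {ca cb : F} {ta tb : E} (hta : ta ≠ 0) (htb : tb ≠ 0)
    (ha : algebraMap F E ca = -(ta * σ ta)) (hb : algebraMap F E cb = -(tb * σ tb))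
    (hc : ca ≠ cb) {V₁ : HermSpace σ (Fin 1)} (hV₁ : v (V₁.gram 0 0) = 1) : ∃ x, IsRegSS V V x ∧
      IsJLTransfer (contraction V V x) (dsum (Matrix.of fun _ _ : Fin 1 => algebraMap F E ca)
        (Matrix.of fun _ _ : Fin 1 => algebraMap F E cb)) := by
  obtain ⟨C, -, hCd, hC⟩ := D.exists_conjT_mul_self hVi hV V.conjT_gram
  have hσ : ∀ {z : E}, z ≠ 0 → σ z ≠ 0 := fun hz => by simpa using hz
  have hu : IsUnit C.det := isUnit_iff_ne_zero.2 fun h0 => by simp [h0] at hCd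
  have hu' : IsUnit (conjT σ C).det := by
    rw [det_conjT, isUnit_iff_ne_zero]
    exact hσ hu.ne_zero
  have hi := Matrix.mul_nonsing_inv C hu
  have hi' := Matrix.nonsing_inv_mul C hu
  have hj := Matrix.mul_nonsing_inv _ hu'
  have hj' := Matrix.nonsing_inv_mul _ hu'
  have hconj : conjT σ C⁻¹ = (conjT σ C)⁻¹ :=
    (Matrix.inv_eq_left_inv (by rw [← conjT_mul, hi, conjT_one])).symm
  -- In an orthonormal basis the diagonal operator `diag(ta, tb)` has contraction `diag(ca, cb)`.
  set x : Matrix (Fin 2) (Fin 2) E := C⁻¹ * Matrix.diagonal ![ta, tb] * C with hx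
  have hadj : HermSpace.adj V V x = C⁻¹ * Matrix.diagonal ![σ ta, σ tb] * C := by
    rw [HermSpace.adj_eq, ← hC, Matrix.mul_inv_rev, hx, conjT_mul, conjT_mul, conjT_diagonal, hconj]
    calc _ = C⁻¹ * ((conjT σ C)⁻¹ * conjT σ C) * Matrix.diagonal ![σ ta, σ tb] *
          ((conjT σ C)⁻¹ * conjT σ C) * C := by simp only [mul_assoc]
      _ = _ := by rw [hj', mul_one, mul_one]
  have hcon : contraction V V x =
      C⁻¹ * Matrix.diagonal ![algebraMap F E ca, algebraMap F E cb] * C := by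
    rw [contraction, hadj, ha, hb]
    calc _ = -(C⁻¹ * Matrix.diagonal ![ta, tb] * (C * C⁻¹) * Matrix.diagonal ![σ ta, σ tb] * C) := by
          rw [hx]; simp only [mul_assoc]
      _ = -(C⁻¹ * Matrix.diagonal ![ta * σ ta, tb * σ tb] * C) := by
          rw [hi, mul_one, mul_assoc C⁻¹, diagonal_mul_diagonal_two]
      _ = _ := by
          have : Matrix.diagonal ![-(ta * σ ta), -(tb * σ tb)] =
              -Matrix.diagonal ![ta * σ ta, tb * σ tb] := by
            ext i j; fin_cases i <;> fin_cases j <;> simp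
          rw [this]
          noncomm_ring
  refine ⟨x, ?_, ?_⟩
  · rw [IsRegSS, Matrix.charpoly_fromBlocks_zero_diagonal]
    have h1 : x * -(HermSpace.adj V V x) = contraction V V x := by rw [contraction, mul_neg]
    rw [h1, hcon, mul_assoc, Matrix.charpoly_mul_comm, mul_assoc, hi, mul_one,
      Matrix.charpoly_diagonal_two]
    refine separable_expand_two D.two_ne_zero' ?_ ?_ fun h => hc ((algebraMap F E).injective h)
    · rw [ha]; exact neg_ne_zero.2 (mul_ne_zero hta (hσ hta))
    · rw [hb]; exact neg_ne_zero.2 (mul_ne_zero htb (hσ htb))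
  · obtain ⟨P, P', hP⟩ := exists_frame_sum (ca := ca) (cb := cb) D hV₁
    refine ⟨P * C, C⁻¹ * P', ?_, ?_, ?_⟩
    · rw [Matrix.mul_assoc, ← Matrix.mul_assoc C, hi, Matrix.one_mul, hP.mul_inv]
    · rw [Matrix.mul_assoc, ← Matrix.mul_assoc P', hP.inv_mul, Matrix.one_mul, hi']
    · rw [hcon, hP.conj_eq]
      simp only [← Matrix.mul_assoc]
      rw [Matrix.mul_assoc P C, hi, Matrix.mul_one, Matrix.mul_assoc _ C, hi, Matrix.mul_one]

end UnramifiedQuadratic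
end DimensionOne
end

/-! ### Stable orbital integrals on the endoscopic side. -/

noncomputable section
section StableOrbitalIntegral

open WithZero

variable {F E : Type*} [Field F] [Field E] [ValuativeRel E] [TopologicalSpace E]
  [IsNonarchimedeanLocalField E] [Algebra F E] {σ : E ≃ₐ[F] E}

omit [ValuativeRel E] [TopologicalSpace E] [IsNonarchimedeanLocalField E] in
theorem HermSpace.mul_conj_eq_one {V : HermSpace σ (Fin 1)} (g : V.U) :
    ((g : GL (Fin 1) E) : Matrix (Fin 1) (Fin 1) E) 0 0 *
      σ (((g : GL (Fin 1) E) : Matrix (Fin 1) (Fin 1) E) 0 0) = 1 := by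
  have h := congrFun (congrFun (HermSpace.mem_U_iff.1 g.2) 0) 0
  simp only [conjT, Matrix.mul_apply, Fin.sum_univ_one, Matrix.transpose_apply,
    Matrix.map_apply] at h
  refine mul_right_cancel₀ V.gram_fin_one_ne_zero ?_
  linear_combination h

theorem HermSpace.intValuation_apply_eq_one
    (hv : ∀ z, intValuation E (σ z) = intValuation E z) {V : HermSpace σ (Fin 1)} (g : V.U) :
    intValuation E (((g : GL (Fin 1) E) : Matrix (Fin 1) (Fin 1) E) 0 0) = 1 := by
  have h := congrArg (intValuation E) (HermSpace.mul_conj_eq_one g)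
  rw [map_mul, hv, map_one, ← sq] at h
  exact (pow_eq_one_iff_of_nonneg zero_le (by norm_num)).1 h

theorem HermSpace.isIntegralMatrix_fin_one
    (hv : ∀ z, intValuation E (σ z) = intValuation E z) {V : HermSpace σ (Fin 1)} (g : V.U) :
    IsIntegralMatrix (intValuation E) ((g : GL (Fin 1) E) : Matrix (Fin 1) (Fin 1) E) := by
  intro i j
  fin_cases i; fin_cases j
  exact (HermSpace.intValuation_apply_eq_one hv g).le

theorem HermSpace.latticeStab_fin_one (hv : ∀ z, intValuation E (σ z) = intValuation E z)
    (V : HermSpace σ (Fin 1)) : V.latticeStab = Set.univ :=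
  Set.eq_univ_of_forall fun g => V.mem_latticeStab_iff.2
    ⟨HermSpace.isIntegralMatrix_fin_one hv g, HermSpace.isIntegralMatrix_fin_one hv g⁻¹⟩

theorem HermSpace.compactSpace_U_fin_one (hv : ∀ z, intValuation E (σ z) = intValuation E z)
    (V : HermSpace σ (Fin 1)) : CompactSpace V.U := by
  have h := V.isCompact_lattice_stabilizer hv (mul_one (1 : Matrix (Fin 1) (Fin 1) E))
  refine ⟨?_⟩
  convert h
  symm
  refine Set.eq_univ_of_forall fun g => ?_
  simp only [one_mul, mul_one]
  exact ⟨HermSpace.isIntegralMatrix_fin_one hv g, HermSpace.isIntegralMatrix_fin_one hv g⁻¹⟩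

-- Stably conjugate elements of a line have the same norm, so their quotient has norm one and acts
-- through the unitary group.
omit [ValuativeRel E] [TopologicalSpace E] [IsNonarchimedeanLocalField E] in
theorem stablyConj_fin_one_iff {V : HermSpace σ (Fin 1)} {y y' : Matrix (Fin 1) (Fin 1) E}
    (hy : y 0 0 ≠ 0) : StablyConj V V y y' ↔ ∃ g : V.U × V.U, g • y = y' := by
  constructor
  · rintro ⟨g, h, h1, h2⟩
    have h3 : y' 0 0 * σ (y' 0 0) = y 0 0 * σ (y 0 0) := by
      have hr : contraction V V y' = (g : Matrix (Fin 1) (Fin 1) E) * contraction V V y *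
          ((g⁻¹ : GL (Fin 1) E) : Matrix (Fin 1) (Fin 1) E) := by
        rw [contraction, contraction, h2, h1]
        have hh : ((h⁻¹ : GL (Fin 1) E) : Matrix (Fin 1) (Fin 1) E) * h = 1 := Units.inv_mul h
        simp only [mul_neg, neg_mul, mul_assoc]
        rw [← mul_assoc _ (h : Matrix (Fin 1) (Fin 1) E), hh, one_mul]
      have hg := congrFun (congrFun (Units.mul_inv g) 0) 0
      have hr' := congrFun (congrFun hr 0) 0
      rw [contraction_fin_one, contraction_fin_one] at hr'
      simp only [Matrix.mul_apply, Fin.sum_univ_one, Matrix.of_apply, Matrix.one_apply_eq,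
        div_self V.gram_fin_one_ne_zero, mul_one] at hr' hg
      linear_combination -hr' + (y 0 0 * σ (y 0 0)) * hg
    have hσy : σ (y 0 0) ≠ 0 := by simpa using hy
    set u : E := y' 0 0 / y 0 0 with hu
    have hu1 : u * σ u = 1 := by
      rw [hu, map_div₀]
      field_simp
      exact h3
    have hu0 : u ≠ 0 := left_ne_zero_of_mul_eq_one hu1
    set w : GL (Fin 1) E := Matrix.GeneralLinearGroup.mkOfDetNeZero (Matrix.of fun _ _ => u)
      (by rw [Matrix.det_fin_one]; exact hu0) with hw
    have hwU : w ∈ V.U := by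
      rw [HermSpace.mem_U_iff]
      ext i j
      fin_cases i; fin_cases j
      change (conjT σ (Matrix.of fun _ _ => u) * V.gram * (Matrix.of fun _ _ => u) :
        Matrix (Fin 1) (Fin 1) E) 0 0 =
        V.gram 0 0
      simp only [conjT, Matrix.mul_apply, Fin.sum_univ_one, Matrix.transpose_apply,
        Matrix.map_apply, Matrix.of_apply]
      linear_combination V.gram 0 0 * hu1
    refine ⟨(⟨w, hwU⟩, 1), ?_⟩
    rw [smul_hom_eq]
    ext i j
    fin_cases i; fin_cases j
    change ((Matrix.of fun _ _ => u) * y * _ : Matrix (Fin 1) (Fin 1) E) 0 0 = y' 0 0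
    simp only [Matrix.mul_apply, Fin.sum_univ_one, Matrix.of_apply, OneMemClass.coe_one, inv_one,
      Units.val_one, Matrix.one_apply_eq, mul_one]
    rw [hu]
    field_simp
  · rintro ⟨g, rfl⟩
    refine ⟨g.1, g.2, smul_hom_eq g y, ?_⟩
    have h1 : HermSpace.adj V V (((g.2 : GL (Fin 1) E)⁻¹ : GL (Fin 1) E) :
        Matrix (Fin 1) (Fin 1) E) = ((g.2 : GL (Fin 1) E) : Matrix (Fin 1) (Fin 1) E) := by
      have := HermSpace.adj_coe_U g.2⁻¹
      simpa using this
    rw [smul_hom_eq, HermSpace.adj_mul V V V, HermSpace.adj_mul V V V, HermSpace.adj_coe_U, h1,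
      mul_assoc]

theorem continuous_smul_fin_one (V : HermSpace σ (Fin 1)) (y : Matrix (Fin 1) (Fin 1) E) :
    Continuous fun g : V.U × V.U => g • y := by
  have h1 : Continuous fun g : V.U => ((g : GL (Fin 1) E) : Matrix (Fin 1) (Fin 1) E) :=
    Units.continuous_val.comp continuous_subtype_val
  have h3 : (fun g : V.U × V.U => g • y) = fun g : V.U × V.U =>
      ((g.1 : GL (Fin 1) E) : Matrix (Fin 1) (Fin 1) E) * y *
      (((g.2⁻¹ : V.U) : GL (Fin 1) E) : Matrix (Fin 1) (Fin 1) E) := by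
    funext g
    rw [smul_hom_eq]
    rfl
  rw [h3]
  exact ((h1.comp continuous_fst).mul continuous_const).mul (h1.comp continuous_snd.inv)

/-- The stable orbital integral of an invariant function on a product of two lines. -/
theorem relStableOrbitalIntegral_eq (hv : ∀ z, intValuation E (σ z) = intValuation E z)
    {V : HermSpace σ (Fin 1)} {μ : Measure V.U} (hμ : V.IsUnitHaar μ)
    {y : Matrix (Fin 1) (Fin 1) E × Matrix (Fin 1) (Fin 1) E} (hy₁ : y.1 0 0 ≠ 0)
    (hy₂ : y.2 0 0 ≠ 0) {f : Matrix (Fin 1) (Fin 1) E × Matrix (Fin 1) (Fin 1) E → ℂ}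
    (hf : ∀ (g : (V.U × V.U) × (V.U × V.U)) z, f (g • z) = f z) :
    relStableOrbitalIntegral V V V V μ μ μ μ y f = f y := by
  have := V.compactSpace_U_fin_one hv
  have := hμ.1
  have := V.locallyCompactSpace_U hv
  have hμμ : (μ.prod μ).IsHaarMeasure := inferInstance
  have hμμμ : ((μ.prod μ).prod (μ.prod μ)).IsHaarMeasure := Measure.prod.instIsHaarMeasure _ _
  have hμu : IsProbabilityMeasure μ := ⟨by rw [← V.latticeStab_fin_one hv]; exact hμ.2⟩
  have hcs : ∀ z : Matrix (Fin 1) (Fin 1) E × Matrix (Fin 1) (Fin 1) E,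
      CompactSpace (MulAction.stabilizer ((V.U × V.U) × (V.U × V.U)) z) := by
    intro z
    suffices hs : IsClosed (MulAction.stabilizer ((V.U × V.U) × (V.U × V.U)) z :
        Set ((V.U × V.U) × (V.U × V.U))) from isCompact_iff_compactSpace.1 hs.isCompact
    have h2 : Continuous fun g : (V.U × V.U) × (V.U × V.U) => g • z := by
      change Continuous fun g : (V.U × V.U) × (V.U × V.U) => (g.1 • z.1, g.2 • z.2)
      exact ((continuous_smul_fin_one V z.1).comp continuous_fst).prodMk
        ((continuous_smul_fin_one V z.2).comp continuous_snd)
    exact isClosed_singleton.preimage h2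
  -- The integrand is constant and the compact group has total volume one.
  have hint : ∀ z, orbitalIntegral ((μ.prod μ).prod (μ.prod μ)) z f = f z := by
    intro z
    have := hcs z
    rw [orbitalIntegral_eq_integral]
    · simp only [hf]
      simp
    · simp only [hf]
      exact measurable_const
  have hout : ∀ z : Matrix (Fin 1) (Fin 1) E × Matrix (Fin 1) (Fin 1) E,
      ∃ g : (V.U × V.U) × (V.U × V.U), g • z = Quotient.out (Quotient.mk _ z :
        MulAction.orbitRel.Quotient ((V.U × V.U) × (V.U × V.U))
          (Matrix (Fin 1) (Fin 1) E × Matrix (Fin 1) (Fin 1) E)) := by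
    intro z
    have h1 : (MulAction.orbitRel ((V.U × V.U) × (V.U × V.U))
        (Matrix (Fin 1) (Fin 1) E × Matrix (Fin 1) (Fin 1) E)) (Quotient.out (Quotient.mk _ z :
        MulAction.orbitRel.Quotient ((V.U × V.U) × (V.U × V.U))
          (Matrix (Fin 1) (Fin 1) E × Matrix (Fin 1) (Fin 1) E))) z :=
      Quotient.exact (Quotient.out_eq _)
    exact MulAction.orbitRel_apply.1 h1
  have hst : ∀ z : Matrix (Fin 1) (Fin 1) E × Matrix (Fin 1) (Fin 1) E,
      (StablyConj V V y.1 z.1 ∧ StablyConj V V y.2 z.2) ↔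
        ∃ g : (V.U × V.U) × (V.U × V.U), g • y = z := by
    intro z
    rw [stablyConj_fin_one_iff hy₁, stablyConj_fin_one_iff hy₂]
    constructor
    · rintro ⟨⟨g, hg⟩, ⟨h, hh⟩⟩
      exact ⟨(g, h), Prod.ext hg hh⟩
    · rintro ⟨g, rfl⟩
      exact ⟨⟨g.1, rfl⟩, ⟨g.2, rfl⟩⟩
  rw [relStableOrbitalIntegral, stableOrbitalIntegral, kappaOrbitalIntegral]
  let U : Unique {o : MulAction.orbitRel.Quotient ((V.U × V.U) × (V.U × V.U))
      (Matrix (Fin 1) (Fin 1) E × Matrix (Fin 1) (Fin 1) E) //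
      StablyConj V V y.1 (Quotient.out o).1 ∧ StablyConj V V y.2 (Quotient.out o).2} :=
    { default := ⟨Quotient.mk _ y, (hst _).2 (hout y)⟩
      uniq := by
        rintro ⟨o, ho⟩
        obtain ⟨g, hg⟩ := (hst _).1 ho
        refine Subtype.ext ?_
        change o = Quotient.mk _ y
        rw [← Quotient.out_eq o]
        apply Quotient.sound
        exact MulAction.orbitRel_apply.2 ⟨g, hg⟩ }
  rw [finsum_unique, one_mul, hint]
  obtain ⟨g, hg⟩ := hout y
  change f (Quotient.out (Quotient.mk _ y)) = f y
  rw [← hg, hf]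

end StableOrbitalIntegral
end

/-! ### Comparison of both sides and the theorem. -/

noncomputable section
section Transfer

open WithZero

theorem Finset.sum_neg_one_pow_mul (s : Finset ℕ) (f : ℕ → ℕ) :
    ∑ k ∈ s, (-1 : ℤ) ^ k * f k =
      (∑ k ∈ s.filter (fun k => k % 2 = 0), f k : ℕ) -
        (∑ k ∈ s.filter (fun k => k % 2 = 1), f k : ℕ) := by
  rw [Finset.sum_filter, Finset.sum_filter]
  push_cast
  rw [← Finset.sum_sub_distrib]
  refine Finset.sum_congr rfl fun k _ => ?_
  rcases Nat.mod_two_eq_zero_or_one k with h | h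
  · simp [h, (Nat.even_iff.2 h).neg_one_pow]
  · simp [h, (Nat.odd_iff.2 h).neg_one_pow]

variable {F E : Type*} [Field F] [ValuativeRel F] [TopologicalSpace F]
  [IsNonarchimedeanLocalField F]
  [Field E] [ValuativeRel E] [TopologicalSpace E] [IsNonarchimedeanLocalField E]
  [Algebra F E] {σ : E ≃ₐ[F] E}

omit [Field F] [ValuativeRel F] [TopologicalSpace F] [IsNonarchimedeanLocalField F]
  [Algebra F E] in
theorem endIndicator_fin_one {y : Matrix (Fin 1) (Fin 1) E} {i : ℤ}
    (h : intValuation E (y 0 0) = exp (-i)) :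
    endIndicator E (Fin 1) y = if 0 ≤ i then 1 else 0 := by
  have h1 : y ∈ endLattice E (Fin 1) ↔ 0 ≤ i := by
    rw [mem_endLattice_iff, IsIntegralMatrix]
    simp only [Fin.forall_fin_one, h, ← exp_zero (M := ℤ), exp_le_exp]
    omega
  classical
  rw [endIndicator, Set.indicator_apply]
  simp only [h1, Pi.one_apply]

theorem isSchwartz_mul_endIndicator (n : Type*) [Fintype n] [DecidableEq n] :
    IsSchwartz fun y : Matrix n n E × Matrix n n E =>
      endIndicator E n y.1 * endIndicator E n y.2 := by
  have h := isSchwartz_endIndicator (E := E) (n := n)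
  refine ⟨(h.1.comp_continuous continuous_fst).mul (h.1.comp_continuous continuous_snd), ?_⟩
  refine HasCompactSupport.intro
    (K := tsupport (endIndicator E n) ×ˢ tsupport (endIndicator E n)) (h.2.prod h.2) ?_
  intro y hy
  rw [Set.mem_prod, not_and_or] at hy
  rcases hy with hy | hy
  · rw [image_eq_zero_of_notMem_tsupport hy, zero_mul]
  · rw [image_eq_zero_of_notMem_tsupport hy, mul_zero]

omit [ValuativeRel F] [TopologicalSpace F] [IsNonarchimedeanLocalField F] in
theorem endIndicator_smul (hv : ∀ z, intValuation E (σ z) = intValuation E z)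
    {V : HermSpace σ (Fin 1)} (g : V.U × V.U) (y : Matrix (Fin 1) (Fin 1) E) :
    endIndicator E (Fin 1) (g • y) = endIndicator E (Fin 1) y := by
  have h1 : ∀ (g : V.U × V.U) {y : Matrix (Fin 1) (Fin 1) E}, y ∈ endLattice E (Fin 1) →
      g • y ∈ endLattice E (Fin 1) := by
    intro g y hy
    rw [mem_endLattice_iff] at hy ⊢
    rw [smul_hom_eq]
    exact ((HermSpace.isIntegralMatrix_fin_one hv g.1).mul hy).mul
      (HermSpace.isIntegralMatrix_fin_one hv g.2⁻¹)
  by_cases hy : y ∈ endLattice E (Fin 1)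
  · rw [endIndicator, Set.indicator_of_mem hy, Set.indicator_of_mem (h1 g hy)]
    rfl
  · rw [endIndicator, Set.indicator_of_notMem hy, Set.indicator_of_notMem]
    intro h2
    apply hy
    have := h1 g⁻¹ h2
    rwa [inv_smul_smul] at this

theorem stableOrbitalIntegral_zero {G X : Type*} [Group G] [TopologicalSpace G]
    [MeasurableSpace G] [MulAction G X] (μ : Measure G) (st : X → X → Prop) (x : X) :
    stableOrbitalIntegral μ st x (fun _ => 0) = 0 := by
  simp [stableOrbitalIntegral, kappaOrbitalIntegral, orbitalIntegral]

namespace UnramifiedQuadratic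

variable (D : UnramifiedQuadratic σ (intValuation E)
  (Nat.card (IsLocalRing.ResidueField (valuation F).integer)))
include D

/-- The fundamental lemma for a matching pair of elements. -/
theorem relStableOrbitalIntegral_eq_transfer
    (hunram : ∀ a : F, intValuation E (algebraMap F E a) = intValuation F a)
    (hnorm : ∀ z : E, algebraMap F E (Algebra.norm F z) = z * σ z)
    {V : HermSpace σ (Fin 2)} {V₁ : HermSpace σ (Fin 1)}
    (hV : V.IsSelfDual) (hV₁ : V₁.IsSelfDual)
    {μ : Measure V.U} (hμ : V.IsUnitHaar μ) {μ₁ : Measure V₁.U} (hμ₁ : V₁.IsUnitHaar μ₁)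
    {x : Matrix (Fin 2) (Fin 2) E} {y : Matrix (Fin 1) (Fin 1) E × Matrix (Fin 1) (Fin 1) E}
    (hy : IsRegSSPair V₁ V₁ V₁ V₁ y) (hm : IsMatching V V₁ V₁ V₁ V₁ x y) :
    relStableOrbitalIntegral V₁ V₁ V₁ V₁ μ₁ μ₁ μ₁ μ₁ y
        (fun y => endIndicator E (Fin 1) y.1 * endIndicator E (Fin 1) y.2) =
      relTransferFactor V V₁ V₁ V₁ V₁ y x *
        relKappaOrbitalIntegral V μ (eigF F (contraction V₁ V₁ y.2)) x (endIndicator E (Fin 2)) := by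
  have hVi := hV.isIntegralMatrix
  have hVd := hV.v_det D.v_conj
  have hγ : intValuation E (V₁.gram 0 0) = 1 := by
    have h := hV₁.v_det D.v_conj
    rwa [Matrix.det_fin_one] at h
  obtain ⟨ca, hca, hca'⟩ := D.exists_contraction_eq V₁ V₁ y.1
  obtain ⟨cb, hcb, hcb'⟩ := D.exists_contraction_eq V₁ V₁ y.2
  rw [div_self V₁.gram_fin_one_ne_zero, mul_one] at hca' hcb'
  have hya := hy.1.apply_ne_zero
  have hyb := hy.2.1.apply_ne_zero
  set ta := y.1 0 0 with hta
  set tb := y.2 0 0 with htb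
  have hs : ∀ {z : E}, z ≠ 0 → σ z ≠ 0 := fun hz => by simpa using hz
  have ha0 : ca ≠ 0 := fun h0 => by
    rw [h0, map_zero] at hca'
    exact neg_ne_zero.2 (mul_ne_zero hya (hs hya)) hca'.symm
  have hb0 : cb ≠ 0 := fun h0 => by
    rw [h0, map_zero] at hcb'
    exact neg_ne_zero.2 (mul_ne_zero hyb (hs hyb)) hcb'.symm
  have hc : ca ≠ cb := by
    have h1 := hy.2.2
    rw [hca, hcb] at h1
    exact fun h => ne_of_separable_dsum h1 (congrArg _ h)
  rw [IsMatching, hca, hcb] at hm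
  obtain ⟨ε, hε, hT⟩ := exists_hasType (D := D) hVd hc hm
  obtain ⟨x', hT'⟩ := hT.exists_opposite hVi hVd
  obtain ⟨i, hi⟩ := (intValuation E).exists_eq_exp_neg hya
  obtain ⟨j, hj⟩ := (intValuation E).exists_eq_exp_neg hyb
  have hdiff : algebraMap F E (ca - cb) = tb * σ tb - ta * σ ta := by
    rw [map_sub, hca', hcb']; ring
  have hdne : algebraMap F E (ca - cb) ≠ 0 :=
    (map_ne_zero _).2 (sub_ne_zero.2 hc)
  obtain ⟨e, he⟩ := (intValuation E).exists_eq_exp_neg hdne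
  obtain ⟨N, hN, hsum⟩ := exists_sum_pairCount (D := D) hi hj (hdiff ▸ he)
  -- The orbital integral of the elements of type `η`.
  set R : ℕ → ℕ := fun η => ∑ n ∈ Finset.range N,
    ∑ k ∈ (Finset.range (2 * n + 1)).filter (fun k => k % 2 = η), D.pairCount ta tb n k with hR
  have hRO : ∀ {η : ℕ} {z : Matrix (Fin 2) (Fin 2) E}, η ≤ 1 → D.HasType V ca cb η z →
      orbitalIntegral (μ.prod μ) z (endIndicator E (Fin 2)) = (R η : ℂ) := fun hη hz =>
    HasType.orbitalIntegral_eq_sum hμ hVi hVd hη hz hc hya hyb (by rw [hca', neg_neg])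
      (by rw [hcb', neg_neg]) hN
  have hR01 : (R 0 : ℤ) - R 1 = if 0 ≤ i ∧ 0 ≤ j then
      (-(Nat.card (IsLocalRing.ResidueField (valuation F).integer) : ℤ)) ^ e.toNat else 0 := by
    rw [← hsum, hR]
    simp only
    push_cast
    rw [← Finset.sum_sub_distrib]
    refine Finset.sum_congr rfl fun n _ => ?_
    rw [Finset.sum_neg_one_pow_mul]
    push_cast
    rfl
  -- The sign of the type of `x`. It enters both `RO^κ`, which is the integral of the type of `x`
  -- minus the other one, and the transfer factor, so it cancels.
  set s : ℂ := if ε = 0 then 1 else -1 with hsdef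
  have hss : s * s = 1 := by rw [hsdef]; split_ifs <;> norm_num
  have hκ : relKappaOrbitalIntegral V μ cb x (endIndicator E (Fin 2)) =
      s * (((R 0 : ℤ) - R 1 : ℤ) : ℂ) := by
    rw [HasType.kappaOrbitalIntegral_eq hnorm hμ hVd hT hε hc ha0 hb0 hT']
    rcases hε with rfl | rfl
    · rw [hRO (η := 0) (by norm_num) hT, hRO (η := 1) le_rfl hT', hsdef, if_pos rfl]
      push_cast; ring
    · rw [hRO (η := 1) le_rfl hT, hRO (η := 0) (by norm_num) hT', hsdef, if_neg one_ne_zero]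
      push_cast; ring
  have hΔ : relTransferFactor V V₁ V₁ V₁ V₁ y x = s * (-1) ^ e *
      (Nat.card (IsLocalRing.ResidueField (valuation F).integer) : ℂ) ^ (-e) := by
    obtain ⟨P, P', hP⟩ := hT
    -- The reference operator on `V₁ ⊕ V₁` has type zero, so its invariant against `r(x)` is the
    -- sign `s`.
    obtain ⟨Q, Q', hQ⟩ := exists_frame_sum (ca := ca) (cb := cb) D hγ
    rw [relTransferFactor, transferFactor, hca, hcb, if_pos hm, eigF_of, eigF_of,
      kappaInv_eq hnorm hc hP hQ hε (Or.inl rfl), D.omega_eq hnorm he,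
      absF_eq ((hunram _).symm.trans he)]
    push_cast
    rfl
  rw [relStableOrbitalIntegral_eq D.v_conj hμ₁ hya hyb fun g z => by
    change endIndicator E (Fin 1) (g.1 • z.1) * endIndicator E (Fin 1) (g.2 • z.2) = _
    rw [endIndicator_smul D.v_conj, endIndicator_smul D.v_conj], hΔ, hcb, eigF_of, hκ, hR01,
    endIndicator_fin_one hi, endIndicator_fin_one hj]
  by_cases hij : 0 ≤ i ∧ 0 ≤ j
  -- Needed to identify `e.toNat` with `e`: for integral `ta`, `tb` the difference of norms is
  -- integral.
  · have he0 : 0 ≤ e := by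
      have hle : ∀ {t : E} {l : ℤ}, intValuation E t = exp (-l) → 0 ≤ l →
          intValuation E (t * σ t) ≤ exp 0 := fun ht hl => by
        rw [map_mul, D.v_conj, ht, ← exp_add, exp_le_exp]
        omega
      have h1 := (Valuation.map_sub (intValuation E) (tb * σ tb) (ta * σ ta)).trans
        (max_le (hle hj hij.2) (hle hi hij.1))
      rw [← hdiff, he, exp_le_exp] at h1
      omega
    obtain ⟨l, rfl⟩ := Int.eq_ofNat_of_zero_le he0
    have hq0 : (Nat.card (IsLocalRing.ResidueField (valuation F).integer) : ℂ) ≠ 0 := by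
      have := D.one_lt_q
      exact_mod_cast (by omega : Nat.card (IsLocalRing.ResidueField (valuation F).integer) ≠ 0)
    rw [if_pos hij, if_pos hij.1, if_pos hij.2]
    push_cast
    rw [zpow_neg, zpow_natCast, zpow_natCast, Int.toNat_natCast,
      neg_pow (Nat.card (IsLocalRing.ResidueField (valuation F).integer) : ℂ)]
    have hl : ((-1 : ℂ) ^ l) * (-1) ^ l = 1 := by rw [← mul_pow]; norm_num
    have hql := mul_inv_cancel₀ (pow_ne_zero l hq0)
    linear_combination (-1 : ℂ) * (hss * 1) - hl * (s * s) - hql * (s * s * ((-1) ^ l * (-1) ^ l))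
  · rw [if_neg hij, Int.cast_zero, mul_zero, mul_zero]
    split_ifs <;> simp_all

end UnramifiedQuadratic
end Transfer

theorem mainTheorem1
    {F E : Type*} [Field F] [ValuativeRel F] [TopologicalSpace F] [IsNonarchimedeanLocalField F]
    [Field E] [ValuativeRel E] [TopologicalSpace E] [IsNonarchimedeanLocalField E]
    [Algebra F E] [ValuativeExtension F E]
    (hodd : ringChar (IsLocalRing.ResidueField (valuation F).integer) ≠ 2)
    (hquad : Module.finrank F E = 2) (hunram : IsUnramifiedExt F E)
    (σ : E ≃ₐ[F] E) (hσ : σ ≠ 1)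
    (V₂ : HermSpace σ (Fin 2)) (hV₂ : V₂.IsSelfDual)
    (V₁ : HermSpace σ (Fin 1)) (hV₁ : V₁.IsSelfDual)
    (μ₂ : Measure V₂.U) (hμ₂ : V₂.IsUnitHaar μ₂)
    (μ₁ : Measure V₁.U) (hμ₁ : V₁.IsUnitHaar μ₁) :
    AreSmoothTransfers V₂ V₁ V₁ V₁ V₁ μ₂ μ₁ μ₁ μ₁ μ₁ (endIndicator E (Fin 2))
        (fun y => endIndicator E (Fin 1) y.1 * endIndicator E (Fin 1) y.2) ∧
      ∀ (Vα Vβ : HermSpace σ (Fin 1)) (μα : Measure Vα.U) (μβ : Measure Vβ.U),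
        Vα.IsUnitHaar μα → Vβ.IsUnitHaar μβ →
        ¬ (Vα.Isometric V₁ ∧ Vβ.Isometric V₁) →
        AreSmoothTransfers V₂ V₁ V₁ Vα Vβ μ₂ μ₁ μ₁ μα μβ (endIndicator E (Fin 2))
          (fun _ => 0) := by
  obtain ⟨D⟩ := exists_unramifiedQuadratic hodd hquad hunram hσ
  have hnorm := algebraMap_norm_quadratic hquad hσ
  have hval := intValuation_algebraMap (F := F) (E := E) hunram
  have hVi := hV₂.isIntegralMatrix
  have hVd := hV₂.v_det D.v_conj
  have hγ : intValuation E (V₁.gram 0 0) = 1 := by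
    have h := hV₁.v_det D.v_conj
    rwa [Matrix.det_fin_one] at h
  have hs : ∀ {z : E}, z ≠ 0 → σ z ≠ 0 := fun hz => by simpa using hz
  refine ⟨⟨isSchwartz_endIndicator, isSchwartz_mul_endIndicator (Fin 1), fun x y _ hy hm =>
    D.relStableOrbitalIntegral_eq_transfer hval hnorm hV₂ hV₁ hμ₂ hμ₁ hy hm, ?_⟩, ?_⟩
  -- For the split pair the vanishing condition is empty: every pair of negatives of norms is
  -- realized on the plane.
  · intro y hy hne
    exfalso
    apply hne
    obtain ⟨ca, hca, hca'⟩ := D.exists_contraction_eq V₁ V₁ y.1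
    obtain ⟨cb, hcb, hcb'⟩ := D.exists_contraction_eq V₁ V₁ y.2
    rw [div_self V₁.gram_fin_one_ne_zero, mul_one] at hca' hcb'
    have hc : ca ≠ cb := by
      have h1 := hy.2.2
      rw [hca, hcb] at h1
      exact fun h => ne_of_separable_dsum h1 (congrArg _ h)
    simp only [IsMatching, hca, hcb]
    exact D.exists_isJLTransfer hVi hVd hy.1.apply_ne_zero hy.2.1.apply_ne_zero hca' hcb' hc hγ
  · intro Vα Vβ μα μβ _ _ hiso
    refine ⟨isSchwartz_endIndicator, ⟨IsLocallyConstant.const 0, HasCompactSupport.zero⟩, ?_,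
      fun y _ _ => stableOrbitalIntegral_zero _ _ y⟩
    intro x y _ hy hm
    obtain ⟨ca, hca, hca'⟩ := D.exists_contraction_eq V₁ Vα y.1
    obtain ⟨cb, hcb, hcb'⟩ := D.exists_contraction_eq V₁ Vβ y.2
    have hc : ca ≠ cb := by
      have h1 := hy.2.2
      rw [hca, hcb] at h1
      exact fun h => ne_of_separable_dsum h1 (congrArg _ h)
    rw [IsMatching, hca, hcb] at hm
    obtain ⟨ε, hε, hT⟩ := UnramifiedQuadratic.exists_hasType (D := D) hVd hc hm
    -- The valuation of the eigenvalue has the parity of the Gram entry of `W`, and even parity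
    -- means that `W` is isometric to the unimodular line.
    have hvc : ∀ {W : HermSpace σ (Fin 1)} {z : E} {c : F}, z ≠ 0 →
        algebraMap F E c = -(z * σ z * (V₁.gram 0 0 / W.gram 0 0)) →
        ∃ k : ℤ, intValuation E (algebraMap F E c) = WithZero.exp (-k) ∧
          (Even k → W.Isometric V₁) := by
      intro W z c hz hcz
      obtain ⟨l, hl⟩ := D.exists_v_norm hz
      obtain ⟨w, hw⟩ := (intValuation E).exists_eq_exp_neg W.gram_fin_one_ne_zero
      refine ⟨2 * l - w, ?_, ?_⟩
      · rw [hcz, Valuation.map_neg, map_mul, hl, map_div₀, hγ, hw, one_div, ← WithZero.exp_neg,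
          ← WithZero.exp_add]
        congr 1
        ring
      · rintro ⟨k, hk⟩
        exact D.isometric_of_even hγ (k := l - k) (by rw [hw]; congr 2; omega)
    obtain ⟨a, ha, haiso⟩ := hvc hy.1.apply_ne_zero hca'
    obtain ⟨b, hb, hbiso⟩ := hvc hy.2.1.apply_ne_zero hcb'
    -- A match forces equal parities, so if one of the two lines is not isometric to `V₁`, both
    -- valuations are odd.
    have hab := hT.even_add ha hb
    have hao : Odd a := by
      by_contra h
      rw [Int.not_odd_iff_even] at h
      exact hiso ⟨haiso h, hbiso ((Int.even_add.1 hab).1 h)⟩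
    have hbo : Odd b := by
      by_contra h
      rw [Int.not_odd_iff_even] at h
      exact Int.not_even_iff_odd.2 hao ((Int.even_add.1 hab).2 h)
    rw [hcb, eigF_of,
      UnramifiedQuadratic.HasType.kappaOrbitalIntegral_eq_zero hnorm hμ₂ hVi hVd hT hε
      hc ha hb hao hbo, mul_zero]
    exact stableOrbitalIntegral_zero _ _ y
end
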